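/- Let $k$ be an algebraically closed field of characteristic zero and $n\ge 0$ an integer. A group-valued prestack over $k$ is a functor $H$ from commutative $k$-algebras to groups, and a representation of $H$ on a $k$-vector space $V$ is a family of group homomorphisms $H(R)\to GL_R(V\otimes_k R)$ natural in the $k$-algebra $R$; with the $k$-linear maps $V \to W$ that commute with all these actions, representations form a category $\mathrm{Rep}(H)$. Let $G$ be the group-valued prestack sending $R$ to the group $G(R)$ of $R$-algebra automorphisms of $R[[t_1,\dots,t_n]]$ that are continuous for the $(t_1,\dots,t_n)$-adic topology, and let $K(R)\subseteq G(R)$ be the subgroup of those $\rho$ for which every $\rho(t_i)$ has zero constant term. For $S=\operatorname{Spec}R$, a common étale neighbourhood of the trivial pointed family $S\times\mathbb A^n\rightleftarrows S$ (with zero section $z$) with itself is a smooth $S$-scheme $V\to S$ of relative dimension $n$ with a section $\tau$, together with two étale $S$-morphisms $\phi,\psi:V\to S\times\mathbb A^n$ such that $\phi\circ\tau$ and $\psi\circ\tau$ agree with $z$ on $S_{\mathrm{red}}$; it is strict if $\phi\circ\tau=\psi\circ\tau=z$. Completing along the sections gives isomorphisms $\hat\phi,\hat\psi:\hat V\to S\times\hat{\mathbb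 A}^n$, hence an automorphism $\hat\phi\circ\hat\psi^{-1}$ of $S\times\hat{\mathbb A}^n$, i.e. an element of $G(R)$. Let $G^{\text{ét}}(R)\subseteq G(R)$ be the subgroup of all elements arising in this way, and $K^{\text{ét}}(R)\subseteq K(R)$ the subgroup of those arising from strict common étale neighbourhoods. A representation of $G^{\text{ét}}$ is called $K^{\text{ét}}$-locally-finite if every vector lies in a finite-dimensional subspace $W \subseteq V$ that is $K^{\text{ét}}$-stable (that is, $W\otimes_k R$ is stable under $K^{\text{ét}}(R)$ for every $R$). Then: (1) the restriction functor $\mathrm{Rep}(G)\to\mathrm{Rep}(G^{\text{ét}})$ is fully faithful; (2) its essential image is exactly the full subcategory of $K^{\text{ét}}$-locally-finite representations of $G^{\text{ét}}$; (3) every $K^{\text{ét}}$-locally-finite representation $G^{\text{ét}}\to GL_V$ extends uniquely to a representation $G\to GL_V$ on the same vector space $V$. -/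

import Mathlib

universe u w

open CategoryTheory AlgebraicGeometry Limits TensorProduct

noncomputable section

namespace FormalDisc

section PowerSeries

variable (n : ℕ) (R : Type u) [CommRing R]

/-- The ideal `𝔪 = (t₁, …, tₙ)` of `R⟦t₁, …, tₙ⟧`. -/
def maxIdeal : Ideal (MvPowerSeries (Fin n) R) :=
  Ideal.span (Set.range fun i => MvPowerSeries.X i)

variable {n R}
variable {R' : Type u} [CommRing R'] {R'' : Type u} [CommRing R'']

/-- Continuity of a ring homomorphism for the `𝔪`-adic topologies. -/
def IsAdicContinuous (φ : MvPowerSeries (Fin n) R →+* MvPowerSeries (Fin n) R') : Prop :=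
  ∀ N : ℕ, ∃ M : ℕ, maxIdeal n R ^ M ≤ Ideal.comap φ (maxIdeal n R' ^ N)

theorem X_mem_maxIdeal (i : Fin n) : (MvPowerSeries.X i : MvPowerSeries (Fin n) R) ∈ maxIdeal n R :=
  Ideal.subset_span ⟨i, rfl⟩

theorem mem_pow_of_coeff (N : ℕ) : ∀ f : MvPowerSeries (Fin n) R,
    (∀ d : Fin n →₀ ℕ, d.degree < N → MvPowerSeries.coeff d f = 0) → f ∈ maxIdeal n R ^ N := by
  classical
  induction N with
  | zero => intro f _; simp
  | succ N ih =>
    intro f hf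
    have h0 : ∀ d : Fin n →₀ ℕ, d.degree = 0 → MvPowerSeries.coeff d f = 0 :=
      fun d hd => hf d (by omega)
    let c : (Fin n →₀ ℕ) → Option (Fin n) := fun d =>
      if h : ∃ i, d i ≠ 0 then some h.choose else none
    have hc : ∀ d i, c d = some i → d i ≠ 0 := by
      intro d i hi
      simp only [c] at hi
      split_ifs at hi with h
      have := h.choose_spec
      rwa [Option.some.inj hi] at this
    have hc' : ∀ d : Fin n →₀ ℕ, d ≠ 0 → ∃ i, c d = some i := by
      intro d hd
      have h : ∃ i, d i ≠ 0 := by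
        by_contra! h
        exact hd (Finsupp.ext h)
      exact ⟨h.choose, by simp [c, h]⟩
    let g : Fin n → MvPowerSeries (Fin n) R := fun i d =>
      if c (d + Finsupp.single i 1) = some i then
        MvPowerSeries.coeff (d + Finsupp.single i 1) f else 0
    have hg : ∀ i d, MvPowerSeries.coeff d (g i) =
      if c (d + Finsupp.single i 1) = some i then
        MvPowerSeries.coeff (d + Finsupp.single i 1) f else 0 := fun i d => rfl
    have hmem : ∀ i, g i ∈ maxIdeal n R ^ N := by
      intro i
      apply ih
      intro d hd
      rw [hg]
      split_ifs
      · exact hf _ (by simp; omega)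
      · rfl
    have hsum : f = ∑ i, MvPowerSeries.X i * g i := by
      ext d
      rw [map_sum]
      have key : ∀ i, MvPowerSeries.coeff d (MvPowerSeries.X i * g i) =
          if c d = some i then MvPowerSeries.coeff d f else 0 := by
        intro i
        rw [MvPowerSeries.X, MvPowerSeries.coeff_monomial_mul, one_mul]
        by_cases hd : Finsupp.single i 1 ≤ d
        · rw [if_pos hd, hg, tsub_add_cancel_of_le hd]
        · rw [if_neg hd, if_neg]
          intro h
          apply hd
          rw [Finsupp.single_le_iff]
          have := hc d i h
          omega
      simp_rw [key]
      by_cases hd : d = 0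
      · rw [hd, h0 0 (by simp)]; simp
      · obtain ⟨i, hi⟩ := hc' d hd
        simp [hi]
    rw [hsum, pow_succ']
    exact Ideal.sum_mem _ fun i _ => Ideal.mul_mem_mul (X_mem_maxIdeal i) (hmem i)

theorem maxIdeal_le_ker : maxIdeal n R ≤ RingHom.ker (MvPowerSeries.constantCoeff (σ := Fin n) (R := R)) := by
  rw [maxIdeal, Ideal.span_le]
  rintro _ ⟨i, rfl⟩
  simp

theorem sub_C_mem (f : MvPowerSeries (Fin n) R) :
    f - MvPowerSeries.C (MvPowerSeries.constantCoeff f) ∈ maxIdeal n R := by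
  have := mem_pow_of_coeff 1 (f - MvPowerSeries.C (MvPowerSeries.constantCoeff f)) (by
    intro d hd
    have : d = 0 := (Finsupp.degree_eq_zero_iff d).1 (by omega)
    subst this
    simp)
  simpa using this

theorem coeff_eq_zero_of_mem_pow (N : ℕ) : ∀ f ∈ maxIdeal n R ^ N,
    ∀ d : Fin n →₀ ℕ, d.degree < N → MvPowerSeries.coeff d f = 0 := by
  classical
  induction N with
  | zero => intro f _ d hd; omega
  | succ N ih =>
    intro f hf
    rw [pow_succ'] at hf
    induction hf using Submodule.mul_induction_on' with
    | mem_mul_mem r hr s hs =>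
      intro d hd
      rw [MvPowerSeries.coeff_mul]
      apply Finset.sum_eq_zero
      rintro ⟨a, b⟩ hab
      replace hab : a + b = d := Finset.HasAntidiagonal.mem_antidiagonal.1 hab
      by_cases ha : a = 0
      · have : MvPowerSeries.coeff a r = 0 := by
          rw [ha]; exact maxIdeal_le_ker hr
        simp [this]
      · have hb : b.degree < N := by
          have h1 : a.degree + b.degree = d.degree := by rw [← hab]; simp
          have h2 : a.degree ≠ 0 := fun h => ha ((Finsupp.degree_eq_zero_iff a).1 h)
          omega
        simp [ih s hs b hb]
    | add x _ y _ hx hy =>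
      intro d hd
      rw [map_add, hx d hd, hy d hd, add_zero]

theorem IsAdicContinuous.comp {ψ : MvPowerSeries (Fin n) R' →+* MvPowerSeries (Fin n) R''}
    {φ : MvPowerSeries (Fin n) R →+* MvPowerSeries (Fin n) R'}
    (hψ : IsAdicContinuous ψ) (hφ : IsAdicContinuous φ) : IsAdicContinuous (ψ.comp φ) := by
  intro N
  obtain ⟨M, hM⟩ := hψ N
  obtain ⟨L, hL⟩ := hφ M
  exact ⟨L, fun x hx => hM (hL hx)⟩

theorem IsAdicContinuous.id : IsAdicContinuous (RingHom.id (MvPowerSeries (Fin n) R)) :=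
  fun N => ⟨N, le_rfl⟩

theorem isAdicContinuous_of_mem_radical
    {φ : MvPowerSeries (Fin n) R →+* MvPowerSeries (Fin n) R'}
    (h : ∀ i, φ (MvPowerSeries.X i) ∈ (maxIdeal n R').radical) : IsAdicContinuous φ := by
  have hmap : Ideal.map φ (maxIdeal n R) =
      Ideal.span (Set.range fun i => φ (MvPowerSeries.X i)) := by
    rw [maxIdeal, Ideal.map_span, ← Set.range_comp]
    rfl
  have hle : Ideal.map φ (maxIdeal n R) ≤ (maxIdeal n R').radical := by
    rw [hmap, Ideal.span_le]
    rintro _ ⟨i, rfl⟩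
    exact h i
  have hfg : (Ideal.map φ (maxIdeal n R)).FG := by
    rw [hmap]
    exact Submodule.fg_span (Set.finite_range _)
  obtain ⟨L, hL⟩ := Ideal.exists_pow_le_of_le_radical_of_fg hle hfg
  intro N
  refine ⟨L * N, ?_⟩
  rw [← Ideal.map_le_iff_le_comap, Ideal.map_pow, pow_mul]
  exact Ideal.pow_right_mono hL N

theorem IsAdicContinuous.isNilpotent
    {φ : MvPowerSeries (Fin n) R →+* MvPowerSeries (Fin n) R'}
    (h : IsAdicContinuous φ) (i : Fin n) :
    IsNilpotent (MvPowerSeries.constantCoeff (φ (MvPowerSeries.X i))) := by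
  obtain ⟨M, hM⟩ := h 1
  refine ⟨M, ?_⟩
  have := hM (Ideal.pow_mem_pow (X_mem_maxIdeal i) M)
  rw [Ideal.mem_comap, pow_one, map_pow] at this
  rw [← map_pow]
  exact maxIdeal_le_ker this

theorem mem_radical_of_isNilpotent {f : MvPowerSeries (Fin n) R}
    (h : IsNilpotent (MvPowerSeries.constantCoeff f)) : f ∈ (maxIdeal n R).radical := by
  have h1 : MvPowerSeries.C (MvPowerSeries.constantCoeff f) ∈ (maxIdeal n R).radical := by
    obtain ⟨M, hM⟩ := h
    refine ⟨M, ?_⟩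
    rw [← map_pow, hM, map_zero]
    exact zero_mem _
  have h2 := Ideal.le_radical (sub_C_mem f)
  simpa using add_mem h2 h1

theorem ringHom_ext {φ ψ : MvPowerSeries (Fin n) R →+* MvPowerSeries (Fin n) R'}
    (hφ : IsAdicContinuous φ) (hψ : IsAdicContinuous ψ)
    (hC : ∀ r, φ (MvPowerSeries.C r) = ψ (MvPowerSeries.C r))
    (hX : ∀ i, φ (MvPowerSeries.X i) = ψ (MvPowerSeries.X i)) : φ = ψ := by
  have hpoly : ∀ p : MvPolynomial (Fin n) R, φ (p : MvPowerSeries (Fin n) R) = ψ p := by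
    have : φ.comp MvPolynomial.coeToMvPowerSeries.ringHom =
        ψ.comp MvPolynomial.coeToMvPowerSeries.ringHom := by
      apply MvPolynomial.ringHom_ext
      · intro r; simpa using hC r
      · intro i; simpa using hX i
    intro p
    exact congrArg (fun f : _ →+* _ => f p) this
  ext f d
  obtain ⟨M₁, h₁⟩ := hφ (d.degree + 1)
  obtain ⟨M₂, h₂⟩ := hψ (d.degree + 1)
  set p := MvPowerSeries.truncTotal (max M₁ M₂) f
  have hp : f - p ∈ maxIdeal n R ^ (max M₁ M₂) := by
    apply mem_pow_of_coeff
    intro e he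
    rw [map_sub, MvPolynomial.coeff_coe, MvPowerSeries.coeff_truncTotal _ he, sub_self]
  have e₁ := coeff_eq_zero_of_mem_pow _ _ (h₁ (Ideal.pow_le_pow_right (le_max_left _ _) hp)) d
    (Nat.lt_succ_self _)
  have e₂ := coeff_eq_zero_of_mem_pow _ _ (h₂ (Ideal.pow_le_pow_right (le_max_right _ _) hp)) d
    (Nat.lt_succ_self _)
  rw [map_sub, map_sub, sub_eq_zero] at e₁ e₂
  rw [e₁, e₂, hpoly]

theorem map_isAdicContinuous (f : R →+* R') :
    IsAdicContinuous (MvPowerSeries.map (σ := Fin n) f) :=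
  isAdicContinuous_of_mem_radical fun i => by
    rw [MvPowerSeries.map_X]
    exact Ideal.le_radical (X_mem_maxIdeal i)

variable (n R) in
/-- `G(R)`: the group of automorphisms of the `R`-algebra `R⟦t₁, …, tₙ⟧` which are continuous
(together with their inverse) for the `𝔪`-adic topology. Multiplication is composition. -/
def G : Subgroup (MvPowerSeries (Fin n) R ≃ₐ[R] MvPowerSeries (Fin n) R) where
  carrier := {ρ | IsAdicContinuous (ρ : MvPowerSeries (Fin n) R →+* MvPowerSeries (Fin n) R) ∧
    IsAdicContinuous (ρ.symm : MvPowerSeries (Fin n) R →+* MvPowerSeries (Fin n) R)}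
  mul_mem' ha hb := ⟨ha.1.comp hb.1, hb.2.comp ha.2⟩
  one_mem' := ⟨IsAdicContinuous.id, IsAdicContinuous.id⟩
  inv_mem' ha := ⟨ha.2, ha.1⟩

/-- The ring endomorphism underlying an element of `G(R)`. -/
def G.hom (ρ : G n R) : MvPowerSeries (Fin n) R →+* MvPowerSeries (Fin n) R :=
  (ρ.1 : MvPowerSeries (Fin n) R →+* MvPowerSeries (Fin n) R)

theorem G.continuous (ρ : G n R) : IsAdicContinuous (G.hom ρ) := ρ.2.1

@[simp] theorem G.hom_C (ρ : G n R) (r : R) : G.hom ρ (MvPowerSeries.C r) = MvPowerSeries.C r :=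
  ρ.1.commutes r

@[simp] theorem G.hom_one : G.hom (1 : G n R) = RingHom.id _ := rfl

theorem G.hom_mul (ρ σ : G n R) : G.hom (ρ * σ) = (G.hom ρ).comp (G.hom σ) := rfl

theorem G.hom_injective {ρ σ : G n R} (h : G.hom ρ = G.hom σ) : ρ = σ :=
  Subtype.ext (AlgEquiv.ext fun x => congrArg (fun f : _ →+* _ => f x) h)

theorem G.hom_hom_inv (ρ : G n R) (x : MvPowerSeries (Fin n) R) :
    G.hom ρ (G.hom ρ⁻¹ x) = x := ρ.1.apply_symm_apply x

theorem G.hom_inv_hom (ρ : G n R) (x : MvPowerSeries (Fin n) R) :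
    G.hom ρ⁻¹ (G.hom ρ x) = x := ρ.1.symm_apply_apply x

theorem G.hasSubst (f : R →+* R') (ρ : G n R) :
    MvPowerSeries.HasSubst fun i => MvPowerSeries.map f (G.hom ρ (MvPowerSeries.X i)) :=
  MvPowerSeries.hasSubst_of_constantCoeff_nilpotent fun i => by
    rw [MvPowerSeries.constantCoeff_map]
    exact ((G.continuous ρ).isNilpotent i).map f

/-- The continuous endomorphism of `R'⟦t⟧` with `tᵢ ↦ f(ρ(tᵢ))`, where `f` is applied to
coefficients. -/
def G.substHom (f : R →+* R') (ρ : G n R) :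
    MvPowerSeries (Fin n) R' →ₐ[R'] MvPowerSeries (Fin n) R' :=
  MvPowerSeries.substAlgHom (G.hasSubst f ρ)

theorem G.substHom_X (f : R →+* R') (ρ : G n R) (i : Fin n) :
    G.substHom f ρ (MvPowerSeries.X i) = MvPowerSeries.map f (G.hom ρ (MvPowerSeries.X i)) :=
  MvPowerSeries.substAlgHom_X _ i

theorem G.substHom_C (f : R →+* R') (ρ : G n R) (r : R') :
    G.substHom f ρ (MvPowerSeries.C r) = MvPowerSeries.C r :=
  (G.substHom f ρ).commutes r

theorem G.substHom_continuous (f : R →+* R') (ρ : G n R) :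
    IsAdicContinuous (G.substHom f ρ : MvPowerSeries (Fin n) R' →+* MvPowerSeries (Fin n) R') :=
  isAdicContinuous_of_mem_radical fun i => by
    rw [RingHom.coe_coe, G.substHom_X]
    apply mem_radical_of_isNilpotent
    rw [MvPowerSeries.constantCoeff_map]
    exact ((G.continuous ρ).isNilpotent i).map f

theorem G.substHom_map (f : R →+* R') (ρ : G n R) (x : MvPowerSeries (Fin n) R) :
    G.substHom f ρ (MvPowerSeries.map f x) = MvPowerSeries.map f (G.hom ρ x) := by
  have := ringHom_ext ((G.substHom_continuous f ρ).comp (map_isAdicContinuous f))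
    ((map_isAdicContinuous f).comp (G.continuous ρ)) (fun r => by
      simp [G.substHom_C]) (fun i => by simp [G.substHom_X])
  exact congrArg (fun f : _ →+* _ => f x) this

theorem G.substHom_substHom_inv (f : R →+* R') (ρ : G n R) (x : MvPowerSeries (Fin n) R') :
    G.substHom f ρ (G.substHom f ρ⁻¹ x) = x := by
  have := ringHom_ext ((G.substHom_continuous f ρ).comp (G.substHom_continuous f ρ⁻¹))
    IsAdicContinuous.id (fun r => by simp [G.substHom_C])
    (fun i => by simp [G.substHom_X, G.substHom_map, G.hom_hom_inv])
  exact congrArg (fun f : _ →+* _ => f x) this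

/-- The image of `ρ ∈ G(R)` in `G(R')` under a ring homomorphism `f : R → R'`: apply `f` to the
coefficients of the series `ρ(tᵢ)`. -/
def G.mapFun (f : R →+* R') (ρ : G n R) : G n R' :=
  ⟨AlgEquiv.ofAlgHom (G.substHom f ρ) (G.substHom f ρ⁻¹)
    (AlgHom.ext fun x => G.substHom_substHom_inv f ρ x)
    (AlgHom.ext fun x => by simpa using G.substHom_substHom_inv f ρ⁻¹ x),
    G.substHom_continuous f ρ, G.substHom_continuous f ρ⁻¹⟩

theorem G.mapFun_X (f : R →+* R') (ρ : G n R) (i : Fin n) :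
    G.hom (G.mapFun f ρ) (MvPowerSeries.X i) = MvPowerSeries.map f (G.hom ρ (MvPowerSeries.X i)) :=
  G.substHom_X f ρ i

theorem G.mapFun_map (f : R →+* R') (ρ : G n R) (x : MvPowerSeries (Fin n) R) :
    G.hom (G.mapFun f ρ) (MvPowerSeries.map f x) = MvPowerSeries.map f (G.hom ρ x) :=
  G.substHom_map f ρ x

theorem G.ext_X {ρ σ : G n R}
    (h : ∀ i, G.hom ρ (MvPowerSeries.X i) = G.hom σ (MvPowerSeries.X i)) : ρ = σ :=
  G.hom_injective (ringHom_ext (G.continuous ρ) (G.continuous σ) (fun r => by simp) h)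

/-- The group homomorphism `G(R) → G(R')` induced by a ring homomorphism `f : R → R'`. -/
def G.map (f : R →+* R') : G n R →* G n R' where
  toFun := G.mapFun f
  map_one' := G.ext_X fun i => by rw [G.mapFun_X]; simp
  map_mul' ρ σ := G.ext_X fun i => by
    rw [G.mapFun_X, G.hom_mul, G.hom_mul, RingHom.comp_apply, RingHom.comp_apply, G.mapFun_X,
      G.mapFun_map]

theorem G.map_hom_X (f : R →+* R') (ρ : G n R) (i : Fin n) :
    G.hom (G.map f ρ) (MvPowerSeries.X i) = MvPowerSeries.map f (G.hom ρ (MvPowerSeries.X i)) :=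
  G.mapFun_X f ρ i

theorem G.map_hom_map (f : R →+* R') (ρ : G n R) (x : MvPowerSeries (Fin n) R) :
    G.hom (G.map f ρ) (MvPowerSeries.map f x) = MvPowerSeries.map f (G.hom ρ x) :=
  G.mapFun_map f ρ x

theorem G.map_id (ρ : G n R) : G.map (RingHom.id R) ρ = ρ :=
  G.ext_X fun i => by rw [G.map_hom_X, MvPowerSeries.map_id, RingHom.id_apply]

theorem G.map_comp (g : R' →+* R'') (f : R →+* R') (ρ : G n R) :
    G.map (g.comp f) ρ = G.map g (G.map f ρ) :=
  G.ext_X fun i => by rw [G.map_hom_X, G.map_hom_X, G.map_hom_X, MvPowerSeries.map_comp]; rfl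

theorem constantCoeff_hom {ρ : G n R}
    (h : ∀ i, MvPowerSeries.constantCoeff (G.hom ρ (MvPowerSeries.X i)) = 0)
    (x : MvPowerSeries (Fin n) R) :
    MvPowerSeries.constantCoeff (G.hom ρ x) = MvPowerSeries.constantCoeff x := by
  have h1 : maxIdeal n R ≤ RingHom.ker
      ((MvPowerSeries.constantCoeff (σ := Fin n) (R := R)).comp (G.hom ρ)) := by
    rw [maxIdeal, Ideal.span_le]
    rintro _ ⟨i, rfl⟩
    exact h i
  have h2 := h1 (sub_C_mem x)
  rw [RingHom.mem_ker, map_sub, sub_eq_zero] at h2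
  simpa using h2

variable (n R) in
/-- `K(R) ⊆ G(R)`: the automorphisms `ρ` such that each `ρ(tᵢ)` has constant term zero. -/
def K : Subgroup (G n R) where
  carrier := {ρ | ∀ i, MvPowerSeries.constantCoeff (G.hom ρ (MvPowerSeries.X i)) = 0}
  one_mem' i := by simp
  mul_mem' {a b} ha hb i := by
    rw [G.hom_mul, RingHom.comp_apply, constantCoeff_hom ha, hb i]
  inv_mem' {a} ha i := by
    rw [← constantCoeff_hom ha, G.hom_hom_inv]
    simp

theorem K.map_mem (f : R →+* R') {ρ : G n R} (h : ρ ∈ K n R) : G.map f ρ ∈ K n R' := by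
  intro i
  rw [G.map_hom_X, MvPowerSeries.constantCoeff_map, h i, map_zero]

end PowerSeries

section Geometry

variable (n : ℕ) (R : Type u) [CommRing R]

/-- The trivial family `S × 𝔸ⁿ` over `S = Spec R`. -/
abbrev affineSpace : Scheme.{u} := Spec (.of (MvPolynomial (Fin n) R))

/-- The projection `S × 𝔸ⁿ ⟶ S`. -/
def affineProj : affineSpace n R ⟶ Spec (.of R) :=
  Spec.map (CommRingCat.ofHom MvPolynomial.C)

/-- The zero section `z : S ⟶ S × 𝔸ⁿ`. -/
def zeroSection : Spec (.of R) ⟶ affineSpace n R :=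
  Spec.map (CommRingCat.ofHom MvPolynomial.constantCoeff)

/-- The closed embedding `S_red ⟶ S` for `S = Spec R`. -/
def redEmb : Spec (.of (R ⧸ nilradical R)) ⟶ Spec (.of R) :=
  Spec.map (CommRingCat.ofHom (Ideal.Quotient.mk (nilradical R)))

/-- A pointed `n`-dimensional family `π : V ⇄ S : σ` over `S = Spec R`. -/
structure PointedFamily where
  V : Scheme.{u}
  π : V ⟶ Spec (.of R)
  σ : Spec (.of R) ⟶ V
  section_proj : σ ≫ π = 𝟙 _
  smooth : SmoothOfRelativeDimension n π

/-- A common étale neighbourhood `(V, φ, ψ)` of the trivial pointed family `S × 𝔸ⁿ ⇄ S` (with the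
zero section) with itself: `φ` and `ψ` are étale maps over `S`, compatible with the sections on
`S_red`. -/
structure CommonEtaleNhd extends PointedFamily n R where
  φ : V ⟶ affineSpace n R
  ψ : V ⟶ affineSpace n R
  etale_φ : Etale φ
  etale_ψ : Etale ψ
  φ_proj : φ ≫ affineProj n R = π
  ψ_proj : ψ ≫ affineProj n R = π
  red_φ : redEmb R ≫ σ ≫ φ = redEmb R ≫ zeroSection n R
  red_ψ : redEmb R ≫ σ ≫ ψ = redEmb R ≫ zeroSection n R

variable {n R}

/-- A common étale neighbourhood is strict if it is compatible with the sections on all of `S`. -/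
def CommonEtaleNhd.IsStrict (V : CommonEtaleNhd n R) : Prop :=
  V.σ ≫ V.φ = zeroSection n R ∧ V.σ ≫ V.ψ = zeroSection n R

/-- The points, with values in an affine `S`-scheme `s : Spec A ⟶ S`, of the formal completion of
`V` along the section `σ : S ⟶ V`: the maps `Spec A ⟶ V` over `S` whose restriction to
`(Spec A)_red` factors through `σ`. -/
def PointedFamily.formalPoints (V : PointedFamily n R) {A : Type u} [CommRing A] (s : R →+* A) :
    Set (Spec (.of A) ⟶ V.V) :=
  {v | v ≫ V.π = Spec.map (CommRingCat.ofHom s) ∧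
    redEmb A ≫ v = redEmb A ≫ Spec.map (CommRingCat.ofHom s) ≫ V.σ}

/-- A ring homomorphism `χ : R⟦t⟧ → A` to a discrete ring is continuous if it kills a power of `𝔪`.
Such homomorphisms are the `A`-points of the formal scheme `S × 𝔸̂ⁿ = Spf R⟦t⟧`. -/
def IsFormalPoint {A : Type u} [CommRing A] (χ : MvPowerSeries (Fin n) R →+* A) : Prop :=
  ∃ N : ℕ, maxIdeal n R ^ N ≤ RingHom.ker χ

/-- The `A`-point of `S × 𝔸ⁿ` underlying an `A`-point `χ` of `S × 𝔸̂ⁿ`. -/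
def toAffineSpace {A : Type u} [CommRing A] (χ : MvPowerSeries (Fin n) R →+* A) :
    Spec (.of A) ⟶ affineSpace n R :=
  Spec.map (CommRingCat.ofHom (χ.comp MvPolynomial.coeToMvPowerSeries.ringHom))

/-- The completions of `φ` and `ψ` along the sections are isomorphisms `φ̂, ψ̂ : V̂ ≃ S × 𝔸̂ⁿ`, and
this says that `φ̂ ∘ ψ̂⁻¹` is the automorphism of `S × 𝔸̂ⁿ = Spf R⟦t⟧` defined by `ρ ∈ G(R)`.
It is spelled out on points: `Spf ρ` sends an `A`-point `χ : R⟦t⟧ → A` to `χ ∘ ρ`, and the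
(automatically unique) `A`-point `v = ψ̂⁻¹(χ)` of the completion of `V` has `φ̂(v) = χ ∘ ρ`. -/
def CommonEtaleNhd.Induces (V : CommonEtaleNhd n R) (ρ : G n R) : Prop :=
  ∀ (A : Type u) [CommRing A] (χ : MvPowerSeries (Fin n) R →+* A), IsFormalPoint χ →
    ∃ v ∈ V.formalPoints (χ.comp MvPowerSeries.C),
      v ≫ V.ψ = toAffineSpace χ ∧ v ≫ V.φ = toAffineSpace (χ.comp (G.hom ρ))

/-! Facts needed for the group structure and functoriality. -/

variable {R' : Type u} [CommRing R']

theorem smooth_affineProj : SmoothOfRelativeDimension n (affineProj n R) := by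
  have : RingHom.IsStandardSmoothOfRelativeDimension n
      (MvPolynomial.C : R →+* MvPolynomial (Fin n) R) := by
    let P : Algebra.PreSubmersivePresentation R (MvPolynomial (Fin n) R) (Fin n) PEmpty.{1} :=
      { toGenerators := Algebra.Generators.mvPolynomial R (Fin n)
        relation := PEmpty.elim
        span_range_relation_eq_ker := by
          rw [Algebra.Generators.ker_mvPolynomial]
          simp
        map := PEmpty.elim
        map_inj := fun x => x.elim }
    let Q : Algebra.SubmersivePresentation R (MvPolynomial (Fin n) R) (Fin n) PEmpty.{1} :=
      { __ := P
        jacobian_isUnit := by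
          classical
          rw [P.jacobian_eq_jacobiMatrix_det]
          simp }
    have := Q.isStandardSmoothOfRelativeDimension (n := n)
      (by simp [Algebra.Presentation.dimension])
    exact RingHom.isStandardSmoothOfRelativeDimension_algebraMap (n := n) |>.2 this
  rw [affineProj, HasRingHomProperty.Spec_iff (P := @SmoothOfRelativeDimension n)]
  exact RingHom.locally_of RingHom.isStandardSmoothOfRelativeDimension_respectsIso _ this

theorem smooth_of_etale {V : Scheme.{u}} (φ : V ⟶ affineSpace n R) (h : Etale φ) :
    SmoothOfRelativeDimension n (φ ≫ affineProj n R) := by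
  have := smooth_affineProj (n := n) (R := R)
  have h2 : SmoothOfRelativeDimension (0 + n) (φ ≫ affineProj n R) := inferInstance
  rwa [zero_add] at h2

theorem toAffineSpace_proj {A : Type u} [CommRing A] (χ : MvPowerSeries (Fin n) R →+* A) :
    toAffineSpace χ ≫ affineProj n R = Spec.map (CommRingCat.ofHom (χ.comp MvPowerSeries.C)) := by
  rw [toAffineSpace, affineProj, ← Spec.map_comp, ← CommRingCat.ofHom_comp]
  congr 2
  ext r
  simp

theorem zeroSection_proj : zeroSection n R ≫ affineProj n R = 𝟙 _ := by
  rw [zeroSection, affineProj, ← Spec.map_comp, ← CommRingCat.ofHom_comp, ← Spec.map_id]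
  congr 1
  ext r
  simp

theorem toAffineSpace_constantCoeff :
    toAffineSpace (MvPowerSeries.constantCoeff (σ := Fin n) (R := R)) = zeroSection n R := by
  rw [toAffineSpace, zeroSection]
  congr 2

theorem isFormalPoint_constantCoeff :
    IsFormalPoint (MvPowerSeries.constantCoeff (σ := Fin n) (R := R)) :=
  ⟨1, by rw [pow_one]; exact maxIdeal_le_ker⟩

theorem IsFormalPoint.comp {A : Type u} [CommRing A] {χ : MvPowerSeries (Fin n) R' →+* A}
    (h : IsFormalPoint χ) {φ : MvPowerSeries (Fin n) R →+* MvPowerSeries (Fin n) R'}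
    (hφ : IsAdicContinuous φ) : IsFormalPoint (χ.comp φ) := by
  obtain ⟨N, hN⟩ := h
  obtain ⟨M, hM⟩ := hφ N
  exact ⟨M, fun x hx => hN (hM hx)⟩

theorem redEmb_naturality {A : Type u} [CommRing A] (s : R →+* A) :
    ∃ s' : (R ⧸ nilradical R) →+* (A ⧸ nilradical A),
      redEmb A ≫ Spec.map (CommRingCat.ofHom s) =
        Spec.map (CommRingCat.ofHom s') ≫ redEmb R := by
  refine ⟨Ideal.quotientMap _ s ?_, ?_⟩
  · intro x hx
    exact IsNilpotent.map hx s
  · rw [redEmb, redEmb, ← Spec.map_comp, ← Spec.map_comp]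
    rfl

/-- Restricted to the reduced subscheme, a formal point of `S × 𝔸̂ⁿ` is the zero section. -/
theorem redEmb_toAffineSpace {A : Type u} [CommRing A] {χ : MvPowerSeries (Fin n) R →+* A}
    (h : IsFormalPoint χ) :
    redEmb A ≫ toAffineSpace χ =
      redEmb A ≫ Spec.map (CommRingCat.ofHom (χ.comp MvPowerSeries.C)) ≫ zeroSection n R := by
  rw [redEmb, toAffineSpace, zeroSection, ← Spec.map_comp, ← Spec.map_comp, ← Spec.map_comp,
    ← CommRingCat.ofHom_comp, ← CommRingCat.ofHom_comp, ← CommRingCat.ofHom_comp]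
  congr 2
  apply MvPolynomial.ringHom_ext
  · intro r
    simp
  · intro i
    have : IsNilpotent (χ (MvPowerSeries.X i)) := by
      obtain ⟨N, hN⟩ := h
      refine ⟨N, ?_⟩
      rw [← map_pow]
      exact hN (Ideal.pow_mem_pow (X_mem_maxIdeal i) N)
    simpa [Ideal.Quotient.eq_zero_iff_mem, mem_nilradical] using this

theorem comp_hom_C {A : Type u} [CommRing A] (χ : MvPowerSeries (Fin n) R →+* A) (ρ : G n R) :
    (χ.comp (G.hom ρ)).comp MvPowerSeries.C = χ.comp MvPowerSeries.C := by
  ext r; simp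

/-- The trivial common étale neighbourhood. -/
def CommonEtaleNhd.refl : CommonEtaleNhd n R where
  V := affineSpace n R
  π := affineProj n R
  σ := zeroSection n R
  section_proj := zeroSection_proj
  smooth := smooth_affineProj
  φ := 𝟙 _
  ψ := 𝟙 _
  etale_φ := inferInstance
  etale_ψ := inferInstance
  φ_proj := Category.id_comp _
  ψ_proj := Category.id_comp _
  red_φ := by simp
  red_ψ := by simp

theorem CommonEtaleNhd.refl_isStrict : (refl : CommonEtaleNhd n R).IsStrict :=
  ⟨Category.comp_id _, Category.comp_id _⟩

theorem CommonEtaleNhd.refl_induces : (refl : CommonEtaleNhd n R).Induces 1 := by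
  intro A _ χ hχ
  exact ⟨toAffineSpace χ, ⟨toAffineSpace_proj χ, redEmb_toAffineSpace hχ⟩,
    Category.comp_id _, Category.comp_id _⟩

/-- The mirror image of a common étale neighbourhood. -/
def CommonEtaleNhd.symm (V : CommonEtaleNhd n R) : CommonEtaleNhd n R where
  toPointedFamily := V.toPointedFamily
  φ := V.ψ
  ψ := V.φ
  etale_φ := V.etale_ψ
  etale_ψ := V.etale_φ
  φ_proj := V.ψ_proj
  ψ_proj := V.φ_proj
  red_φ := V.red_ψ
  red_ψ := V.red_φ

theorem CommonEtaleNhd.Induces.symm {V : CommonEtaleNhd n R} {ρ : G n R} (h : V.Induces ρ) :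
    V.symm.Induces ρ⁻¹ := by
  intro A _ χ hχ
  obtain ⟨v, hv, h1, h2⟩ := h A (χ.comp (G.hom ρ⁻¹)) (hχ.comp (G.continuous ρ⁻¹))
  refine ⟨v, ?_, ?_, h1⟩
  · rw [comp_hom_C] at hv
    exact hv
  · change v ≫ V.φ = _
    rw [h2]
    congr 1
    ext x
    simp [G.hom_inv_hom]

/-- The composition of two common étale neighbourhoods: the fibre product over the middle copy of
`S × 𝔸ⁿ`, with a section determined by a compatible pair of sections `s₁, s₂`. -/
def CommonEtaleNhd.trans (V₁ V₂ : CommonEtaleNhd n R)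
    (s₁ : Spec (.of R) ⟶ V₁.V) (s₂ : Spec (.of R) ⟶ V₂.V) (h : s₁ ≫ V₁.ψ = s₂ ≫ V₂.φ)
    (h₁ : s₁ ≫ V₁.π = 𝟙 _)
    (hr₁ : redEmb R ≫ s₁ = redEmb R ≫ V₁.σ) (hr₂ : redEmb R ≫ s₂ = redEmb R ≫ V₂.σ) :
    CommonEtaleNhd n R where
  V := pullback V₁.ψ V₂.φ
  π := pullback.fst V₁.ψ V₂.φ ≫ V₁.π
  σ := pullback.lift s₁ s₂ h
  section_proj := by rw [pullback.lift_fst_assoc, h₁]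
  smooth := by
    have := V₁.etale_φ
    have := V₂.etale_φ
    rw [← V₁.φ_proj, ← Category.assoc]
    exact smooth_of_etale _ inferInstance
  φ := pullback.fst V₁.ψ V₂.φ ≫ V₁.φ
  ψ := pullback.snd V₁.ψ V₂.φ ≫ V₂.ψ
  etale_φ := by
    have := V₁.etale_φ
    have := V₂.etale_φ
    infer_instance
  etale_ψ := by
    have := V₁.etale_ψ
    have := V₂.etale_ψ
    infer_instance
  φ_proj := by rw [Category.assoc, V₁.φ_proj]
  ψ_proj := by
    rw [Category.assoc, V₂.ψ_proj, ← V₂.φ_proj, ← pullback.condition_assoc, V₁.ψ_proj]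
  red_φ := by
    rw [pullback.lift_fst_assoc, reassoc_of% hr₁, V₁.red_φ]
  red_ψ := by
    rw [pullback.lift_snd_assoc, reassoc_of% hr₂, V₂.red_ψ]

theorem CommonEtaleNhd.Induces.trans {V₁ V₂ : CommonEtaleNhd n R} {ρ₁ ρ₂ : G n R}
    (i₁ : V₁.Induces ρ₁) (i₂ : V₂.Induces ρ₂) {s₁ : Spec (.of R) ⟶ V₁.V}
    {s₂ : Spec (.of R) ⟶ V₂.V} (h : s₁ ≫ V₁.ψ = s₂ ≫ V₂.φ) (h₁ : s₁ ≫ V₁.π = 𝟙 _)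
    (hr₁ : redEmb R ≫ s₁ = redEmb R ≫ V₁.σ) (hr₂ : redEmb R ≫ s₂ = redEmb R ≫ V₂.σ) :
    (trans V₁ V₂ s₁ s₂ h h₁ hr₁ hr₂).Induces (ρ₂ * ρ₁) := by
  intro A _ χ hχ
  obtain ⟨v₂, hv₂, e₂, f₂⟩ := i₂ A χ hχ
  obtain ⟨v₁, hv₁, e₁, f₁⟩ := i₁ A (χ.comp (G.hom ρ₂)) (hχ.comp (G.continuous ρ₂))
  rw [comp_hom_C] at hv₁
  refine ⟨pullback.lift v₁ v₂ (e₁.trans f₂.symm), ⟨?_, ?_⟩, ?_, ?_⟩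
  · change _ ≫ pullback.fst _ _ ≫ _ = _
    rw [pullback.lift_fst_assoc, hv₁.1]
  · change redEmb A ≫ (pullback.lift v₁ v₂ _ : _ ⟶ pullback V₁.ψ V₂.φ) =
      redEmb A ≫ _ ≫ (pullback.lift s₁ s₂ h : _ ⟶ pullback V₁.ψ V₂.φ)
    obtain ⟨s', hs'⟩ := redEmb_naturality (χ.comp (MvPowerSeries.C (σ := Fin n)))
    apply pullback.hom_ext
    · rw [Category.assoc, Category.assoc, Category.assoc, pullback.lift_fst, pullback.lift_fst,
        hv₁.2, reassoc_of% hs', reassoc_of% hs', hr₁]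
    · rw [Category.assoc, Category.assoc, Category.assoc, pullback.lift_snd, pullback.lift_snd,
        hv₂.2, reassoc_of% hs', reassoc_of% hs', hr₂]
  · change _ ≫ pullback.snd _ _ ≫ _ = _
    rw [pullback.lift_snd_assoc, e₂]
  · change _ ≫ pullback.fst _ _ ≫ _ = _
    rw [pullback.lift_fst_assoc, f₁]
    rfl

theorem CommonEtaleNhd.Induces.exists_trans {V₁ V₂ : CommonEtaleNhd n R} {ρ₁ ρ₂ : G n R}
    (i₁ : V₁.Induces ρ₁) (i₂ : V₂.Induces ρ₂) :
    ∃ V : CommonEtaleNhd n R, V.Induces (ρ₂ * ρ₁) := by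
  have hC : (MvPowerSeries.constantCoeff (σ := Fin n) (R := R)).comp MvPowerSeries.C =
      RingHom.id R := by ext r; simp
  obtain ⟨s₁, hs₁, e₁, -⟩ := i₁ R MvPowerSeries.constantCoeff isFormalPoint_constantCoeff
  obtain ⟨s₂, hs₂, -, f₂⟩ := i₂ R (MvPowerSeries.constantCoeff.comp (G.hom ρ₂⁻¹))
    (isFormalPoint_constantCoeff.comp (G.continuous ρ₂⁻¹))
  rw [comp_hom_C] at hs₂
  rw [hC] at hs₁ hs₂
  have hid : Spec.map (CommRingCat.ofHom (RingHom.id R)) = 𝟙 (Spec (.of R)) := Spec.map_id _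
  have key : (MvPowerSeries.constantCoeff.comp (G.hom ρ₂⁻¹)).comp (G.hom ρ₂) =
      MvPowerSeries.constantCoeff (σ := Fin n) (R := R) := by
    ext x; simp [G.hom_inv_hom]
  rw [key] at f₂
  have h1 := hs₁.1
  have h2 := hs₁.2
  have h3 := hs₂.2
  rw [hid] at h1 h2 h3
  rw [Category.id_comp] at h2 h3
  exact ⟨_, i₁.trans i₂ (e₁.trans f₂.symm) h1 h2 h3⟩

theorem CommonEtaleNhd.Induces.exists_trans_strict {V₁ V₂ : CommonEtaleNhd n R} {ρ₁ ρ₂ : G n R}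
    (i₁ : V₁.Induces ρ₁) (i₂ : V₂.Induces ρ₂) (st₁ : V₁.IsStrict) (st₂ : V₂.IsStrict) :
    ∃ V : CommonEtaleNhd n R, V.IsStrict ∧ V.Induces (ρ₂ * ρ₁) := by
  refine ⟨_, ⟨?_, ?_⟩, i₁.trans i₂ (st₁.2.trans st₂.1.symm) V₁.section_proj rfl rfl⟩
  · change pullback.lift _ _ _ ≫ pullback.fst _ _ ≫ _ = _
    rw [pullback.lift_fst_assoc, st₁.1]
  · change pullback.lift _ _ _ ≫ pullback.snd _ _ ≫ _ = _
    rw [pullback.lift_snd_assoc, st₂.2]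

/-- The map `S' × 𝔸ⁿ ⟶ S × 𝔸ⁿ` for `S' = Spec R' ⟶ S = Spec R`. -/
def affineSpaceMap (n : ℕ) (f : R →+* R') : affineSpace n R' ⟶ affineSpace n R :=
  Spec.map (CommRingCat.ofHom (MvPolynomial.map f))

theorem isPullback_affineSpaceMap (f : R →+* R') :
    IsPullback (affineSpaceMap n f) (affineProj n R') (affineProj n R)
      (Spec.map (CommRingCat.ofHom f)) := by
  algebraize [f]
  let : Algebra (MvPolynomial (Fin n) R) (MvPolynomial (Fin n) R') :=
    MvPolynomial.algebraMvPolynomial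
  exact isPullback_SpecMap_of_isPushout _ _ _ _
    (CommRingCat.isPushout_of_isPushout R (MvPolynomial (Fin n) R) R' (MvPolynomial (Fin n) R'))

theorem zeroSection_map (f : R →+* R') :
    zeroSection n R' ≫ affineSpaceMap n f =
      Spec.map (CommRingCat.ofHom f) ≫ zeroSection n R := by
  rw [zeroSection, zeroSection, affineSpaceMap, ← Spec.map_comp, ← Spec.map_comp,
    ← CommRingCat.ofHom_comp, ← CommRingCat.ofHom_comp]
  congr 2

theorem toAffineSpace_map (f : R →+* R') {A : Type u} [CommRing A]
    (χ : MvPowerSeries (Fin n) R' →+* A) :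
    toAffineSpace χ ≫ affineSpaceMap n f = toAffineSpace (χ.comp (MvPowerSeries.map f)) := by
  rw [toAffineSpace, toAffineSpace, affineSpaceMap, ← Spec.map_comp, ← CommRingCat.ofHom_comp]
  congr 2

theorem redEmb_section (f : R →+* R') {X : Scheme.{u}} {a b : Spec (.of R) ⟶ X}
    (h : redEmb R ≫ a = redEmb R ≫ b) :
    redEmb R' ≫ Spec.map (CommRingCat.ofHom f) ≫ a =
      redEmb R' ≫ Spec.map (CommRingCat.ofHom f) ≫ b := by
  obtain ⟨s', hs'⟩ := redEmb_naturality f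
  rw [reassoc_of% hs', reassoc_of% hs', h]

/-- The base change to `S'` of a map `V ⟶ S × 𝔸ⁿ` over `S`. -/
def baseChangeMap (f : R →+* R') {V : Scheme.{u}} (π : V ⟶ Spec (.of R)) (φ : V ⟶ affineSpace n R)
    (h : φ ≫ affineProj n R = π) :
    pullback π (Spec.map (CommRingCat.ofHom f)) ⟶ affineSpace n R' :=
  (isPullback_affineSpaceMap f).lift (pullback.fst _ _ ≫ φ) (pullback.snd _ _)
    (by rw [Category.assoc, h, pullback.condition])

theorem baseChangeMap_fst (f : R →+* R') {V : Scheme.{u}} (π : V ⟶ Spec (.of R))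
    (φ : V ⟶ affineSpace n R) (h : φ ≫ affineProj n R = π) :
    baseChangeMap f π φ h ≫ affineSpaceMap n f = pullback.fst _ _ ≫ φ :=
  (isPullback_affineSpaceMap f).lift_fst _ _ _

theorem baseChangeMap_snd (f : R →+* R') {V : Scheme.{u}} (π : V ⟶ Spec (.of R))
    (φ : V ⟶ affineSpace n R) (h : φ ≫ affineProj n R = π) :
    baseChangeMap f π φ h ≫ affineProj n R' = pullback.snd _ _ :=
  (isPullback_affineSpaceMap f).lift_snd _ _ _

theorem etale_baseChangeMap (f : R →+* R') {V : Scheme.{u}} (π : V ⟶ Spec (.of R))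
    (φ : V ⟶ affineSpace n R) (h : φ ≫ affineProj n R = π) (hφ : Etale φ) :
    Etale (baseChangeMap f π φ h) := by
  have h1 : IsPullback (pullback.fst π (Spec.map (CommRingCat.ofHom f)))
      (baseChangeMap f π φ h ≫ affineProj n R') (φ ≫ affineProj n R)
      (Spec.map (CommRingCat.ofHom f)) := by
    rw [baseChangeMap_snd, h]
    exact IsPullback.of_hasPullback _ _
  have h2 := IsPullback.of_bot h1 (baseChangeMap_fst f π φ h).symm (isPullback_affineSpaceMap f)
  exact MorphismProperty.of_isPullback h2 hφ

/-- The base change of a common étale neighbourhood along `S' = Spec R' ⟶ S = Spec R`. -/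
def CommonEtaleNhd.baseChange (f : R →+* R') (V : CommonEtaleNhd n R) : CommonEtaleNhd n R' where
  V := pullback V.π (Spec.map (CommRingCat.ofHom f))
  π := pullback.snd _ _
  σ := pullback.lift (Spec.map (CommRingCat.ofHom f) ≫ V.σ) (𝟙 _)
    (by rw [Category.assoc, V.section_proj, Category.comp_id, Category.id_comp])
  section_proj := pullback.lift_snd _ _ _
  smooth := by
    rw [← baseChangeMap_snd f V.π V.φ V.φ_proj]
    exact smooth_of_etale _ (etale_baseChangeMap f V.π V.φ V.φ_proj V.etale_φ)
  φ := baseChangeMap f V.π V.φ V.φ_proj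
  ψ := baseChangeMap f V.π V.ψ V.ψ_proj
  etale_φ := etale_baseChangeMap f V.π V.φ V.φ_proj V.etale_φ
  etale_ψ := etale_baseChangeMap f V.π V.ψ V.ψ_proj V.etale_ψ
  φ_proj := baseChangeMap_snd _ _ _ _
  ψ_proj := baseChangeMap_snd _ _ _ _
  red_φ := by
    apply (isPullback_affineSpaceMap f).hom_ext
    · simp only [Category.assoc, baseChangeMap_fst, pullback.lift_fst_assoc, zeroSection_map]
      exact redEmb_section f V.red_φ
    · simp only [Category.assoc, baseChangeMap_snd, pullback.lift_snd, zeroSection_proj]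
  red_ψ := by
    apply (isPullback_affineSpaceMap f).hom_ext
    · simp only [Category.assoc, baseChangeMap_fst, pullback.lift_fst_assoc, zeroSection_map]
      exact redEmb_section f V.red_ψ
    · simp only [Category.assoc, baseChangeMap_snd, pullback.lift_snd, zeroSection_proj]

theorem CommonEtaleNhd.IsStrict.baseChange (f : R →+* R') {V : CommonEtaleNhd n R}
    (h : V.IsStrict) : (V.baseChange f).IsStrict := by
  constructor
  · apply (isPullback_affineSpaceMap f).hom_ext
    · simp only [CommonEtaleNhd.baseChange, Category.assoc, baseChangeMap_fst,
        pullback.lift_fst_assoc, zeroSection_map, h.1]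
    · simp only [CommonEtaleNhd.baseChange, Category.assoc, baseChangeMap_snd, pullback.lift_snd,
        zeroSection_proj]
  · apply (isPullback_affineSpaceMap f).hom_ext
    · simp only [CommonEtaleNhd.baseChange, Category.assoc, baseChangeMap_fst,
        pullback.lift_fst_assoc, zeroSection_map, h.2]
    · simp only [CommonEtaleNhd.baseChange, Category.assoc, baseChangeMap_snd, pullback.lift_snd,
        zeroSection_proj]

theorem CommonEtaleNhd.Induces.baseChange (f : R →+* R') {V : CommonEtaleNhd n R} {ρ : G n R}
    (h : V.Induces ρ) : (V.baseChange f).Induces (G.map f ρ) := by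
  intro A _ χ hχ
  obtain ⟨v, hv, e₁, e₂⟩ := h A (χ.comp (MvPowerSeries.map f))
    (hχ.comp (map_isAdicContinuous f))
  have hs : (χ.comp (MvPowerSeries.map f)).comp MvPowerSeries.C =
      (χ.comp (MvPowerSeries.C (σ := Fin n))).comp f := by
    ext r; simp
  have hs' : Spec.map (CommRingCat.ofHom ((χ.comp (MvPowerSeries.C (σ := Fin n))).comp f)) =
      Spec.map (CommRingCat.ofHom (χ.comp (MvPowerSeries.C (σ := Fin n)))) ≫
        Spec.map (CommRingCat.ofHom f) := by
    rw [← Spec.map_comp, ← CommRingCat.ofHom_comp]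
  rw [hs] at hv
  obtain ⟨hv1, hv2⟩ := hv
  rw [hs'] at hv1 hv2
  refine ⟨pullback.lift v (Spec.map (CommRingCat.ofHom (χ.comp MvPowerSeries.C))) hv1,
    ⟨pullback.lift_snd _ _ _, ?_⟩, ?_, ?_⟩
  · apply pullback.hom_ext
    · simp only [CommonEtaleNhd.baseChange, Category.assoc, pullback.lift_fst]
      simpa using hv2
    · simp only [CommonEtaleNhd.baseChange, Category.assoc, pullback.lift_snd, Category.comp_id]
  · apply (isPullback_affineSpaceMap f).hom_ext
    · simp only [CommonEtaleNhd.baseChange, Category.assoc, baseChangeMap_fst,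
        pullback.lift_fst_assoc, e₁, toAffineSpace_map]
    · simp only [CommonEtaleNhd.baseChange, Category.assoc, baseChangeMap_snd, pullback.lift_snd,
        toAffineSpace_proj]
  · apply (isPullback_affineSpaceMap f).hom_ext
    · simp only [CommonEtaleNhd.baseChange, Category.assoc, baseChangeMap_fst,
        pullback.lift_fst_assoc, e₂, toAffineSpace_map]
      congr 1
      ext x
      simp [G.map_hom_map]
    · simp only [CommonEtaleNhd.baseChange, Category.assoc, baseChangeMap_snd, pullback.lift_snd,
        toAffineSpace_proj, comp_hom_C]

variable (n R) in
/-- `G^ét(R) ⊆ G(R)`: the automorphisms of étale type, i.e. those induced by a common étale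
neighbourhood of the trivial pointed family over `Spec R` with itself. -/
def Get : Subgroup (G n R) where
  carrier := {ρ | ∃ V : CommonEtaleNhd n R, V.Induces ρ}
  one_mem' := ⟨_, CommonEtaleNhd.refl_induces⟩
  mul_mem' := by
    rintro a b ⟨_, ha⟩ ⟨_, hb⟩
    exact hb.exists_trans ha
  inv_mem' := by
    rintro a ⟨_, ha⟩
    exact ⟨_, ha.symm⟩

variable (n R) in
/-- `K^ét(R) ⊆ K(R)`: the automorphisms fixing the origin which are induced by a strict common
étale neighbourhood of the trivial pointed family over `Spec R` with itself. -/
def Ket : Subgroup (G n R) where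
  carrier := {ρ | ρ ∈ K n R ∧ ∃ V : CommonEtaleNhd n R, V.IsStrict ∧ V.Induces ρ}
  one_mem' := ⟨one_mem _, _, CommonEtaleNhd.refl_isStrict, CommonEtaleNhd.refl_induces⟩
  mul_mem' := by
    rintro a b ⟨ha, _, sa, ia⟩ ⟨hb, _, sb, ib⟩
    exact ⟨mul_mem ha hb, ib.exists_trans_strict ia sb sa⟩
  inv_mem' := by
    rintro a ⟨ha, _, sa, ia⟩
    exact ⟨inv_mem ha, _, ⟨sa.2, sa.1⟩, ia.symm⟩

theorem Ket_le_Get : Ket n R ≤ Get n R := fun _ ⟨_, V, _, h⟩ => ⟨V, h⟩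

theorem Get.map_mem (f : R →+* R') {ρ : G n R} (h : ρ ∈ Get n R) : G.map f ρ ∈ Get n R' := by
  obtain ⟨V, hV⟩ := h
  exact ⟨_, hV.baseChange f⟩

theorem Ket.map_mem (f : R →+* R') {ρ : G n R} (h : ρ ∈ Ket n R) : G.map f ρ ∈ Ket n R' := by
  obtain ⟨hK, V, sV, hV⟩ := h
  exact ⟨K.map_mem f hK, _, sV.baseChange f, hV.baseChange f⟩

end Geometry

section Representations

/-- A group-valued prestack over `k`: a functor from affine `k`-schemes (opposite of commutative
`k`-algebras) to groups. -/
abbrev GroupPrestack (k : Type u) [Field k] := CommAlgCat.{u} k ⥤ GrpCat.{u}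

variable {k : Type u} [Field k]

/-- A representation of a group-valued prestack `H` on a `k`-vector space `V`: a morphism
`H ⟶ GL_V` of group-valued prestacks, i.e. group homomorphisms `H(R) → GL_R(R ⊗ V)` natural
in `R`. -/
@[ext]
structure PrestackRep (H : GroupPrestack k) (V : Type w) [AddCommGroup V] [Module k V] where
  act : ∀ R : CommAlgCat.{u} k, H.obj R →* ((R ⊗[k] V) ≃ₗ[R] (R ⊗[k] V))
  naturality : ∀ {R R' : CommAlgCat.{u} k} (f : R ⟶ R') (x : H.obj R) (m : R ⊗[k] V),
    LinearMap.rTensor V f.hom.toLinearMap (act R x m) =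
      act R' (H.map f x) (LinearMap.rTensor V f.hom.toLinearMap m)

/-- Restriction of a representation along a morphism of group-valued prestacks. -/
def PrestackRep.restrict {H H' : GroupPrestack k} (η : H' ⟶ H) {V : Type w} [AddCommGroup V]
    [Module k V] (ρ : PrestackRep H V) : PrestackRep H' V where
  act R := (ρ.act R).comp (η.app R).hom
  naturality {R R'} f x m := by
    have h : η.app R' (H'.map f x) = H.map f (η.app R x) :=
      congrArg (fun g => g x) (congrArg GrpCat.Hom.hom (η.naturality f))
    have := ρ.naturality f (η.app R x) m
    rw [← h] at this
    exact this

/-- A linear subspace `W ⊆ V` is a subrepresentation if each `R ⊗ W` is stable under `H(R)`. -/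
def PrestackRep.IsSubrep {H : GroupPrestack k} {V : Type w} [AddCommGroup V] [Module k V]
    (ρ : PrestackRep H V) (W : Submodule k V) : Prop :=
  ∀ (R : CommAlgCat.{u} k) (x : H.obj R), ∀ m ∈ W.baseChange R, ρ.act R x m ∈ W.baseChange R

/-- A representation is locally finite if every vector lies in a finite-dimensional
subrepresentation. -/
def PrestackRep.IsLocallyFinite {H : GroupPrestack k} {V : Type w} [AddCommGroup V] [Module k V]
    (ρ : PrestackRep H V) : Prop :=
  ∀ v : V, ∃ W : Submodule k V, FiniteDimensional k W ∧ v ∈ W ∧ ρ.IsSubrep W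

/-- The objects of the category `Rep(H)` of representations of `H` on `k`-vector spaces. -/
structure RepCat (H : GroupPrestack k) where
  V : Type w
  [addCommGroup : AddCommGroup V]
  [module : Module k V]
  rep : PrestackRep H V

attribute [instance] RepCat.addCommGroup RepCat.module

/-- The morphisms of `Rep(H)`: the `k`-linear maps compatible with the actions of all `H(R)`. -/
@[ext]
structure RepCat.Hom {H : GroupPrestack k} (X Y : RepCat.{u, w} H) where
  lin : X.V →ₗ[k] Y.V
  comm : ∀ (R : CommAlgCat.{u} k) (x : H.obj R) (m : R ⊗[k] X.V),
    lin.baseChange R (X.rep.act R x m) = Y.rep.act R x (lin.baseChange R m)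

instance (H : GroupPrestack k) : Category (RepCat.{u, w} H) where
  Hom := RepCat.Hom
  id X := ⟨LinearMap.id, fun R x m => by simp⟩
  comp f g := ⟨g.lin.comp f.lin, fun R x m => by
    rw [LinearMap.baseChange_comp, LinearMap.comp_apply, LinearMap.comp_apply, f.comm, g.comm]⟩

/-- The restriction functor `Rep(H) ⥤ Rep(H')` along a morphism `H' ⟶ H`. -/
def resFunctor {H H' : GroupPrestack k} (η : H' ⟶ H) : RepCat.{u, w} H ⥤ RepCat.{u, w} H' where
  obj X := ⟨X.V, X.rep.restrict η⟩
  map f := ⟨f.lin, fun R x m => f.comm R (η.app R x) m⟩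

end Representations

section Prestacks

variable (k : Type u) [Field k] (n : ℕ)

/-- The group-valued prestack `G`. -/
def GPrestack : GroupPrestack k where
  obj R := GrpCat.of (G n R)
  map f := GrpCat.ofHom (G.map f.hom.toRingHom)
  map_id R := GrpCat.hom_ext (MonoidHom.ext fun ρ => G.map_id ρ)
  map_comp f g := GrpCat.hom_ext (MonoidHom.ext fun ρ =>
    G.map_comp g.hom.toRingHom f.hom.toRingHom ρ)

/-- A group-valued subprestack of `G`, given by subgroups of `G(R)` stable under base change. -/
def subPrestack (P : ∀ (R : Type u) [CommRing R], Subgroup (G n R))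
    (hP : ∀ {R R' : Type u} [CommRing R] [CommRing R'] (f : R →+* R') {ρ : G n R},
      ρ ∈ P R → G.map f ρ ∈ P R') : GroupPrestack k where
  obj R := GrpCat.of (P R)
  map f := GrpCat.ofHom (((G.map f.hom.toRingHom).comp (P _).subtype).codRestrict (P _)
    fun ρ => hP f.hom.toRingHom ρ.2)
  map_id R := GrpCat.hom_ext (MonoidHom.ext fun ρ => Subtype.ext (G.map_id ρ.1))
  map_comp f g := GrpCat.hom_ext (MonoidHom.ext fun ρ =>
    Subtype.ext (G.map_comp g.hom.toRingHom f.hom.toRingHom ρ.1))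

/-- The group-valued prestack `G^ét`. -/
def GetPrestack : GroupPrestack k := subPrestack k n (fun R _ => Get n R) Get.map_mem

/-- The group-valued prestack `K^ét`. -/
def KetPrestack : GroupPrestack k := subPrestack k n (fun R _ => Ket n R) Ket.map_mem

/-- The inclusion `G^ét ⟶ G`. -/
def GetToG : GetPrestack k n ⟶ GPrestack k n where
  app R := GrpCat.ofHom (Get n R).subtype
  naturality _ _ _ := rfl

/-- The inclusion `K^ét ⟶ G^ét`. -/
def KetToGet : KetPrestack k n ⟶ GetPrestack k n where
  app _ := GrpCat.ofHom (Subgroup.inclusion Ket_le_Get)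
  naturality _ _ _ := rfl

end Prestacks

/-- The restriction functor `Rep(G) ⥤ Rep(G^ét)`. -/
def Res (k : Type u) [Field k] (n : ℕ) :
    RepCat.{u, w} (GPrestack k n) ⥤ RepCat.{u, w} (GetPrestack k n) :=
  resFunctor (GetToG k n)

/-- A representation of `G^ét` is `K^ét`-locally-finite if its restriction to `K^ét` is locally
finite. -/
def IsKetLocallyFinite {k : Type u} [Field k] {n : ℕ} {V : Type w} [AddCommGroup V] [Module k V]
    (ρ : PrestackRep (GetPrestack k n) V) : Prop :=
  (ρ.restrict (KetToGet k n)).IsLocallyFinite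

end FormalDisc

end

/-!
The proof compares `G` and `G^ét` through the congruence subgroups of `G(R)`, consisting of the
automorphisms which are trivial modulo `𝔪 ^ N`. Two facts carry it.

*Density.* Every `g ∈ G(R)` agrees to any order with an element of `G^ét(R)`
(`exists_mem_Get_inv_mul_mem`). The constant terms of `g` are nilpotent, so a translation, which is
of étale type, moves `g` into `K(R)`. There the series `g(tᵢ)` may be truncated to polynomials: by
the formal inverse function theorem (`exists_mem_K`) these define an element of `K(R)`, and by the
Jacobian criterion they define an étale map near the origin (`mem_Ket_of_isEtaleFamily`).

*Smoothness.* In a `K^ét`-locally-finite representation of `G^ét`, and in every representation of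
`G`, each vector is fixed by the elements of a congruence subgroup, whose level is independent of
`R`.

* For `G` (`PrestackRep.exists_level`) this holds because `K` is represented by an affine scheme,
  the spectrum of a localized polynomial ring in infinitely many variables; a function on it
  involves only finitely many Taylor coefficients of the automorphism.
* For `G^ét` (`IsKetLocallyFinite.exists_level`) it is the heart of the matter, as `K^ét` has no
  such coordinates. The vector lies in a finite-dimensional representation `W` of `K^ét`. One may
  assume that `R` is local. Then the series `ρ(tᵢ)` of an element `ρ` of `K^ét(R)` are functions on
  an affine étale neighbourhood of the origin (`isEtaleFamily_of_mem_Ket`), and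
  `ρₛ(t) = s⁻¹ ρ(s t)` is again an element of `K^ét(R[s])` (`exists_dilation`). If `ρ` is trivial modulo
  `𝔪 ^ (N + 1)`, then `ρₛ` is trivial modulo `s ^ N`, hence so is its matrix on `W`. Over `R[s, s⁻¹]` this
  matrix is conjugate to the constant matrix of `ρ` by the matrix of a dilation, which is defined
  over `k[s, s⁻¹]` and so has a pole of order bounded in terms of `W` alone. For `N` large, the
  constant matrix of `ρ` has to be the identity (`eq_one_of_conj_eq`).

Density and smoothness show that `G`-representations on `V` are determined by their restriction to
`G^ét`, that linear maps commuting with `G^ét` commute with `G`, and that a `K^ét`-locally-finite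
action of `G^ét` extends to `G` by letting `g` act on a tensor as the elements of `G^ét(R)` close
to `g` do (`extendRep`). Finally, restrictions of `G`-representations are `K^ét`-locally-finite by
the usual argument for comodules over the ring of functions on `K`
(`PrestackRep.isKetLocallyFinite_restrict`).
-/

noncomputable section

namespace FormalDisc

/-! ### The formal inverse function theorem and congruence subgroups -/

section FormalInverse

variable {n : ℕ} {R : Type u} [CommRing R] {R' : Type u} [CommRing R']

instance isAdicComplete_maxIdeal : IsAdicComplete (maxIdeal n R) (MvPowerSeries (Fin n) R) :=
  inferInstanceAs (IsAdicComplete (Ideal.span (Set.range MvPowerSeries.X)) _)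

theorem eq_of_forall_sub_mem_pow {f g : MvPowerSeries (Fin n) R}
    (h : ∀ N, f - g ∈ maxIdeal n R ^ N) : f = g := by
  rw [← sub_eq_zero]
  ext d
  exact coeff_eq_zero_of_mem_pow _ _ (h (d.degree + 1)) d (Nat.lt_succ_self _)

theorem mem_maxIdeal_iff {f : MvPowerSeries (Fin n) R} :
    f ∈ maxIdeal n R ↔ MvPowerSeries.constantCoeff f = 0 := by
  refine ⟨fun h => maxIdeal_le_ker h, fun h => ?_⟩
  have := sub_C_mem f
  rwa [h, map_zero, sub_zero] at this

theorem exists_eq_C_add_sum (f : MvPowerSeries (Fin n) R) :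
    ∃ g : Fin n → MvPowerSeries (Fin n) R,
      f = MvPowerSeries.C (MvPowerSeries.constantCoeff f) + ∑ l, g l * MvPowerSeries.X l := by
  obtain ⟨g, hg⟩ := Ideal.mem_span_range_iff_exists_fun.1 (sub_C_mem f)
  exact ⟨g, by rw [hg]; ring⟩

theorem coeff_single_mul (j : Fin n) (f g : MvPowerSeries (Fin n) R) :
    MvPowerSeries.coeff (Finsupp.single j 1) (f * g) =
      MvPowerSeries.constantCoeff f * MvPowerSeries.coeff (Finsupp.single j 1) g +
        MvPowerSeries.coeff (Finsupp.single j 1) f * MvPowerSeries.constantCoeff g := by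
  have key : ∀ f : MvPowerSeries (Fin n) R, MvPowerSeries.coeff (Finsupp.single j 1) f =
      MvPowerSeries.constantCoeff (MvPowerSeries.pderiv R j f) := by
    intro f
    rw [← MvPowerSeries.coeff_zero_eq_constantCoeff_apply, MvPowerSeries.coeff_pderiv]
    simp
  simp only [key, Derivation.leibniz, smul_eq_mul, map_add, map_mul]
  ring

theorem coeff_single_X (i j : Fin n) :
    MvPowerSeries.coeff (Finsupp.single j 1) (MvPowerSeries.X i : MvPowerSeries (Fin n) R) =
      if i = j then 1 else 0 := by
  rw [MvPowerSeries.coeff_X]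
  simp [Finsupp.single_left_inj, eq_comm]

theorem coeff_single_C (j : Fin n) (r : R) :
    MvPowerSeries.coeff (Finsupp.single j 1) (MvPowerSeries.C r : MvPowerSeries (Fin n) R) = 0 := by
  classical
  rw [MvPowerSeries.coeff_C]
  simp

/-- The Jacobian matrix at the origin of a family of power series. -/
def linearPart {ι : Type*} (f : ι → MvPowerSeries (Fin n) R) : Matrix ι (Fin n) R :=
  Matrix.of fun i j => MvPowerSeries.coeff (Finsupp.single j 1) (f i)

/-- The endomorphism of the `R`-algebra `R⟦t⟧` with `tᵢ ↦ fᵢ`, for series without constant term. -/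
def substEnd (f : Fin n → MvPowerSeries (Fin n) R)
    (hf : ∀ i, MvPowerSeries.constantCoeff (f i) = 0) :
    MvPowerSeries (Fin n) R →ₐ[R] MvPowerSeries (Fin n) R :=
  MvPowerSeries.substAlgHom (MvPowerSeries.hasSubst_of_constantCoeff_zero hf)

@[simp] theorem substEnd_X (f : Fin n → MvPowerSeries (Fin n) R)
    (hf : ∀ i, MvPowerSeries.constantCoeff (f i) = 0) (i : Fin n) :
    substEnd f hf (MvPowerSeries.X i) = f i :=
  MvPowerSeries.substAlgHom_X _ i

@[simp] theorem algHom_C (E : MvPowerSeries (Fin n) R →ₐ[R] MvPowerSeries (Fin n) R) (r : R) :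
    E (MvPowerSeries.C r) = MvPowerSeries.C r := E.commutes r

theorem constantCoeff_algHom {E : MvPowerSeries (Fin n) R →ₐ[R] MvPowerSeries (Fin n) R}
    (h : ∀ i, MvPowerSeries.constantCoeff (E (MvPowerSeries.X i)) = 0)
    (f : MvPowerSeries (Fin n) R) :
    MvPowerSeries.constantCoeff (E f) = MvPowerSeries.constantCoeff f := by
  obtain ⟨g, hg⟩ := exists_eq_C_add_sum f
  conv_lhs => rw [hg]
  simp [h]

/-- The chain rule at the origin. -/
theorem coeff_single_algHom {E : MvPowerSeries (Fin n) R →ₐ[R] MvPowerSeries (Fin n) R}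
    (h : ∀ i, MvPowerSeries.constantCoeff (E (MvPowerSeries.X i)) = 0)
    (f : MvPowerSeries (Fin n) R) (j : Fin n) :
    MvPowerSeries.coeff (Finsupp.single j 1) (E f) =
      ∑ l, MvPowerSeries.coeff (Finsupp.single l 1) f *
        MvPowerSeries.coeff (Finsupp.single j 1) (E (MvPowerSeries.X l)) := by
  obtain ⟨g, hg⟩ := exists_eq_C_add_sum f
  conv_lhs => rw [hg]
  conv_rhs => rw [hg]
  simp [coeff_single_mul, coeff_single_C, coeff_single_X, h, constantCoeff_algHom h]

theorem isAdicContinuous_algHom {E : MvPowerSeries (Fin n) R →ₐ[R] MvPowerSeries (Fin n) R}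
    (h : ∀ i, MvPowerSeries.constantCoeff (E (MvPowerSeries.X i)) = 0) :
    IsAdicContinuous (E : MvPowerSeries (Fin n) R →+* MvPowerSeries (Fin n) R) :=
  isAdicContinuous_of_mem_radical fun i => mem_radical_of_isNilpotent (by
    rw [RingHom.coe_coe, h i]; exact IsNilpotent.zero)

theorem algHom_mem_pow {E : MvPowerSeries (Fin n) R →ₐ[R] MvPowerSeries (Fin n) R}
    (h : ∀ i, MvPowerSeries.constantCoeff (E (MvPowerSeries.X i)) = 0) {N : ℕ}
    {f : MvPowerSeries (Fin n) R} (hf : f ∈ maxIdeal n R ^ N) : E f ∈ maxIdeal n R ^ N := by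
  have : Ideal.map E (maxIdeal n R) ≤ maxIdeal n R := by
    rw [Ideal.map_le_iff_le_comap]
    intro x hx
    rw [Ideal.mem_comap, mem_maxIdeal_iff, constantCoeff_algHom h]
    exact mem_maxIdeal_iff.1 hx
  have h2 := Ideal.mem_map_of_mem E hf
  rw [Ideal.map_pow] at h2
  exact Ideal.pow_right_mono this N h2

/-- An additive endomorphism inducing the identity on the graded ring of the `𝔪`-adic filtration is
bijective, by completeness. -/
theorem bijective_of_sub_mem (u : MvPowerSeries (Fin n) R →+ MvPowerSeries (Fin n) R)
    (hu : ∀ N, ∀ f ∈ maxIdeal n R ^ N, u f - f ∈ maxIdeal n R ^ (N + 1)) :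
    Function.Bijective u := by
  have hu' : ∀ N, ∀ f ∈ maxIdeal n R ^ N, u f ∈ maxIdeal n R ^ N := fun N f hf => by
    have := add_mem (Ideal.pow_le_pow_right (Nat.le_succ N) (hu N f hf)) hf
    simpa using this
  constructor
  · rw [injective_iff_map_eq_zero]
    intro f hf
    refine eq_of_forall_sub_mem_pow fun N => ?_
    rw [sub_zero]
    induction N with
    | zero => simp
    | succ N ih => simpa [hf] using hu N f ih
  · intro g
    -- Successive approximation: each step corrects the approximate preimage by the current error.
    let F : ℕ → MvPowerSeries (Fin n) R := fun N => Nat.rec 0 (fun _ f => f + (g - u f)) N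
    have hF : ∀ N, F (N + 1) = F N + (g - u (F N)) := fun N => rfl
    have herr : ∀ N, g - u (F N) ∈ maxIdeal n R ^ N := by
      intro N
      induction N with
      | zero => simp
      | succ N ih =>
        have := neg_mem (hu N _ ih)
        rw [hF, map_add]
        convert this using 1
        ring
    have hstep : ∀ N M, N ≤ M → F N - F M ∈ maxIdeal n R ^ N := by
      intro N M h
      induction M, h using Nat.le_induction with
      | base => simp
      | succ M hM ih =>
        rw [hF]
        have := sub_mem ih (Ideal.pow_le_pow_right hM (herr M))
        convert this using 1
        ring
    obtain ⟨L, hL⟩ := IsPrecomplete.prec (I := maxIdeal n R) inferInstance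
      (f := F) (fun {m l} h => by
        rw [SModEq.sub_mem, smul_eq_mul, Ideal.mul_top]
        exact hstep _ _ h)
    refine ⟨L, eq_of_forall_sub_mem_pow fun N => ?_⟩
    have h1 := hL N
    rw [SModEq.sub_mem, smul_eq_mul, Ideal.mul_top] at h1
    have h2 := sub_mem (neg_mem (herr N)) (hu' N _ h1)
    rw [map_sub] at h2
    convert h2 using 1
    ring

/-- An endomorphism tangent to the identity is an automorphism. -/
theorem algHom_bijective_of_sub_mem
    {E : MvPowerSeries (Fin n) R →ₐ[R] MvPowerSeries (Fin n) R}
    (hE : ∀ i, E (MvPowerSeries.X i) - MvPowerSeries.X i ∈ maxIdeal n R ^ 2) :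
    Function.Bijective E := by
  have h0 : ∀ i, MvPowerSeries.constantCoeff (E (MvPowerSeries.X i)) = 0 := by
    intro i
    have := maxIdeal_le_ker (Ideal.pow_le_self two_ne_zero (hE i))
    simpa using this
  have h1 : ∀ f ∈ maxIdeal n R, E f - f ∈ maxIdeal n R ^ 2 := by
    intro f hf
    obtain ⟨g, hg⟩ := Ideal.mem_span_range_iff_exists_fun.1 hf
    rw [← hg, map_sum, ← Finset.sum_sub_distrib]
    refine Ideal.sum_mem _ fun l _ => ?_
    have e : E (g l * MvPowerSeries.X l) - g l * MvPowerSeries.X l =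
        E (g l) * (E (MvPowerSeries.X l) - MvPowerSeries.X l) +
          (E (g l) - g l) * MvPowerSeries.X l := by
      rw [map_mul]; ring
    rw [e]
    refine add_mem (Ideal.mul_mem_left _ _ (hE l)) ?_
    rw [pow_two]
    refine Ideal.mul_mem_mul ?_ (X_mem_maxIdeal l)
    rw [mem_maxIdeal_iff, map_sub, constantCoeff_algHom h0, sub_self]
  refine bijective_of_sub_mem E.toRingHom.toAddMonoidHom fun N => ?_
  change ∀ f ∈ maxIdeal n R ^ N, E f - f ∈ _
  induction N with
  | zero =>
    intro f _
    rw [zero_add, pow_one, mem_maxIdeal_iff, map_sub, constantCoeff_algHom h0, sub_self]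
  | succ N ih =>
    intro f hf
    rw [pow_succ] at hf
    induction hf using Submodule.mul_induction_on' with
    | mem_mul_mem r hr s hs =>
      have e : E (r * s) - r * s = E r * (E s - s) + (E r - r) * s := by rw [map_mul]; ring
      rw [e]
      refine add_mem ?_ ?_
      · have := Ideal.mul_mem_mul (algHom_mem_pow h0 hr) (h1 s hs)
        rwa [← pow_add] at this
      · have := Ideal.mul_mem_mul (ih r hr) hs
        rwa [← pow_succ] at this
    | add x _ y _ hx hy =>
      have := add_mem hx hy
      rw [map_add]
      convert this using 1
      ring

theorem algHom_ext_of_constantCoeff {E F : MvPowerSeries (Fin n) R →ₐ[R] MvPowerSeries (Fin n) R}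
    (hE : ∀ i, MvPowerSeries.constantCoeff (E (MvPowerSeries.X i)) = 0)
    (h : ∀ i, E (MvPowerSeries.X i) = F (MvPowerSeries.X i)) : E = F := by
  have := ringHom_ext (isAdicContinuous_algHom hE)
    (isAdicContinuous_algHom (E := F) fun i => by rw [← h]; exact hE i)
    (fun r => by simp) h
  exact AlgHom.ext fun x => congrArg (fun f : _ →+* _ => f x) this

/-- The linear substitution with matrix `A`. -/
def linearSubst (A : Matrix (Fin n) (Fin n) R) :
    MvPowerSeries (Fin n) R →ₐ[R] MvPowerSeries (Fin n) R :=
  substEnd (fun i => ∑ j, MvPowerSeries.C (A i j) * MvPowerSeries.X j) fun i => by simp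

theorem linearSubst_X (A : Matrix (Fin n) (Fin n) R) (i : Fin n) :
    linearSubst A (MvPowerSeries.X i) = ∑ j, MvPowerSeries.C (A i j) * MvPowerSeries.X j :=
  substEnd_X _ _ i

theorem linearSubst_comp {A B : Matrix (Fin n) (Fin n) R} (h : A * B = 1) :
    (linearSubst B).comp (linearSubst A) = AlgHom.id R _ := by
  classical
  have key : ∀ i, ((linearSubst B).comp (linearSubst A)) (MvPowerSeries.X i) =
      MvPowerSeries.X i := by
    intro i
    have h2 : ∀ l, ∑ j, A i j * B j l = if i = l then 1 else 0 := fun l => by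
      rw [← Matrix.mul_apply, h, Matrix.one_apply]
    simp only [AlgHom.comp_apply, linearSubst_X, map_sum, map_mul, algHom_C, Finset.mul_sum]
    rw [Finset.sum_comm]
    simp only [← mul_assoc, ← map_mul, ← Finset.sum_mul, ← map_sum, h2]
    simp
  exact algHom_ext_of_constantCoeff (fun i => by rw [key]; simp) key

theorem sub_X_mem_sq {f : MvPowerSeries (Fin n) R} (i : Fin n)
    (h0 : MvPowerSeries.constantCoeff f = 0)
    (h1 : ∀ j, MvPowerSeries.coeff (Finsupp.single j 1) f = if i = j then 1 else 0) :
    f - MvPowerSeries.X i ∈ maxIdeal n R ^ 2 := by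
  apply mem_pow_of_coeff
  intro d hd
  by_cases hd0 : d = 0
  · subst hd0; simp [h0]
  · have hd1 : d.degree = 1 := by
      have : d.degree ≠ 0 := fun h => hd0 ((Finsupp.degree_eq_zero_iff d).1 h)
      omega
    obtain ⟨j, rfl⟩ : ∃ j, d = Finsupp.single j 1 := by
      obtain ⟨j, hj⟩ : ∃ j, d j ≠ 0 := by
        by_contra! h
        exact hd0 (Finsupp.ext h)
      have hle : Finsupp.single j 1 ≤ d := by
        rw [Finsupp.single_le_iff]; omega
      refine ⟨j, ?_⟩
      have h3 := tsub_add_cancel_of_le hle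
      have h4 : (d - Finsupp.single j 1).degree = 0 := by
        have := congrArg Finsupp.degree h3
        simp only [map_add, Finsupp.degree_single] at this
        omega
      rw [(Finsupp.degree_eq_zero_iff _).1 h4, zero_add] at h3
      exact h3.symm
    rw [map_sub, h1, coeff_single_X, sub_self]

/-- The formal inverse function theorem. -/
theorem exists_mem_K {f : Fin n → MvPowerSeries (Fin n) R}
    (h0 : ∀ i, MvPowerSeries.constantCoeff (f i) = 0) (h1 : IsUnit (linearPart f).det) :
    ∃ ρ ∈ K n R, ∀ i, G.hom ρ (MvPowerSeries.X i) = f i := by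
  classical
  obtain ⟨B, hAB, hBA⟩ : ∃ B, linearPart f * B = 1 ∧ B * linearPart f = 1 :=
    ⟨_, Matrix.mul_nonsing_inv _ h1, Matrix.nonsing_inv_mul _ h1⟩
  have hE0 : ∀ i, MvPowerSeries.constantCoeff (substEnd f h0 (MvPowerSeries.X i)) = 0 :=
    fun i => by rw [substEnd_X]; exact h0 i
  -- Precomposing with the inverse of the linear part gives an endomorphism tangent to the identity.
  have hbij : Function.Bijective ((substEnd f h0).comp (linearSubst B)) := by
    apply algHom_bijective_of_sub_mem
    intro i
    rw [AlgHom.comp_apply, linearSubst_X]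
    apply sub_X_mem_sq
    · simp [h0]
    · intro j
      have h2 : ∑ l, B i l * linearPart f l j = if i = j then 1 else 0 := by
        rw [← Matrix.mul_apply, hBA, Matrix.one_apply]
      rw [← h2, map_sum, map_sum]
      refine Finset.sum_congr rfl fun l _ => ?_
      rw [map_mul, algHom_C, substEnd_X, coeff_single_mul, coeff_single_C, h0, mul_zero, add_zero,
        MvPowerSeries.constantCoeff_C]
      rfl
  have hlin : Function.Bijective (linearSubst B) := by
    have e1 := linearSubst_comp hAB
    have e2 := linearSubst_comp hBA
    exact Function.bijective_iff_has_inverse.2 ⟨linearSubst (linearPart f),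
      fun x => congrArg (fun f : _ →ₐ[R] _ => f x) e2,
      fun x => congrArg (fun f : _ →ₐ[R] _ => f x) e1⟩
  have hE : Function.Bijective (substEnd f h0) := by
    rw [AlgHom.coe_comp] at hbij
    exact (Function.Bijective.of_comp_iff _ hlin).1 hbij
  obtain ⟨e, he'⟩ : ∃ e : MvPowerSeries (Fin n) R ≃ₐ[R] MvPowerSeries (Fin n) R,
      (e : MvPowerSeries (Fin n) R →ₐ[R] MvPowerSeries (Fin n) R) = substEnd f h0 :=
    ⟨AlgEquiv.ofBijective _ hE, AlgHom.ext fun x => rfl⟩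
  rw [← he'] at hE0
  have hX : ∀ i, e (MvPowerSeries.X i) = f i := fun i => by
    rw [← substEnd_X f h0 i, ← he']; rfl
  have he : ∀ i, MvPowerSeries.constantCoeff
      ((e.symm : MvPowerSeries (Fin n) R →ₐ[R] MvPowerSeries (Fin n) R) (MvPowerSeries.X i)) = 0 := by
    intro i
    rw [← constantCoeff_algHom hE0]
    simp
  refine ⟨⟨e, isAdicContinuous_algHom hE0, isAdicContinuous_algHom he⟩, fun i => ?_, fun i => ?_⟩
  · exact hE0 i
  · exact hX i

theorem coeff_single_hom {ρ : G n R} (h : ρ ∈ K n R) (f : MvPowerSeries (Fin n) R) (j : Fin n) :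
    MvPowerSeries.coeff (Finsupp.single j 1) (G.hom ρ f) =
      ∑ l, MvPowerSeries.coeff (Finsupp.single l 1) f *
        MvPowerSeries.coeff (Finsupp.single j 1) (G.hom ρ (MvPowerSeries.X l)) :=
  coeff_single_algHom (E := ρ.1.toAlgHom) (fun i => h i) f j

/-- The converse of the formal inverse function theorem. -/
theorem isUnit_det_linearPart {ρ : G n R} (h : ρ ∈ K n R) :
    IsUnit (linearPart fun i => G.hom ρ (MvPowerSeries.X i)).det := by
  classical
  refine IsUnit.of_mul_eq_one
    (linearPart fun i => G.hom ρ⁻¹ (MvPowerSeries.X i)).det ?_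
  rw [mul_comm, ← Matrix.det_mul]
  convert Matrix.det_one (n := Fin n) (R := R)
  ext i j
  rw [Matrix.mul_apply, Matrix.one_apply]
  have := coeff_single_hom h (G.hom ρ⁻¹ (MvPowerSeries.X i)) j
  rw [G.hom_hom_inv, coeff_single_X] at this
  exact this.symm

end FormalInverse

section Congruence

variable {n : ℕ} {R : Type u} [CommRing R] {R' : Type u} [CommRing R']

variable (n R) in
/-- The congruence subgroup of level `N`: the automorphisms inducing the identity on
`R⟦t⟧ / 𝔪 ^ N`. -/
def congruence (N : ℕ) : Subgroup (G n R) where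
  carrier := {ρ | ∀ f, G.hom ρ f - f ∈ maxIdeal n R ^ N ∧ G.hom ρ⁻¹ f - f ∈ maxIdeal n R ^ N}
  one_mem' f := by simp
  mul_mem' {a b} ha hb f := by
    refine ⟨?_, ?_⟩
    · have := add_mem (ha (G.hom b f)).1 (hb f).1
      rw [sub_add_sub_cancel] at this
      exact this
    · have := add_mem (hb (G.hom a⁻¹ f)).2 (ha f).2
      rw [sub_add_sub_cancel] at this
      rw [mul_inv_rev]
      exact this
  inv_mem' {a} ha f := ⟨(ha f).2, by rw [inv_inv]; exact (ha f).1⟩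

theorem congruence_anti {N M : ℕ} (h : N ≤ M) : congruence n R M ≤ congruence n R N :=
  fun _ hρ f => ⟨Ideal.pow_le_pow_right h (hρ f).1, Ideal.pow_le_pow_right h (hρ f).2⟩

theorem congruence_le_K {N : ℕ} (hN : N ≠ 0) : congruence n R N ≤ K n R := by
  intro ρ hρ i
  have := maxIdeal_le_ker (Ideal.pow_le_self hN (hρ (MvPowerSeries.X i)).1)
  simpa using this

theorem hom_mem_pow {ρ : G n R} (h : ρ ∈ K n R) {N : ℕ} {f : MvPowerSeries (Fin n) R}
    (hf : f ∈ maxIdeal n R ^ N) : G.hom ρ f ∈ maxIdeal n R ^ N :=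
  algHom_mem_pow (E := ρ.1.toAlgHom) (fun i => h i) hf

theorem hom_sub_mem {ρ σ : G n R} {N : ℕ}
    (h : ∀ i, G.hom ρ (MvPowerSeries.X i) - G.hom σ (MvPowerSeries.X i) ∈ maxIdeal n R ^ N)
    (f : MvPowerSeries (Fin n) R) : G.hom ρ f - G.hom σ f ∈ maxIdeal n R ^ N := by
  have hpoly : ∀ p : MvPolynomial (Fin n) R,
      G.hom ρ (p : MvPowerSeries (Fin n) R) - G.hom σ p ∈ maxIdeal n R ^ N := by
    have : ((Ideal.Quotient.mk (maxIdeal n R ^ N)).comp (G.hom ρ)).comp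
          MvPolynomial.coeToMvPowerSeries.ringHom =
        ((Ideal.Quotient.mk (maxIdeal n R ^ N)).comp (G.hom σ)).comp
          MvPolynomial.coeToMvPowerSeries.ringHom := by
      apply MvPolynomial.ringHom_ext
      · intro r; simp
      · intro i
        simpa using Ideal.Quotient.eq.2 (h i)
    intro p
    exact Ideal.Quotient.eq.1 (congrArg (fun f : _ →+* _ => f p) this)
  obtain ⟨M₁, h₁⟩ := G.continuous ρ N
  obtain ⟨M₂, h₂⟩ := G.continuous σ N
  set p := MvPowerSeries.truncTotal (max M₁ M₂) f
  have hp : f - p ∈ maxIdeal n R ^ (max M₁ M₂) := by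
    apply mem_pow_of_coeff
    intro e he
    rw [map_sub, MvPolynomial.coeff_coe, MvPowerSeries.coeff_truncTotal _ he, sub_self]
  have e₁ := h₁ (Ideal.pow_le_pow_right (le_max_left _ _) hp)
  have e₂ := h₂ (Ideal.pow_le_pow_right (le_max_right _ _) hp)
  rw [Ideal.mem_comap, map_sub] at e₁ e₂
  have := add_mem (sub_mem e₁ e₂) (hpoly p)
  convert this using 1
  ring

theorem inv_mul_mem_congruence {ρ σ : G n R} (hρ : ρ ∈ K n R) (hσ : σ ∈ K n R) {N : ℕ}
    (h : ∀ i, G.hom ρ (MvPowerSeries.X i) - G.hom σ (MvPowerSeries.X i) ∈ maxIdeal n R ^ N) :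
    ρ⁻¹ * σ ∈ congruence n R N := by
  intro f
  constructor
  · have := neg_mem (hom_mem_pow (inv_mem hρ) (hom_sub_mem h f))
    rw [map_sub, G.hom_inv_hom] at this
    rw [G.hom_mul, RingHom.comp_apply]
    convert this using 1
    ring
  · have := hom_mem_pow (inv_mem hσ) (hom_sub_mem h f)
    rw [map_sub, G.hom_inv_hom] at this
    rw [mul_inv_rev, inv_inv, G.hom_mul, RingHom.comp_apply]
    exact this

theorem mem_congruence_iff {ρ : G n R} {N : ℕ} (hρ : ρ ∈ K n R) :
    ρ ∈ congruence n R N ↔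
      ∀ i, G.hom ρ (MvPowerSeries.X i) - MvPowerSeries.X i ∈ maxIdeal n R ^ N := by
  refine ⟨fun h i => (h _).1, fun h => ?_⟩
  have := inv_mul_mem_congruence hρ (one_mem _) (N := N) (by simpa using h)
  rw [mul_one] at this
  simpa using inv_mem this

theorem map_mem_pow (f : R →+* R') {N : ℕ} {x : MvPowerSeries (Fin n) R}
    (hx : x ∈ maxIdeal n R ^ N) : MvPowerSeries.map f x ∈ maxIdeal n R' ^ N := by
  apply mem_pow_of_coeff
  intro d hd
  rw [MvPowerSeries.coeff_map, coeff_eq_zero_of_mem_pow N x hx d hd, map_zero]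

theorem congruence_map_mem (f : R →+* R') {N : ℕ} (hN : N ≠ 0) {ρ : G n R}
    (h : ρ ∈ congruence n R N) : G.map f ρ ∈ congruence n R' N := by
  rw [mem_congruence_iff (K.map_mem f (congruence_le_K hN h))]
  intro i
  have := map_mem_pow f (h (MvPowerSeries.X i)).1
  rw [map_sub, MvPowerSeries.map_X] at this
  rwa [G.map_hom_X]

/-- Conjugation is continuous for the topology defined by the congruence subgroups. -/
theorem exists_conj_mem_congruence (σ : G n R) (N : ℕ) :
    ∃ M, ∀ ρ ∈ congruence n R M, σ⁻¹ * ρ * σ ∈ congruence n R N := by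
  obtain ⟨M, hM⟩ := G.continuous σ⁻¹ N
  have key : ∀ ρ ∈ congruence n R M, ∀ f, G.hom (σ⁻¹ * ρ * σ) f - f ∈ maxIdeal n R ^ N := by
    intro ρ hρ f
    have := hM (hρ (G.hom σ f)).1
    rw [Ideal.mem_comap, map_sub, G.hom_inv_hom] at this
    exact this
  refine ⟨M, fun ρ hρ f => ⟨key ρ hρ f, ?_⟩⟩
  have := key ρ⁻¹ (inv_mem hρ) f
  simpa [mul_assoc] using this

end Congruence

/-! ### Étale neighbourhoods of the origin and power series of étale type -/

section EtaleAlgebra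

variable {n : ℕ} {R : Type u} [CommRing R]

/-- Maps out of an unramified algebra of finite type are determined modulo nilpotents. -/
theorem algHom_eq_of_isNilpotent_sub {P B A : Type*} [CommRing P] [CommRing B] [CommRing A]
    [Algebra P B] [Algebra P A] [Algebra.FormallyUnramified P B] [Algebra.FiniteType P B]
    {f g : B →ₐ[P] A} (h : ∀ x, IsNilpotent (f x - g x)) : f = g := by
  obtain ⟨s, hs⟩ := Algebra.FiniteType.out (R := P) (A := B)
  -- Finitely many of the differences generate an ideal which is nilpotent, not merely nil.
  let J : Ideal A := Ideal.span ((fun x => f x - g x) '' (s : Set B))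
  have hJ : IsNilpotent J := by
    rw [Ideal.FG.isNilpotent_iff_le_nilradical
      (Submodule.fg_span (s.finite_toSet.image _)), Ideal.span_le]
    rintro _ ⟨x, -, rfl⟩
    exact h x
  refine Algebra.FormallyUnramified.lift_unique J hJ f g (AlgHom.ext_of_adjoin_eq_top hs ?_)
  intro x hx
  exact Ideal.Quotient.eq.2 (Ideal.subset_span ⟨x, hx, rfl⟩)

/-- The differentials of the coordinates form a basis on an étale neighbourhood in affine space. -/
theorem exists_basis_kaehlerDifferential (T : Type u) [CommRing T] [Algebra R T]
    [Algebra (MvPolynomial (Fin n) R) T] [IsScalarTower R (MvPolynomial (Fin n) R) T]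
    [Algebra.FormallyEtale (MvPolynomial (Fin n) R) T] :
    ∃ c : Module.Basis (Fin n) T (Ω[T⁄R]), ∀ j, c j =
      KaehlerDifferential.D R T (algebraMap (MvPolynomial (Fin n) R) T (MvPolynomial.X j)) := by
  refine ⟨((KaehlerDifferential.mvPolynomialBasis R (Fin n)).baseChange T).map
    (KaehlerDifferential.tensorKaehlerEquivOfFormallyEtale R (MvPolynomial (Fin n) R) T),
    fun j => ?_⟩
  simp

/-- The Jacobian criterion for a map to affine space to be étale. -/
theorem formallyEtale_of_isUnit_det {T : Type u} [CommRing T] [Algebra R T]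
    [Algebra (MvPolynomial (Fin n) R) T] [IsScalarTower R (MvPolynomial (Fin n) R) T]
    [Algebra.FormallySmooth R T] (c : Module.Basis (Fin n) T (Ω[T⁄R]))
    (h : IsUnit (c.det fun j => KaehlerDifferential.D R T
      (algebraMap (MvPolynomial (Fin n) R) T (MvPolynomial.X j)))) :
    Algebra.FormallyEtale (MvPolynomial (Fin n) R) T := by
  let P := MvPolynomial (Fin n) R
  -- Bijectivity here makes the relative differentials vanish, and by the Jacobi–Zariski sequence also
  -- the relative `H₁` of the cotangent complex, as that of the smooth algebra `T` over `R` is zero.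
  have hbij : Function.Bijective (KaehlerDifferential.mapBaseChange R P T) := by
    obtain ⟨h1, h2⟩ := c.is_basis_iff_det.2 h
    let c' := Module.Basis.mk h1 h2.ge
    let b := (KaehlerDifferential.mvPolynomialBasis R (Fin n)).baseChange T
    have : KaehlerDifferential.mapBaseChange R P T =
        (b.equiv c' (Equiv.refl _) : T ⊗[P] Ω[P⁄R] →ₗ[T] Ω[T⁄R]) := by
      refine b.ext fun j => ?_
      rw [LinearEquiv.coe_coe, Module.Basis.equiv_apply]
      simp [b, c', P]
    rw [this]
    exact (b.equiv c' (Equiv.refl _)).bijective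
  refine ⟨?_, ?_⟩
  · refine subsingleton_of_forall_eq 0 fun x => ?_
    obtain ⟨y, rfl⟩ := KaehlerDifferential.map_surjective R P T x
    obtain ⟨z, rfl⟩ := hbij.2 y
    exact (KaehlerDifferential.exact_mapBaseChange_map R P T).apply_apply_eq_zero z
  · refine subsingleton_of_forall_eq 0 fun x => ?_
    have h1 : Algebra.H1Cotangent.δ R P T x = 0 := hbij.1 (by
      rw [(Algebra.H1Cotangent.exact_δ_mapBaseChange R P T).apply_apply_eq_zero, map_zero])
    obtain ⟨y, rfl⟩ := (Algebra.H1Cotangent.exact_map_δ R P T x).1 h1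
    rw [Subsingleton.elim y 0, map_zero]

theorem etale_aeval_of_isUnit_det {T : Type u} [CommRing T] [Algebra R T]
    [Algebra.FormallySmooth R T] [Algebra.FinitePresentation R T]
    (c : Module.Basis (Fin n) T (Ω[T⁄R])) (b : Fin n → T)
    (h : IsUnit (c.det fun j => KaehlerDifferential.D R T (b j))) :
    (MvPolynomial.aeval (R := R) b).toRingHom.Etale := by
  let : Algebra (MvPolynomial (Fin n) R) T := (MvPolynomial.aeval (R := R) b).toRingHom.toAlgebra
  have : IsScalarTower R (MvPolynomial (Fin n) R) T := IsScalarTower.of_algebraMap_eq fun r =>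
    ((MvPolynomial.aeval (R := R) b).commutes r).symm
  have hb : ∀ j, algebraMap (MvPolynomial (Fin n) R) T (MvPolynomial.X j) = b j := fun j =>
    MvPolynomial.aeval_X _ _
  have : Algebra.FormallyEtale (MvPolynomial (Fin n) R) T :=
    formallyEtale_of_isUnit_det c (by simpa only [hb] using h)
  exact ⟨this, Algebra.FinitePresentation.of_restrict_scalars_finitePresentation R _ T⟩

variable {B : Type u} [CommRing B] [Algebra R B] [Algebra (MvPolynomial (Fin n) R) B]
  [IsScalarTower R (MvPolynomial (Fin n) R) B]

/-- Functions on an étale neighbourhood of the origin whose linear parts are independent define an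
étale map to affine space, after shrinking the neighbourhood. -/
theorem exists_etale_aeval [Algebra.Etale (MvPolynomial (Fin n) R) B]
    (θ : B →ₐ[MvPolynomial (Fin n) R] MvPowerSeries (Fin n) R) (b : Fin n → B)
    (hb : IsUnit (linearPart fun i => θ (b i)).det) :
    ∃ h : B, IsUnit (MvPowerSeries.constantCoeff (θ h)) ∧
      (MvPolynomial.aeval (R := R) fun i =>
        algebraMap B (Localization.Away h) (b i)).toRingHom.Etale := by
  obtain ⟨c, hc⟩ := exists_basis_kaehlerDifferential (n := n) (R := R) B
  -- Shrink to the locus where the Jacobian determinant `h` does not vanish; its value on the section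
  -- is the determinant of the linear parts.
  obtain ⟨h, hh⟩ : ∃ h : B, h = c.det fun i => KaehlerDifferential.D R B (b i) := ⟨_, rfl⟩
  refine ⟨h, ?_, ?_⟩
  · let : Algebra B (MvPowerSeries (Fin n) R) := θ.toRingHom.toAlgebra
    have : IsScalarTower R B (MvPowerSeries (Fin n) R) := IsScalarTower.of_algebraMap_eq fun r => by
      change _ = θ _
      rw [IsScalarTower.algebraMap_apply R (MvPolynomial (Fin n) R) B, θ.commutes,
        ← IsScalarTower.algebraMap_apply]
    have key : ∀ i l, θ (c.repr (KaehlerDifferential.D R B (b i)) l) =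
        MvPowerSeries.pderiv R l (θ (b i)) := by
      intro i l
      let δ : Derivation R B (MvPowerSeries (Fin n) R) :=
        (MvPowerSeries.pderiv R l).compAlgebraMap B
      have h1 : δ.liftKaehlerDifferential (KaehlerDifferential.D R B (b i)) = δ (b i) :=
        δ.liftKaehlerDifferential_comp_D _
      rw [← c.sum_repr (KaehlerDifferential.D R B (b i)), map_sum] at h1
      have h2 : ∀ j, δ.liftKaehlerDifferential (c j) = if j = l then 1 else 0 := by
        intro j
        rw [hc, δ.liftKaehlerDifferential_comp_D]
        change MvPowerSeries.pderiv R l (θ _) = _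
        rw [θ.commutes, MvPowerSeries.algebraMap_apply']
        simp [MvPowerSeries.pderiv_X, Pi.single_apply, eq_comm]
      simp only [map_smul, h2, smul_ite, smul_zero, Finset.sum_ite_eq', Finset.mem_univ,
        if_true] at h1
      rw [Algebra.smul_def, mul_one] at h1
      exact h1
    have h3 : MvPowerSeries.constantCoeff (θ h) = (linearPart fun i => θ (b i)).det := by
      have h4 : ∀ x, MvPowerSeries.constantCoeff (θ x) =
        (MvPowerSeries.constantCoeff.comp (θ : B →+* MvPowerSeries (Fin n) R)) x := fun x => rfl
      rw [h4, hh, Module.Basis.det_apply, RingHom.map_det, ← Matrix.det_transpose]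
      congr 1
      ext i j
      simp only [RingHom.mapMatrix_apply, Matrix.transpose_apply, Matrix.map_apply,
        Module.Basis.toMatrix_apply, RingHom.comp_apply, RingHom.coe_coe, key]
      rw [← MvPowerSeries.coeff_zero_eq_constantCoeff_apply, MvPowerSeries.coeff_pderiv]
      simp [linearPart]
    rw [h3]
    exact hb
  · let T := Localization.Away h
    have hsm : Algebra.FormallySmooth R T := by
      have : Algebra.FormallySmooth R B := Algebra.FormallySmooth.comp R (MvPolynomial (Fin n) R) B
      have : Algebra.FormallySmooth B T := Algebra.FormallySmooth.of_isLocalization (.powers h)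
      exact Algebra.FormallySmooth.comp R B T
    obtain ⟨c', hc'⟩ := exists_basis_kaehlerDifferential (n := n) (R := R) T
    have key : ∀ i l, c'.repr (KaehlerDifferential.D R T (algebraMap B T (b i))) l =
        algebraMap B T (c.repr (KaehlerDifferential.D R B (b i)) l) := by
      intro i l
      have h1 := congrArg (KaehlerDifferential.map R R B T)
        (c.sum_repr (KaehlerDifferential.D R B (b i)))
      have h2 : ∀ j, KaehlerDifferential.map R R B T (c j) = c' j := by
        intro j
        rw [hc, KaehlerDifferential.map_D, hc', ← IsScalarTower.algebraMap_apply]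
      rw [map_sum, KaehlerDifferential.map_D] at h1
      rw [← h1]
      simp only [map_smul, h2]
      simp only [← algebraMap_smul T (_ : B)]
      rw [c'.repr_sum_self]
    have hu : IsUnit (c'.det fun i => KaehlerDifferential.D R T (algebraMap B T (b i))) := by
      have : c'.det (fun i => KaehlerDifferential.D R T (algebraMap B T (b i))) =
          algebraMap B T h := by
        refine Eq.trans ?_ (congrArg (algebraMap B T) hh).symm
        rw [Module.Basis.det_apply, Module.Basis.det_apply, RingHom.map_det]
        congr 1
        ext i j
        simp [Module.Basis.toMatrix_apply, key]
      rw [this]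
      exact IsLocalization.Away.algebraMap_isUnit h
    have hfp : Algebra.FinitePresentation R T := by
      have : Algebra.FinitePresentation R B :=
        Algebra.FinitePresentation.trans R (MvPolynomial (Fin n) R) B
      have : Algebra.FinitePresentation B T := IsLocalization.Away.finitePresentation h
      exact Algebra.FinitePresentation.trans R B T
    exact etale_aeval_of_isUnit_det c' _ hu

/-- After shrinking, an étale neighbourhood of the origin meets the fibre `t = 0` in the section
only: the functions vanishing on the section become combinations of the coordinates. -/
theorem exists_mul_mem_span [Algebra.Etale (MvPolynomial (Fin n) R) B]
    (θ : B →ₐ[MvPolynomial (Fin n) R] MvPowerSeries (Fin n) R) :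
    ∃ h : B, MvPowerSeries.constantCoeff (θ h) = 1 ∧
      ∀ x, MvPowerSeries.constantCoeff (θ x) = 0 → h * x ∈ Ideal.span (Set.range fun i =>
        algebraMap (MvPolynomial (Fin n) R) B (MvPolynomial.X i)) := by
  let P := MvPolynomial (Fin n) R
  let σ : B →ₐ[R] R :=
    { (MvPowerSeries.constantCoeff.comp (θ : B →+* MvPowerSeries (Fin n) R)) with
      commutes' := fun r => by
        change MvPowerSeries.constantCoeff (θ (algebraMap R B r)) = r
        rw [IsScalarTower.algebraMap_apply R P B, θ.commutes, MvPowerSeries.algebraMap_apply']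
        simp [P] }
  have hσP : ∀ p : P, σ (algebraMap P B p) = MvPolynomial.constantCoeff p := fun p => by
    change MvPowerSeries.constantCoeff (θ _) = _
    rw [θ.commutes, MvPowerSeries.algebraMap_apply']
    simp [P, ← MvPowerSeries.coeff_zero_eq_constantCoeff_apply, MvPolynomial.constantCoeff_eq]
  let I : Ideal B := RingHom.ker σ
  let J : Ideal B := Ideal.span (Set.range fun i => algebraMap P B (MvPolynomial.X i))
  have hI : I.FG := by
    have : Algebra.FinitePresentation R B := Algebra.FinitePresentation.trans R P B
    exact Algebra.FinitePresentation.ker_fG_of_surjective σ fun r =>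
      ⟨algebraMap R B r, σ.commutes r⟩
  have hJI : J ≤ I := by
    rw [Ideal.span_le]
    rintro _ ⟨i, rfl⟩
    change σ _ = 0
    rw [hσP]
    simp
  have hle : I ≤ J ⊔ I • I := by
    -- Over the polynomial ring, the quotient map and the map through the section agree modulo a
    -- square-zero ideal, so they agree.
    let A := B ⧸ (J ⊔ I • I)
    have hC : ∀ p : P, (Ideal.Quotient.mk (J ⊔ I • I)) (algebraMap P B p) =
        Ideal.Quotient.mk (J ⊔ I • I) (algebraMap R B (MvPolynomial.constantCoeff p)) := by
      intro p
      have : ((Ideal.Quotient.mk (J ⊔ I • I)).comp (algebraMap P B)) =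
          ((Ideal.Quotient.mk (J ⊔ I • I)).comp (algebraMap R B)).comp
            MvPolynomial.constantCoeff := by
        apply MvPolynomial.ringHom_ext
        · intro r
          simp only [RingHom.comp_apply, MvPolynomial.constantCoeff_C]
          rw [IsScalarTower.algebraMap_apply R P B]
          rfl
        · intro i
          simp only [RingHom.comp_apply, MvPolynomial.constantCoeff_X, map_zero]
          exact Ideal.Quotient.eq_zero_iff_mem.2
            (Ideal.mem_sup_left (Ideal.subset_span ⟨i, rfl⟩))
      exact congrArg (fun f : _ →+* _ => f p) this
    let f : B →ₐ[P] A := Ideal.Quotient.mkₐ P _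
    let g : B →ₐ[P] A :=
      { ((Ideal.Quotient.mk (J ⊔ I • I)).comp ((algebraMap R B).comp (σ : B →+* R))) with
        commutes' := fun p => by
          change Ideal.Quotient.mk (J ⊔ I • I) (algebraMap R B (σ (algebraMap P B p))) =
            Ideal.Quotient.mk (J ⊔ I • I) (algebraMap P B p)
          rw [hC, hσP] }
    have hfg : f = g := by
      refine algHom_eq_of_isNilpotent_sub fun x => ⟨2, ?_⟩
      have hx : x - algebraMap R B (σ x) ∈ I := by
        change σ _ = 0
        rw [map_sub, σ.commutes]
        simp
      change (Ideal.Quotient.mk (J ⊔ I • I) x -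
        Ideal.Quotient.mk (J ⊔ I • I) (algebraMap R B (σ x))) ^ 2 = 0
      rw [← map_sub, ← map_pow, Ideal.Quotient.eq_zero_iff_mem, pow_two]
      exact Ideal.mem_sup_right (Ideal.mul_mem_mul hx hx)
    intro x hx
    have h1 : f x = g x := by rw [hfg]
    change Ideal.Quotient.mk (J ⊔ I • I) x =
      Ideal.Quotient.mk (J ⊔ I • I) (algebraMap R B (σ x)) at h1
    rw [show σ x = 0 from hx, map_zero, map_zero] at h1
    exact Ideal.Quotient.eq_zero_iff_mem.1 h1
  obtain ⟨h, h1, h2⟩ := Submodule.exists_sub_one_mem_and_smul_le_of_fg_of_le_sup hI le_rfl hle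
  refine ⟨h, ?_, fun x hx => ?_⟩
  · have : σ (h - 1) = 0 := h1
    rw [map_sub, map_one, sub_eq_zero] at this
    exact this
  · exact h2 (Submodule.smul_mem_pointwise_smul x h I hx)

end EtaleAlgebra

section EtaleFamily

variable {n : ℕ} {R : Type u} [CommRing R] {R' : Type u} [CommRing R']

/-- The power series of a family are of étale type if they are the expansions at the origin of
functions on a common étale neighbourhood `Spec B ⟶ 𝔸ⁿ` of the origin. The section of the
neighbourhood is `B → R⟦t⟧ → R`; the expansion `θ` is determined by it. -/
def IsEtaleFamily {ι : Type*} (f : ι → MvPowerSeries (Fin n) R) : Prop :=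
  ∃ (B : Type u) (_ : CommRing B) (_ : Algebra (MvPolynomial (Fin n) R) B)
    (_ : Algebra.Etale (MvPolynomial (Fin n) R) B)
    (θ : B →ₐ[MvPolynomial (Fin n) R] MvPowerSeries (Fin n) R), ∀ i, f i ∈ θ.range

theorem isEtaleFamily_polynomial {ι : Type*} (p : ι → MvPolynomial (Fin n) R) :
    IsEtaleFamily fun i => (p i : MvPowerSeries (Fin n) R) :=
  ⟨MvPolynomial (Fin n) R, inferInstance, inferInstance, inferInstance,
    Algebra.ofId _ _, fun i => ⟨p i, rfl⟩⟩

/-- Series of étale type without constant term are combinations of the coordinates with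
coefficients of étale type. -/
theorem IsEtaleFamily.exists_eq_sum {ι : Type*} {f : ι → MvPowerSeries (Fin n) R}
    (hf : IsEtaleFamily f) (h0 : ∀ i, MvPowerSeries.constantCoeff (f i) = 0) :
    ∃ g : ι × Fin n → MvPowerSeries (Fin n) R, IsEtaleFamily g ∧
      ∀ i, f i = ∑ j, g (i, j) * MvPowerSeries.X j := by
  obtain ⟨B, _, _, _, θ, hθ⟩ := hf
  choose b hb using hθ
  let : Algebra R B := Algebra.compHom B (algebraMap R (MvPolynomial (Fin n) R))
  have : IsScalarTower R (MvPolynomial (Fin n) R) B := IsScalarTower.of_algebraMap_eq fun r => rfl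
  obtain ⟨h, h1, h2⟩ := exists_mul_mem_span (R := R) θ
  have h3 : ∀ i, h * b i ∈ Ideal.span (Set.range fun i =>
      algebraMap (MvPolynomial (Fin n) R) B (MvPolynomial.X i)) := fun i =>
    h2 _ ((congrArg _ (hb i)).trans (h0 i))
  choose c hc using fun i => Ideal.mem_span_range_iff_exists_fun.1 (h3 i)
  have hu : IsUnit (θ h) := by
    rw [MvPowerSeries.isUnit_iff_constantCoeff, h1]
    exact isUnit_one
  have hu' : ∀ y : Submonoid.powers h, IsUnit (θ y) := by
    rintro ⟨_, m, rfl⟩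
    change IsUnit (θ (h ^ m))
    rw [map_pow]
    exact hu.pow m
  let θ' : Localization.Away h →ₐ[MvPolynomial (Fin n) R] MvPowerSeries (Fin n) R :=
    IsLocalization.liftAlgHom (M := Submonoid.powers h) hu'
  have hθ' : ∀ x, θ' (algebraMap B _ x) = θ x := fun x =>
    IsLocalization.lift_eq (M := Submonoid.powers h) (g := (θ : B →+* MvPowerSeries (Fin n) R)) hu' x
  refine ⟨fun p => θ' (algebraMap B _ (c p.1 p.2) * IsLocalization.Away.invSelf h),
    ⟨Localization.Away h, inferInstance, inferInstance, inferInstance, θ', fun p => ⟨_, rfl⟩⟩,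
    fun i => ?_⟩
  have h4 : θ' (IsLocalization.Away.invSelf h) * θ h = 1 := by
    rw [← hθ', ← map_mul, mul_comm, IsLocalization.Away.mul_invSelf, map_one]
  have h5 := congrArg θ (hc i)
  have hX : ∀ j, θ (algebraMap (MvPolynomial (Fin n) R) B (MvPolynomial.X j)) =
      MvPowerSeries.X j := fun j => by
    rw [θ.commutes, MvPowerSeries.algebraMap_apply']
    simp
  have hb' : θ (b i) = f i := hb i
  simp only [map_sum, map_mul, hX, hb'] at h5
  simp only [map_mul, hθ']
  calc f i = θ' (IsLocalization.Away.invSelf h) * (θ h * f i) := by rw [← mul_assoc, h4, one_mul]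
    _ = _ := by
      rw [← h5, Finset.mul_sum]
      exact Finset.sum_congr rfl fun j _ => by ring

/-- Series of étale type are stable under the substitution `tᵢ ↦ a tᵢ` (along with a change of
coefficients): pull back the étale neighbourhood. -/
theorem IsEtaleFamily.rescale {ι : Type*} {f : ι → MvPowerSeries (Fin n) R}
    (hf : IsEtaleFamily f) (φ : R →+* R') (a : R') :
    IsEtaleFamily fun i => MvPowerSeries.rescale (fun _ => a) (MvPowerSeries.map φ (f i)) := by
  obtain ⟨B, _, _, _, θ, hθ⟩ := hf
  let P := MvPolynomial (Fin n) R
  let P' := MvPolynomial (Fin n) R'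
  let τ : P →+* P' := MvPolynomial.eval₂Hom (MvPolynomial.C.comp φ)
    fun i => MvPolynomial.C a * MvPolynomial.X i
  let S : MvPowerSeries (Fin n) R →+* MvPowerSeries (Fin n) R' :=
    (MvPowerSeries.rescale fun _ => a).comp (MvPowerSeries.map φ)
  let : Algebra P P' := τ.toAlgebra
  let : Algebra P (MvPowerSeries (Fin n) R') := ((algebraMap P' _).comp τ).toAlgebra
  have : IsScalarTower P P' (MvPowerSeries (Fin n) R') := IsScalarTower.of_algebraMap_eq fun r => rfl
  have hS : ∀ p : P, S (algebraMap P (MvPowerSeries (Fin n) R) p) =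
      algebraMap P (MvPowerSeries (Fin n) R') p := by
    intro p
    change S _ = algebraMap P' (MvPowerSeries (Fin n) R') (τ p)
    rw [MvPowerSeries.algebraMap_apply', MvPowerSeries.algebraMap_apply']
    have : S.comp MvPolynomial.coeToMvPowerSeries.ringHom =
        MvPolynomial.coeToMvPowerSeries.ringHom.comp τ := by
      apply MvPolynomial.ringHom_ext
      · intro r
        simp [S, τ, MvPowerSeries.rescale_eq_subst]
      · intro i
        simp only [S, τ, RingHom.comp_apply, MvPolynomial.coe_eval₂Hom, MvPolynomial.eval₂_X,
          MvPolynomial.coeToMvPowerSeries.ringHom_apply, MvPolynomial.coe_X, MvPowerSeries.map_X,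
          MvPowerSeries.rescale_eq_subst]
        rw [MvPowerSeries.subst_X (MvPowerSeries.HasSubst.smul_X _)]
        change a • (MvPowerSeries.X i : MvPowerSeries (Fin n) R') =
          ((MvPolynomial.C a * MvPolynomial.X i : MvPolynomial (Fin n) R') : MvPowerSeries _ R')
        rw [MvPolynomial.coe_mul, MvPolynomial.coe_C, MvPolynomial.coe_X,
          MvPowerSeries.smul_eq_C_mul]
    have h2 := congrArg (fun f : _ →+* _ => f p) this
    simp only [RingHom.comp_apply, MvPolynomial.coeToMvPowerSeries.ringHom_apply] at h2
    simpa [P] using h2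
  let g : B →ₐ[P] MvPowerSeries (Fin n) R' :=
    { S.comp (θ : B →+* MvPowerSeries (Fin n) R) with
      commutes' := fun p => by
        change S (θ _) = _
        rw [θ.commutes, hS] }
  refine ⟨P' ⊗[P] B, inferInstance, inferInstance, inferInstance,
    Algebra.TensorProduct.lift (Algebra.ofId P' _) g (fun _ _ => Commute.all _ _), fun i => ?_⟩
  obtain ⟨b, hb⟩ := hθ i
  refine ⟨1 ⊗ₜ b, ?_⟩
  change Algebra.TensorProduct.lift (Algebra.ofId P' _) g _ (1 ⊗ₜ b) = _
  rw [Algebra.TensorProduct.lift_tmul, map_one, one_mul]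
  exact congrArg S hb

end EtaleFamily

/-! ### Automorphisms of étale type -/

section EtaleAutomorphisms

variable {n : ℕ} {R : Type u} [CommRing R]

theorem etale_SpecMap {A B : Type u} [CommRing A] [CommRing B] {f : A →+* B} :
    Etale (Spec.map (CommRingCat.ofHom f)) ↔ f.Etale :=
  HasRingHomProperty.Spec_iff (P := @Etale)

/-- An automorphism is of étale type as soon as the series `ρ(tᵢ)` are the expansions at the origin
of functions on an étale neighbourhood `ψ` of the origin which define an étale map `φ`. -/
theorem exists_induces {T : Type u} [CommRing T] {φ ψ : MvPolynomial (Fin n) R →+* T}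
    (hφ : φ.Etale) (hψ : ψ.Etale) (hC : φ.comp MvPolynomial.C = ψ.comp MvPolynomial.C)
    {θ : T →+* MvPowerSeries (Fin n) R} {ρ : G n R}
    (hθψ : θ.comp ψ = MvPolynomial.coeToMvPowerSeries.ringHom)
    (hθφ : θ.comp φ = (G.hom ρ).comp MvPolynomial.coeToMvPowerSeries.ringHom) :
    ∃ V : CommonEtaleNhd n R, V.Induces ρ ∧ (ρ ∈ K n R → V.IsStrict) := by
  let s : T →+* R := MvPowerSeries.constantCoeff.comp θ
  have hsψ : s.comp ψ = MvPolynomial.constantCoeff := by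
    rw [RingHom.comp_assoc, hθψ]
    apply MvPolynomial.ringHom_ext <;> simp
  have hsφC : (s.comp φ).comp MvPolynomial.C = RingHom.id R := by
    rw [RingHom.comp_assoc, hC, ← RingHom.comp_assoc, hsψ]
    ext r; simp
  have hsφX : ∀ i, s (φ (MvPolynomial.X i)) =
      MvPowerSeries.constantCoeff (G.hom ρ (MvPowerSeries.X i)) := fun i => by
    have := congrArg (fun f : _ →+* _ => f (MvPolynomial.X i)) hθφ
    simp only [RingHom.comp_apply, MvPolynomial.coeToMvPowerSeries.ringHom_apply,
      MvPolynomial.coe_X] at this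
    simp [s, this]
  have := etale_SpecMap.2 hφ
  have := etale_SpecMap.2 hψ
  let V : CommonEtaleNhd n R :=
    { V := Spec (.of T)
      π := Spec.map (CommRingCat.ofHom (φ.comp MvPolynomial.C))
      σ := Spec.map (CommRingCat.ofHom s)
      section_proj := by
        rw [← Spec.map_comp, ← CommRingCat.ofHom_comp, ← RingHom.comp_assoc, hsφC]
        exact Spec.map_id _
      smooth := by
        have h := smooth_of_etale (Spec.map (CommRingCat.ofHom φ)) inferInstance
        rwa [affineProj, ← Spec.map_comp, ← CommRingCat.ofHom_comp] at h
      φ := Spec.map (CommRingCat.ofHom φ)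
      ψ := Spec.map (CommRingCat.ofHom ψ)
      etale_φ := inferInstance
      etale_ψ := inferInstance
      φ_proj := by rw [affineProj, ← Spec.map_comp, ← CommRingCat.ofHom_comp]
      ψ_proj := by rw [affineProj, ← Spec.map_comp, ← CommRingCat.ofHom_comp, hC]
      red_φ := by
        rw [redEmb, zeroSection, ← Spec.map_comp, ← Spec.map_comp, ← Spec.map_comp,
          ← CommRingCat.ofHom_comp, ← CommRingCat.ofHom_comp, ← CommRingCat.ofHom_comp]
        congr 2
        apply MvPolynomial.ringHom_ext
        · intro r
          have := congrArg (fun f : _ →+* _ => f r) hsφC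
          simp only [RingHom.comp_apply, RingHom.id_apply] at this
          simp [this]
        · intro i
          change Ideal.Quotient.mk _ (s (φ (MvPolynomial.X i))) = _
          rw [hsφX, RingHom.comp_apply, MvPolynomial.constantCoeff_X, map_zero]
          exact Ideal.Quotient.eq_zero_iff_mem.2 ((G.continuous ρ).isNilpotent i)
      red_ψ := by
        rw [zeroSection, ← Spec.map_comp (CommRingCat.ofHom ψ), ← CommRingCat.ofHom_comp, hsψ] }
  refine ⟨V, ?_, fun hρ => ⟨?_, ?_⟩⟩
  · intro A _ χ hχ
    refine ⟨Spec.map (CommRingCat.ofHom (χ.comp θ)), ⟨?_, ?_⟩, ?_, ?_⟩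
    · change _ ≫ Spec.map (CommRingCat.ofHom (φ.comp MvPolynomial.C)) = _
      rw [hC, ← Spec.map_comp, ← CommRingCat.ofHom_comp, RingHom.comp_assoc,
        ← RingHom.comp_assoc _ _ θ, hθψ]
      congr 2
      ext r
      simp
    · change _ = _ ≫ _ ≫ Spec.map (CommRingCat.ofHom s)
      rw [redEmb, ← Spec.map_comp, ← Spec.map_comp, ← Spec.map_comp,
        ← CommRingCat.ofHom_comp, ← CommRingCat.ofHom_comp, ← CommRingCat.ofHom_comp]
      congr 2
      ext x
      -- A formal point kills the coordinates up to nilpotents.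
      obtain ⟨N, hN⟩ := hχ
      refine Ideal.Quotient.eq.2 ⟨N, ?_⟩
      simp only [s, RingHom.comp_apply]
      rw [← map_sub, ← map_pow]
      exact hN (Ideal.pow_mem_pow (sub_C_mem _) N)
    · change _ ≫ Spec.map (CommRingCat.ofHom ψ) = _
      rw [toAffineSpace, ← Spec.map_comp, ← CommRingCat.ofHom_comp, RingHom.comp_assoc, hθψ]
    · change _ ≫ Spec.map (CommRingCat.ofHom φ) = _
      rw [toAffineSpace, ← Spec.map_comp, ← CommRingCat.ofHom_comp, RingHom.comp_assoc, hθφ,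
        RingHom.comp_assoc]
  · change Spec.map (CommRingCat.ofHom s) ≫ Spec.map (CommRingCat.ofHom φ) = _
    rw [zeroSection, ← Spec.map_comp, ← CommRingCat.ofHom_comp]
    congr 2
    apply MvPolynomial.ringHom_ext
    · intro r
      have := congrArg (fun f : _ →+* _ => f r) hsφC
      simp only [RingHom.comp_apply, RingHom.id_apply] at this
      simp [this]
    · intro i
      rw [RingHom.comp_apply, hsφX, MvPolynomial.constantCoeff_X]
      exact hρ i
  · change Spec.map (CommRingCat.ofHom s) ≫ Spec.map (CommRingCat.ofHom ψ) = _
    rw [zeroSection, ← Spec.map_comp, ← CommRingCat.ofHom_comp, hsψ]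

/-- A formal automorphism fixing the origin whose components are expansions of functions on an étale
neighbourhood of the origin lies in `K^ét`: by the Jacobian criterion these functions define an étale
map to affine space near the origin. -/
theorem mem_Ket_of_isEtaleFamily {ρ : G n R} (hρ : ρ ∈ K n R)
    (h : IsEtaleFamily fun i => G.hom ρ (MvPowerSeries.X i)) : ρ ∈ Ket n R := by
  obtain ⟨B, _, _, _, θ, hθ⟩ := h
  choose b hb using hθ
  replace hb : ∀ i, θ (b i) = G.hom ρ (MvPowerSeries.X i) := hb
  let : Algebra R B := Algebra.compHom B (algebraMap R (MvPolynomial (Fin n) R))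
  have : IsScalarTower R (MvPolynomial (Fin n) R) B := IsScalarTower.of_algebraMap_eq fun r => rfl
  obtain ⟨h, hu, het⟩ := exists_etale_aeval (R := R) θ b (by
    simpa only [hb] using isUnit_det_linearPart hρ)
  have hu1 : IsUnit (θ h) := MvPowerSeries.isUnit_iff_constantCoeff.2 hu
  have hu' : ∀ y : Submonoid.powers h, IsUnit (θ y) := by
    rintro ⟨_, m, rfl⟩
    change IsUnit (θ (h ^ m))
    rw [map_pow]
    exact hu1.pow m
  let θ' : Localization.Away h →+* MvPowerSeries (Fin n) R :=
    IsLocalization.lift (M := Submonoid.powers h) (g := (θ : B →+* MvPowerSeries (Fin n) R)) hu'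
  have hθ' : ∀ x, θ' (algebraMap B _ x) = θ x := fun x => IsLocalization.lift_eq _ x
  have hP : ∀ p : MvPolynomial (Fin n) R,
      θ' (algebraMap _ (Localization.Away h) p) = (p : MvPowerSeries (Fin n) R) := by
    intro p
    rw [IsScalarTower.algebraMap_apply _ B, hθ', θ.commutes, MvPowerSeries.algebraMap_apply']
    simp
  obtain ⟨V, h1, h2⟩ := exists_induces (ρ := ρ)
    (φ := (MvPolynomial.aeval (R := R) fun i =>
        algebraMap B (Localization.Away h) (b i)).toRingHom)
    (ψ := algebraMap (MvPolynomial (Fin n) R) (Localization.Away h)) (θ := θ') het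
    (RingHom.etale_algebraMap.2 inferInstance)
    (by
      ext r
      change MvPolynomial.aeval _ (MvPolynomial.C r) = _
      rw [MvPolynomial.aeval_C]
      exact IsScalarTower.algebraMap_apply R (MvPolynomial (Fin n) R) (Localization.Away h) r)
    (RingHom.ext hP)
    (by
      apply MvPolynomial.ringHom_ext
      · intro r
        change θ' (MvPolynomial.aeval _ (MvPolynomial.C r)) = _
        rw [MvPolynomial.aeval_C, IsScalarTower.algebraMap_apply R (MvPolynomial (Fin n) R), hP]
        simp
      · intro i
        change θ' (MvPolynomial.aeval _ (MvPolynomial.X i)) = _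
        rw [MvPolynomial.aeval_X, hθ', hb]
        simp)
  exact ⟨hρ, V, h2 hρ, h1⟩

/-- `G^ét(R) ∩ K(R) = K^ét(R)`. -/
theorem mem_Ket_of_mem_Get {ρ : G n R} (h : ρ ∈ Get n R) (hK : ρ ∈ K n R) : ρ ∈ Ket n R := by
  obtain ⟨V, hV⟩ := h
  have hC : (MvPowerSeries.constantCoeff (σ := Fin n) (R := R)).comp MvPowerSeries.C =
      RingHom.id R := by ext r; simp
  have hK' : MvPowerSeries.constantCoeff.comp (G.hom ρ) =
      MvPowerSeries.constantCoeff (σ := Fin n) (R := R) := by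
    ext x; exact constantCoeff_hom hK x
  -- The preimage of the zero section is a new section, which makes the neighbourhood strict.
  obtain ⟨s, hs, e₁, e₂⟩ := hV R MvPowerSeries.constantCoeff isFormalPoint_constantCoeff
  obtain ⟨hs1, hs2⟩ := hs
  have hid : Spec.map (CommRingCat.ofHom (RingHom.id R)) = 𝟙 (Spec (.of R)) := Spec.map_id _
  rw [hC, hid] at hs1 hs2
  rw [Category.id_comp] at hs2
  rw [toAffineSpace_constantCoeff] at e₁
  rw [hK', toAffineSpace_constantCoeff] at e₂
  let V' : CommonEtaleNhd n R :=
    { V with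
      σ := s
      section_proj := hs1
      red_φ := by rw [e₂]
      red_ψ := by rw [e₁] }
  refine ⟨hK, V', ⟨e₂, e₁⟩, fun A _ χ hχ => ?_⟩
  obtain ⟨v, ⟨hv1, hv2⟩, hv3⟩ := hV A χ hχ
  refine ⟨v, ⟨hv1, hv2.trans ?_⟩, hv3⟩
  change _ = _ ≫ _ ≫ s
  obtain ⟨s', hs'⟩ := redEmb_naturality (χ.comp (MvPowerSeries.C (σ := Fin n)))
  rw [reassoc_of% hs', reassoc_of% hs', hs2]

theorem constantCoeff_coe (p : MvPolynomial (Fin n) R) :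
    MvPowerSeries.constantCoeff (p : MvPowerSeries (Fin n) R) = MvPolynomial.constantCoeff p := by
  rw [← MvPowerSeries.coeff_zero_eq_constantCoeff_apply, MvPolynomial.coeff_coe,
    MvPolynomial.constantCoeff_eq]

theorem redEmb_surjective (A : Type u) [CommRing A] : Function.Surjective (redEmb A) := by
  rw [← Set.range_eq_univ]
  change Set.range (PrimeSpectrum.comap (Ideal.Quotient.mk (nilradical A))) = _
  rw [range_comap_of_surjective _ _ Ideal.Quotient.mk_surjective, Ideal.mk_ker]
  exact (PrimeSpectrum.zeroLocus_eq_univ_iff _).2 fun x hx => hx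

theorem PointedFamily.mem_of_mem_formalPoints (V : PointedFamily n R) {U : V.V.Opens}
    (hU : ∀ x, V.σ x ∈ U) {A : Type u} [CommRing A] {s : R →+* A} {v : Spec (.of A) ⟶ V.V}
    (hv : v ∈ V.formalPoints s) (x : Spec (.of A)) : v x ∈ U := by
  obtain ⟨y, rfl⟩ := redEmb_surjective A x
  have h1 : (redEmb A ≫ v) y = (redEmb A ≫ Spec.map (CommRingCat.ofHom s) ≫ V.σ) y := by
    rw [hv.2]
  simp only [Scheme.Hom.comp_apply] at h1
  rw [h1]
  exact hU _

/-- Over a local ring the section of a strict common étale neighbourhood lies in an affine open, so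
the automorphism induced by the neighbourhood is given by series of étale type. -/
theorem isEtaleFamily_of_mem_Ket [IsLocalRing R] {ρ : G n R} (h : ρ ∈ Ket n R) :
    IsEtaleFamily fun i => G.hom ρ (MvPowerSeries.X i) := by
  obtain ⟨hK, V, st, hV⟩ := h
  let P := MvPolynomial (Fin n) R
  obtain ⟨_, ⟨U, hU, rfl⟩, hxU, -⟩ := V.V.isBasis_affineOpens.exists_subset_of_mem_open
    (Set.mem_univ (V.σ (IsLocalRing.closedPoint R))) isOpen_univ
  have hσU : ∀ x, V.σ x ∈ U := fun x =>
    ((IsLocalRing.specializes_closedPoint x).map V.σ.continuous).mem_open U.2 hxU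
  let j := hU.fromSpec
  have hopen : IsOpenImmersion j := hU.isOpenImmersion_fromSpec
  have hj : Set.range j = U := hU.range_fromSpec
  let B := Γ(V.V, U)
  let σ' : Spec (.of R) ⟶ Spec B := IsOpenImmersion.lift j V.σ (by
    rw [hj]; rintro _ ⟨x, rfl⟩; exact hσU x)
  have hσ' : σ' ≫ j = V.σ := IsOpenImmersion.lift_fac _ _ _
  let σr : B →+* R := (Spec.preimage σ').hom
  have hσr : Spec.map (CommRingCat.ofHom σr) = σ' := Spec.map_preimage _
  let ψr : P →+* B := (Spec.preimage (j ≫ V.ψ)).hom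
  have hψr : Spec.map (CommRingCat.ofHom ψr) = j ≫ V.ψ := Spec.map_preimage _
  let φr : P →+* B := (Spec.preimage (j ≫ V.φ)).hom
  have hφr : Spec.map (CommRingCat.ofHom φr) = j ≫ V.φ := Spec.map_preimage _
  let : Algebra P B := ψr.toAlgebra
  have : Algebra.Etale P B := by
    have := V.etale_ψ
    have h : Etale (Spec.map (CommRingCat.ofHom ψr)) := by
      rw [hψr]; infer_instance
    exact etale_SpecMap.1 h
  have hσψ : σr.comp ψr = MvPolynomial.constantCoeff := by
    have : Spec.map (CommRingCat.ofHom (σr.comp ψr)) = zeroSection n R := by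
      rw [CommRingCat.ofHom_comp, Spec.map_comp, hσr, hψr, reassoc_of% hσ', st.2]
    exact congrArg CommRingCat.Hom.hom (Spec.map_injective this)
  let f : B →ₐ[P] MvPowerSeries (Fin n) R ⧸ maxIdeal n R :=
    { (Ideal.Quotient.mk (maxIdeal n R)).comp (MvPowerSeries.C.comp σr) with
      commutes' := fun p => by
        change Ideal.Quotient.mk (maxIdeal n R) (MvPowerSeries.C ((σr.comp ψr) p)) =
          Ideal.Quotient.mk (maxIdeal n R) (algebraMap P (MvPowerSeries (Fin n) R) p)
        rw [hσψ, Ideal.Quotient.eq, MvPowerSeries.algebraMap_apply', mem_maxIdeal_iff]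
        rw [map_sub, MvPowerSeries.constantCoeff_C, Algebra.algebraMap_self, MvPowerSeries.map_id,
          RingHom.id_apply, constantCoeff_coe, sub_self] }
  -- `B` is étale over the polynomial ring, so the section lifts to the expansion at the origin.
  obtain ⟨θ, hθ⟩ := Algebra.FormallySmooth.exists_mkₐ_comp_eq_of_isAdicComplete f
  have hθ' : ∀ b, θ b - MvPowerSeries.C (σr b) ∈ maxIdeal n R := fun b =>
    Ideal.Quotient.eq.1 (congrArg (fun f : _ →ₐ[P] _ => f b) hθ)
  refine ⟨B, inferInstance, inferInstance, inferInstance, θ, fun i =>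
    ⟨φr (MvPolynomial.X i), eq_of_forall_sub_mem_pow fun N => ?_⟩⟩
  let A := MvPowerSeries (Fin n) R ⧸ maxIdeal n R ^ N
  let χ : MvPowerSeries (Fin n) R →+* A := Ideal.Quotient.mk _
  have hχ : IsFormalPoint χ := ⟨N, by rw [Ideal.mk_ker]⟩
  obtain ⟨v, ⟨hv1, hv2⟩, hvψ, hvφ⟩ := hV A χ hχ
  have hvU : ∀ x, v x ∈ U := V.mem_of_mem_formalPoints hσU ⟨hv1, hv2⟩
  let v' : Spec (.of A) ⟶ Spec B := IsOpenImmersion.lift j v (by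
    rw [hj]; rintro _ ⟨x, rfl⟩; exact hvU x)
  have hv' : v' ≫ j = v := IsOpenImmersion.lift_fac _ _ _
  let vr : B →+* A := (Spec.preimage v').hom
  have hvr : Spec.map (CommRingCat.ofHom vr) = v' := Spec.map_preimage _
  have hvrψ : vr.comp ψr = χ.comp MvPolynomial.coeToMvPowerSeries.ringHom := by
    have : Spec.map (CommRingCat.ofHom (vr.comp ψr)) = toAffineSpace χ := by
      rw [CommRingCat.ofHom_comp, Spec.map_comp, hvr, hψr, reassoc_of% hv', hvψ]
    exact congrArg CommRingCat.Hom.hom (Spec.map_injective this)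
  have hvrφ : vr.comp φr = (χ.comp (G.hom ρ)).comp MvPolynomial.coeToMvPowerSeries.ringHom := by
    have : Spec.map (CommRingCat.ofHom (vr.comp φr)) = toAffineSpace (χ.comp (G.hom ρ)) := by
      rw [CommRingCat.ofHom_comp, Spec.map_comp, hvr, hφr, reassoc_of% hv', hvφ]
    exact congrArg CommRingCat.Hom.hom (Spec.map_injective this)
  have hvrσ : ∀ b, IsNilpotent (χ (MvPowerSeries.C (σr b)) - vr b) := by
    have h1 : redEmb A ≫ Spec.map (CommRingCat.ofHom vr) =
        redEmb A ≫ Spec.map (CommRingCat.ofHom (χ.comp MvPowerSeries.C)) ≫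
          Spec.map (CommRingCat.ofHom σr) := by
      rw [← cancel_mono j, hvr, hσr]
      simp only [Category.assoc]
      rw [hv', hσ', hv2]
    rw [redEmb, ← Spec.map_comp, ← Spec.map_comp, ← Spec.map_comp, ← CommRingCat.ofHom_comp,
      ← CommRingCat.ofHom_comp, ← CommRingCat.ofHom_comp] at h1
    intro b
    have h2 := congrArg (fun f => CommRingCat.Hom.hom f b) (Spec.map_injective h1)
    exact Ideal.Quotient.eq.1 h2.symm
  -- Both maps lift the section modulo nilpotents, and `B` is étale.
  let g₁ : B →ₐ[P] A := (Ideal.Quotient.mkₐ P (maxIdeal n R ^ N)).comp θ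
  let g₂ : B →ₐ[P] A :=
    { vr with
      commutes' := fun p => by
        change (vr.comp ψr) p = χ (algebraMap P (MvPowerSeries (Fin n) R) p)
        rw [hvrψ, MvPowerSeries.algebraMap_apply']
        simp [P] }
  have hg : g₁ = g₂ := by
    refine algHom_eq_of_isNilpotent_sub fun b => ?_
    have h1 : IsNilpotent (χ (θ b - MvPowerSeries.C (σr b))) :=
      ⟨N, by
        rw [← map_pow]
        exact Ideal.Quotient.eq_zero_iff_mem.2 (Ideal.pow_mem_pow (hθ' b) N)⟩
    have h2 := (Commute.all _ _).isNilpotent_add h1 (hvrσ b)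
    rw [map_sub, sub_add_sub_cancel] at h2
    exact h2
  have h1 : χ (θ (φr (MvPolynomial.X i))) = vr (φr (MvPolynomial.X i)) :=
    congrArg (fun f : _ →ₐ[P] _ => f (φr (MvPolynomial.X i))) hg
  have h2 : vr (φr (MvPolynomial.X i)) = χ (G.hom ρ (MvPowerSeries.X i)) := by
    have := congrArg (fun f : _ →+* _ => f (MvPolynomial.X i)) hvrφ
    simpa using this
  exact Ideal.Quotient.eq.1 (h1.trans h2)

/-- The translations by nilpotent vectors are automorphisms of étale type. -/
theorem exists_translation (a : Fin n → R) (ha : ∀ i, IsNilpotent (a i)) :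
    ∃ τ ∈ Get n R, ∀ i, G.hom τ (MvPowerSeries.X i) = MvPowerSeries.X i + MvPowerSeries.C (a i) := by
  have hs : ∀ a : Fin n → R, (∀ i, IsNilpotent (a i)) → MvPowerSeries.HasSubst
      fun i => (MvPowerSeries.X i + MvPowerSeries.C (a i) : MvPowerSeries (Fin n) R) :=
    fun a ha => MvPowerSeries.hasSubst_of_constantCoeff_nilpotent fun i => by simpa using ha i
  have hX : ∀ a ha i, MvPowerSeries.substAlgHom (R := R) (hs a ha) (MvPowerSeries.X i) =
      MvPowerSeries.X i + MvPowerSeries.C (a i) := fun a ha i => MvPowerSeries.substAlgHom_X _ i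
  have hc : ∀ a ha, IsAdicContinuous (MvPowerSeries.substAlgHom (R := R) (hs a ha) :
      MvPowerSeries (Fin n) R →+* MvPowerSeries (Fin n) R) := fun a ha =>
    isAdicContinuous_of_mem_radical fun i => mem_radical_of_isNilpotent (by
      rw [RingHom.coe_coe, hX a ha]; simpa using ha i)
  have hinv : ∀ a ha b hb, (∀ i, a i + b i = 0) →
      (MvPowerSeries.substAlgHom (R := R) (hs a ha)).comp
        (MvPowerSeries.substAlgHom (R := R) (hs b hb)) = AlgHom.id R _ := by
    intro a ha b hb hab
    have := ringHom_ext ((hc a ha).comp (hc b hb)) IsAdicContinuous.id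
      (fun r => by simp) (fun i => by
        rw [RingHom.comp_apply, RingHom.coe_coe, RingHom.coe_coe, hX b hb, map_add, hX a ha, algHom_C,
          add_assoc, ← map_add, hab]
        simp)
    exact AlgHom.ext fun x => congrArg (fun f : _ →+* _ => f x) this
  have hna : ∀ i, IsNilpotent (-a i) := fun i => (ha i).neg
  let τ : G n R := ⟨AlgEquiv.ofAlgHom _ _ (hinv a ha (fun i => -a i) hna fun i => add_neg_cancel _)
    (hinv (fun i => -a i) hna a ha fun i => neg_add_cancel _), hc a ha, hc _ hna⟩
  have hτ : ∀ i, G.hom τ (MvPowerSeries.X i) = MvPowerSeries.X i + MvPowerSeries.C (a i) :=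
    fun i => hX a ha i
  have hpoly : ∀ a b : Fin n → R, (∀ i, a i + b i = 0) →
      (MvPolynomial.aeval fun i => MvPolynomial.X i + MvPolynomial.C (a i)).comp
        (MvPolynomial.aeval fun i => MvPolynomial.X i + MvPolynomial.C (b i)) =
      AlgHom.id R (MvPolynomial (Fin n) R) := by
    intro a b hab
    ext1 i
    simp only [AlgHom.comp_apply, MvPolynomial.aeval_X, map_add, MvPolynomial.algHom_C, AlgHom.id_apply]
    rw [add_assoc, MvPolynomial.algebraMap_eq, ← map_add, hab, map_zero, add_zero]
  let e := AlgEquiv.ofAlgHom _ _ (hpoly a (fun i => -a i) fun i => add_neg_cancel _)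
    (hpoly (fun i => -a i) a fun i => neg_add_cancel _)
  obtain ⟨V, hV, -⟩ := exists_induces (ρ := τ)
    (φ := (e : MvPolynomial (Fin n) R →+* MvPolynomial (Fin n) R))
    (ψ := RingHom.id _) (θ := MvPolynomial.coeToMvPowerSeries.ringHom)
    (RingHom.Etale.of_bijective e.bijective) (RingHom.Etale.of_bijective Function.bijective_id)
    (by ext1 r; exact e.commutes r) (RingHom.comp_id _) (by
      apply MvPolynomial.ringHom_ext
      · intro r
        have : e (MvPolynomial.C r) = MvPolynomial.C r := e.commutes r
        simp [this]
      · intro i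
        have : e (MvPolynomial.X i) = MvPolynomial.X i + MvPolynomial.C (a i) :=
          MvPolynomial.aeval_X _ i
        simp [this, hτ])
  exact ⟨τ, ⟨V, hV⟩, hτ⟩

end EtaleAutomorphisms

/-! ### Approximation by automorphisms of étale type, and dilations -/

section Approximation

variable {n : ℕ} {R : Type u} [CommRing R]

/-- Truncation: `K^ét(R)` is dense in `K(R)`. -/
theorem exists_mem_Ket_inv_mul_mem {κ : G n R} (hκ : κ ∈ K n R) (N : ℕ) :
    ∃ κ' ∈ Ket n R, κ'⁻¹ * κ ∈ congruence n R N := by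
  -- At level at least two, truncation does not change the linear part.
  let M := max N 2
  have hM : 2 ≤ M := le_max_right _ _
  let p : Fin n → MvPolynomial (Fin n) R := fun i =>
    MvPowerSeries.truncTotal M (G.hom κ (MvPowerSeries.X i))
  have hp : ∀ i, ∀ d : Fin n →₀ ℕ, d.degree < M →
      MvPowerSeries.coeff d (p i : MvPowerSeries (Fin n) R) =
        MvPowerSeries.coeff d (G.hom κ (MvPowerSeries.X i)) := fun i d hd => by
    rw [MvPolynomial.coeff_coe, MvPowerSeries.coeff_truncTotal _ hd]
  obtain ⟨κ', h1, h2⟩ := exists_mem_K (f := fun i => (p i : MvPowerSeries (Fin n) R))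
    (fun i => by
      rw [← MvPowerSeries.coeff_zero_eq_constantCoeff_apply, hp i 0 (by simp; omega)]
      exact hκ i)
    (by
      convert isUnit_det_linearPart hκ using 2
      ext i j
      exact hp i _ (by simp; omega))
  refine ⟨κ', mem_Ket_of_isEtaleFamily h1 ?_, ?_⟩
  · simp only [h2]
    exact isEtaleFamily_polynomial p
  · refine congruence_anti (le_max_left N 2) (inv_mul_mem_congruence h1 hκ fun i => ?_)
    rw [h2]
    apply mem_pow_of_coeff
    intro d hd
    rw [map_sub, hp i d hd, sub_self]

/-- `G^ét(R)` is dense in `G(R)`. -/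
theorem exists_mem_Get_inv_mul_mem (g : G n R) (N : ℕ) :
    ∃ g' ∈ Get n R, g'⁻¹ * g ∈ congruence n R N := by
  -- Constant terms are nilpotent, so a translation of étale type moves `g` into `K`.
  obtain ⟨τ, hτ, hτX⟩ := exists_translation
    (fun i => -MvPowerSeries.constantCoeff (G.hom g (MvPowerSeries.X i)))
    fun i => ((G.continuous g).isNilpotent i).neg
  have hκ : g * τ ∈ K n R := fun i => by
    rw [G.hom_mul, RingHom.comp_apply, hτX]
    simp
  obtain ⟨M, hM⟩ := exists_conj_mem_congruence τ⁻¹ N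
  obtain ⟨κ', h1, h2⟩ := exists_mem_Ket_inv_mul_mem hκ M
  refine ⟨κ' * τ⁻¹, mul_mem (Ket_le_Get h1) (inv_mem hτ), ?_⟩
  convert hM _ h2 using 1
  group

end Approximation

section Dilation

variable {n : ℕ} {R : Type u} [CommRing R]

/-- Dilations lie in `K^ét`. -/
theorem exists_scaling {a : R} (ha : IsUnit a) :
    ∃ d ∈ Ket n R, ∀ i, G.hom d (MvPowerSeries.X i) = MvPowerSeries.C a * MvPowerSeries.X i := by
  classical
  obtain ⟨d, h1, h2⟩ := exists_mem_K
    (f := fun i : Fin n => MvPowerSeries.C a * MvPowerSeries.X i) (fun i => by simp) (by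
      have : (linearPart fun i : Fin n => (MvPowerSeries.C a * MvPowerSeries.X i :
          MvPowerSeries (Fin n) R)) = Matrix.diagonal fun _ => a := by
        ext i j
        rw [linearPart, Matrix.of_apply, coeff_single_mul, coeff_single_C, coeff_single_X,
          Matrix.diagonal_apply]
        simp
      rw [this, Matrix.det_diagonal, Finset.prod_const]
      exact ha.pow _)
  refine ⟨d, mem_Ket_of_isEtaleFamily h1 ?_, h2⟩
  simp only [h2]
  convert isEtaleFamily_polynomial fun i => MvPolynomial.C a * MvPolynomial.X i using 2 with i
  simp

theorem coeff_rescale_const (a : R) (f : MvPowerSeries (Fin n) R) (d : Fin n →₀ ℕ) :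
    MvPowerSeries.coeff d (MvPowerSeries.rescale (fun _ => a) f) =
      a ^ d.degree * MvPowerSeries.coeff d f := by
  rw [MvPowerSeries.coeff_rescale, Finsupp.prod, Finset.prod_pow_eq_pow_sum]
  rfl

theorem rescale_C (a r : R) : MvPowerSeries.rescale (fun _ => a)
    (MvPowerSeries.C r : MvPowerSeries (Fin n) R) = MvPowerSeries.C r := by
  simp [MvPowerSeries.rescale_eq_subst]

theorem rescale_X (a : R) (i : Fin n) : MvPowerSeries.rescale (fun _ => a)
    (MvPowerSeries.X i : MvPowerSeries (Fin n) R) = MvPowerSeries.C a * MvPowerSeries.X i := by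
  rw [MvPowerSeries.rescale_eq_subst, MvPowerSeries.subst_X (MvPowerSeries.HasSubst.smul_X _),
    ← MvPowerSeries.smul_eq_C_mul]
  rfl

theorem hom_eq_rescale {a : R} {d : G n R}
    (h : ∀ i, G.hom d (MvPowerSeries.X i) = MvPowerSeries.C a * MvPowerSeries.X i) :
    G.hom d = MvPowerSeries.rescale fun _ => a :=
  ringHom_ext (G.continuous d)
    (isAdicContinuous_of_mem_radical fun i => mem_radical_of_isNilpotent (by simp [rescale_X]))
    (fun r => by rw [G.hom_C, rescale_C]) (fun i => by rw [h, rescale_X])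

theorem IsEtaleFamily.sum_mul_X {ι : Type*} {g : ι × Fin n → MvPowerSeries (Fin n) R}
    (hg : IsEtaleFamily g) : IsEtaleFamily fun i => ∑ j, g (i, j) * MvPowerSeries.X j := by
  obtain ⟨B, _, _, _, θ, hθ⟩ := hg
  refine ⟨B, inferInstance, inferInstance, inferInstance, θ, fun i =>
    sum_mem fun j _ => mul_mem (hθ _) ?_⟩
  refine ⟨algebraMap (MvPolynomial (Fin n) R) B (MvPolynomial.X j), ?_⟩
  change θ _ = _
  rw [θ.commutes, MvPowerSeries.algebraMap_apply']
  simp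

/-- The degeneration of an automorphism of étale type to its linear part: with `s` the coordinate on
the affine line, `ρₛ(t) = s⁻¹ ρ(s t)` is of étale type over `R[s]`. Where `s` is invertible it is the
conjugate of `ρ` by the dilation `t ↦ s t`; if `ρ` is trivial to order `N + 1`, then `ρₛ` is trivial
modulo `s ^ N`. -/
theorem exists_dilation [IsLocalRing R] {ρ : G n R} (h : ρ ∈ Ket n R) :
    ∃ ρs ∈ Ket n (Polynomial R),
      (∀ N, ρ ∈ congruence n R (N + 1) → ∀ (A : Type u) [CommRing A] (π : Polynomial R →+* A),
        π (Polynomial.X ^ N) = 0 → G.map π ρs = 1) ∧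
      ∀ (A : Type u) [CommRing A] (χ : Polynomial R →+* A) (d : G n A),
        (∀ i, G.hom d (MvPowerSeries.X i) =
          MvPowerSeries.C (χ Polynomial.X) * MvPowerSeries.X i) →
        G.map χ ρs * d = d * G.map (χ.comp Polynomial.C) ρ := by
  have hK := h.1
  obtain ⟨g, hg, hgf⟩ := (isEtaleFamily_of_mem_Ket h).exists_eq_sum hK
  let S : MvPowerSeries (Fin n) R →+* MvPowerSeries (Fin n) (Polynomial R) :=
    (MvPowerSeries.rescale fun _ => Polynomial.X).comp (MvPowerSeries.map Polynomial.C)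
  have hS : ∀ f d, MvPowerSeries.coeff d (S f) =
      Polynomial.X ^ d.degree * Polynomial.C (MvPowerSeries.coeff d f) := fun f d => by
    rw [RingHom.comp_apply, coeff_rescale_const, MvPowerSeries.coeff_map]
  have hSX : ∀ j, S (MvPowerSeries.X j) = MvPowerSeries.C Polynomial.X * MvPowerSeries.X j :=
    fun j => by rw [RingHom.comp_apply, MvPowerSeries.map_X, rescale_X]
  let f : Fin n → MvPowerSeries (Fin n) (Polynomial R) := fun i => ∑ j, S (g (i, j)) * .X j
  have hf : IsEtaleFamily f :=
    IsEtaleFamily.sum_mul_X (g := fun p => S (g p)) (hg.rescale Polynomial.C Polynomial.X)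
  have hXf : ∀ i, MvPowerSeries.C Polynomial.X * f i = S (G.hom ρ (MvPowerSeries.X i)) := by
    intro i
    rw [hgf, map_sum, Finset.mul_sum]
    refine Finset.sum_congr rfl fun j _ => ?_
    rw [map_mul, hSX]
    ring
  have hcoeff : ∀ i d, Polynomial.X * MvPowerSeries.coeff d (f i) =
      Polynomial.X ^ d.degree *
        Polynomial.C (MvPowerSeries.coeff d (G.hom ρ (MvPowerSeries.X i))) := fun i d => by
    rw [← hS, ← hXf, MvPowerSeries.coeff_C_mul]
  have h0 : ∀ i, MvPowerSeries.constantCoeff (f i) = 0 := fun i => by simp [f]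
  obtain ⟨ρs, h1, h2⟩ := exists_mem_K h0 (by
    have : linearPart f =
        (linearPart fun i => G.hom ρ (MvPowerSeries.X i)).map Polynomial.C := by
      ext1 i j
      refine Polynomial.isRegular_X.left ?_
      change Polynomial.X * MvPowerSeries.coeff _ (f i) = _
      rw [hcoeff]
      simp [linearPart]
    rw [this, ← RingHom.mapMatrix_apply, ← RingHom.map_det]
    exact (isUnit_det_linearPart hK).map _)
  refine ⟨ρs, mem_Ket_of_isEtaleFamily h1 (by simpa only [h2] using hf), ?_, ?_⟩
  · intro N hN A _ π hπ
    refine G.ext_X fun i => ?_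
    rw [G.map_hom_X, h2, G.hom_one, RingHom.id_apply, ← sub_eq_zero,
      ← MvPowerSeries.map_X (R := Polynomial R) π i, ← map_sub]
    ext d
    rw [MvPowerSeries.coeff_map, map_zero]
    have h3 : Polynomial.X * MvPowerSeries.coeff d (f i - MvPowerSeries.X i) =
        Polynomial.X ^ d.degree * Polynomial.C (MvPowerSeries.coeff d
          (G.hom ρ (MvPowerSeries.X i) - MvPowerSeries.X i)) := by
      rw [← hS, map_sub S, ← hXf, hSX, ← mul_sub, MvPowerSeries.coeff_C_mul]
    by_cases hd : d.degree < N + 1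
    · rw [coeff_eq_zero_of_mem_pow _ _ (hN (MvPowerSeries.X i)).1 d hd, map_zero, mul_zero] at h3
      have h4 : MvPowerSeries.coeff d (f i - MvPowerSeries.X i) = 0 :=
        Polynomial.isRegular_X.left (by simpa using h3)
      rw [h4, map_zero]
    · obtain ⟨m, hm⟩ := Nat.exists_eq_add_of_le (not_lt.1 hd)
      have h4 : MvPowerSeries.coeff d (f i - MvPowerSeries.X i) = Polynomial.X ^ N *
          (Polynomial.X ^ m * Polynomial.C (MvPowerSeries.coeff d
            (G.hom ρ (MvPowerSeries.X i) - MvPowerSeries.X i))) := by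
        refine Polynomial.isRegular_X.left (h3.trans ?_)
        rw [hm]
        ring
      rw [h4, map_mul, hπ, zero_mul]
  · intro A _ χ d hd
    refine G.ext_X fun i => ?_
    rw [G.hom_mul, G.hom_mul, RingHom.comp_apply, RingHom.comp_apply, hd, map_mul, G.hom_C,
      G.map_hom_X, G.map_hom_X, h2, ← MvPowerSeries.map_C (σ := Fin n) χ, ← map_mul, hXf,
      hom_eq_rescale hd]
    ext e
    rw [MvPowerSeries.coeff_map, hS, coeff_rescale_const, MvPowerSeries.coeff_map]
    rw [map_mul, map_pow, RingHom.comp_apply]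

end Dilation

/-! ### Matrix coefficients and weights -/

section MatrixCoefficients

variable {k : Type u} [Field k] {V : Type w} [AddCommGroup V] [Module k V]

/-- The extension of a linear functional on `V` to an `R`-linear functional on `R ⊗ V`. -/
def extendFunctional (R : Type u) [CommRing R] [Algebra k R] (c : V →ₗ[k] k) : R ⊗[k] V →ₗ[R] R :=
  (TensorProduct.AlgebraTensorModule.rid k R R).toLinearMap ∘ₗ c.baseChange R

theorem extendFunctional_tmul (R : Type u) [CommRing R] [Algebra k R] (c : V →ₗ[k] k) (r : R)
    (v : V) : extendFunctional R c (r ⊗ₜ v) = c v • r := by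
  simp [extendFunctional]

theorem extendFunctional_rTensor {R R' : Type u} [CommRing R] [Algebra k R] [CommRing R']
    [Algebra k R'] (f : R →ₐ[k] R') (c : V →ₗ[k] k) (m : R ⊗[k] V) :
    extendFunctional R' c (LinearMap.rTensor V f.toLinearMap m) = f (extendFunctional R c m) := by
  induction m using TensorProduct.induction_on with
  | zero => simp
  | tmul r v => simp [extendFunctional_tmul]
  | add x y hx hy => simp [hx, hy]

/-- The action on a finite-dimensional subrepresentation in matrix form. The matrices are transposed,
so that they reverse products. -/
theorem PrestackRep.IsSubrep.exists_matrix {H : GroupPrestack k} {ρ : PrestackRep H V}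
    {W : Submodule k V} [FiniteDimensional k W] (hW : ρ.IsSubrep W) :
    ∃ (d : ℕ) (Φ : ∀ R : CommAlgCat.{u} k, H.obj R → Matrix (Fin d) (Fin d) R),
      (∀ R, Φ R 1 = 1) ∧ (∀ R x y, Φ R (x * y) = Φ R y * Φ R x) ∧
      (∀ (R R' : CommAlgCat.{u} k) (f : R ⟶ R') (x : H.obj R),
        Φ R' (H.map f x) = (Φ R x).map f.hom) ∧
      ∀ (R : CommAlgCat.{u} k) (x : H.obj R), Φ R x = 1 →
        ∀ w ∈ W, ρ.act R x (1 ⊗ₜ w) = 1 ⊗ₜ w := by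
  classical
  let b := Module.finBasis k W
  -- The coordinates on `W` are extended to functionals on `V`, since `R ⊗ W` lives inside `R ⊗ V`.
  choose c hc using fun i => LinearMap.exists_extend (b.coord i)
  have hc' : ∀ i (w : W), c i w = b.repr w i := fun i w =>
    congrArg (fun f : W →ₗ[k] k => f w) (hc i)
  have hexp : ∀ (R : CommAlgCat.{u} k), ∀ m ∈ W.baseChange R,
      m = ∑ i, extendFunctional R (c i) m • ((1 : R) ⊗ₜ[k] (b i : V)) := by
    rintro R _ ⟨m, rfl⟩
    induction m using TensorProduct.induction_on with
    | zero => simp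
    | tmul r w =>
      simp only [LinearMap.baseChange_tmul, extendFunctional_tmul, Submodule.subtype_apply, hc']
      conv_lhs => rw [← b.sum_repr w]
      rw [Submodule.coe_sum, TensorProduct.tmul_sum]
      refine Finset.sum_congr rfl fun i _ => ?_
      simp [TensorProduct.smul_tmul', TensorProduct.tmul_smul]
    | add x y hx hy =>
      simp only [map_add, add_smul, Finset.sum_add_distrib]
      rw [← hx, ← hy]
  let Φ : ∀ R : CommAlgCat.{u} k, H.obj R → Matrix (Fin (Module.finrank k W))
      (Fin (Module.finrank k W)) R := fun R x => Matrix.of fun i j =>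
    extendFunctional R (c j) (ρ.act R x (1 ⊗ₜ (b i : V)))
  have hΦ_def : ∀ R x i j, Φ R x i j =
    extendFunctional R (c j) (ρ.act R x (1 ⊗ₜ (b i : V))) := fun _ _ _ _ => rfl
  have hΦ : ∀ R x i, ρ.act R x (1 ⊗ₜ (b i : V)) = ∑ j, Φ R x i j • ((1 : R) ⊗ₜ[k] (b j : V)) :=
    fun R x i => hexp R _ (hW R x _ (Submodule.tmul_mem_baseChange_of_mem 1 (b i).2))
  have hδ : ∀ (R : CommAlgCat.{u} k) i j, extendFunctional R (c j) ((1 : R) ⊗ₜ[k] (b i : V)) =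
      (1 : Matrix _ _ R) i j := by
    intro R i j
    rw [extendFunctional_tmul, hc', b.repr_self, Finsupp.single_apply, Matrix.one_apply]
    split_ifs <;> simp
  refine ⟨_, Φ, fun R => ?_, fun R x y => ?_, fun R R' f x => ?_, fun R x hx w hw => ?_⟩
  · ext i j
    rw [hΦ_def, map_one]
    exact hδ R i j
  · ext i l
    rw [hΦ_def, map_mul, LinearEquiv.mul_apply, hΦ R y, Matrix.mul_apply]
    simp only [map_sum, map_smul, smul_eq_mul]
    rfl
  · ext i j
    have h := ρ.naturality f x (1 ⊗ₜ (b i : V))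
    rw [LinearMap.rTensor_tmul, AlgHom.toLinearMap_apply, map_one] at h
    rw [hΦ_def, ← h, extendFunctional_rTensor]
    rfl
  · have h1 : ∀ i, ρ.act R x (1 ⊗ₜ (b i : V)) = (1 : R) ⊗ₜ[k] (b i : V) := fun i => by
      rw [hΦ, hx]
      simp [Matrix.one_apply]
    have h2 : ((1 : R) ⊗ₜ[k] w) = ∑ i, b.repr ⟨w, hw⟩ i • ((1 : R) ⊗ₜ[k] (b i : V)) := by
      conv_lhs => rw [show w = ((⟨w, hw⟩ : W) : V) from rfl, ← b.sum_repr ⟨w, hw⟩]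
      rw [Submodule.coe_sum, TensorProduct.tmul_sum]
      simp [TensorProduct.tmul_smul]
    rw [h2, map_sum]
    refine Finset.sum_congr rfl fun i _ => ?_
    rw [← algebraMap_smul R (b.repr ⟨w, hw⟩ i), map_smul, h1]

end MatrixCoefficients

section Weights

open LaurentPolynomial

/-- A finite family of Laurent polynomials has poles of bounded order. -/
theorem exists_toLaurent_eq_mul_T {R ι : Type*} [CommRing R] [Finite ι] (f : ι → R[T;T⁻¹]) :
    ∃ (M : ℕ) (p : ι → Polynomial R), ∀ i, Polynomial.toLaurent (p i) = f i * T (M : ℤ) := by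
  cases nonempty_fintype ι
  choose m q hq using fun i => LaurentPolynomial.exists_T_pow (f i)
  have hm : ∀ i, m i ≤ ∑ j, m j := fun i =>
    Finset.single_le_sum (f := m) (fun _ _ => Nat.zero_le _) (Finset.mem_univ i)
  refine ⟨∑ j, m j, fun i => q i * Polynomial.X ^ (∑ j, m j - m i), fun i => ?_⟩
  rw [map_mul, hq, Polynomial.toLaurent_X_pow, mul_assoc, ← T_add]
  congr 2
  have := hm i
  push_cast [Nat.cast_sub this]
  ring

variable {k : Type u} [Field k] {n : ℕ}

/-- The inclusion `k[T, T⁻¹] → R[T, T⁻¹]`. -/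
def laurentMap (k R : Type u) [Field k] [CommRing R] [Algebra k R] : k[T;T⁻¹] →ₐ[k] R[T;T⁻¹] :=
  { LaurentPolynomial.eval₂ (algebraMap k R[T;T⁻¹])
      ⟨T 1, T (-1), by rw [← T_add]; simp, by rw [← T_add]; simp⟩ with
    commutes' := fun r => by
      rw [← LaurentPolynomial.C_eq_algebraMap]
      exact LaurentPolynomial.eval₂_C _ _ _ }

theorem laurentMap_T (R : Type u) [CommRing R] [Algebra k R] (m : ℕ) :
    laurentMap k R (T (m : ℤ)) = T (m : ℤ) := by
  refine (LaurentPolynomial.eval₂_T_n _ _ m).trans ?_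
  rw [LaurentPolynomial.T_pow]
  simp

theorem laurentMap_toLaurent (R : Type u) [CommRing R] [Algebra k R] (p : Polynomial k) :
    laurentMap k R (Polynomial.toLaurent p) =
      Polynomial.toLaurent (p.map (algebraMap k R)) := by
  have : ((laurentMap k R).comp (Polynomial.toLaurentAlg (R := k))) =
      ((Polynomial.toLaurentAlg (R := R)).restrictScalars k).comp
        (Polynomial.mapAlgHom (Algebra.ofId k R)) := by
    ext
    have := laurentMap_T (k := k) R 1
    simp only [Nat.cast_one] at this
    simp [this]
  exact congrArg (fun f : _ →ₐ[k] _ => f p) this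

/-- Let `A` be a matrix over `R` which becomes the conjugate by `D` over `R[T, T⁻¹]` of a polynomial
matrix `B ≡ 1` modulo `T ^ N`. If `D` and `D⁻¹` have poles of order at most `M` and `2M < N`, then
`A - 1` is both constant and divisible by a positive power of `T`, so that `A = 1`. -/
theorem eq_one_of_conj_eq {R : Type u} [CommRing R] [Algebra k R] {d : ℕ} {M N : ℕ}
    (hMN : M + M < N) {D D' : Matrix (Fin d) (Fin d) k[T;T⁻¹]} (hDD' : D * D' = 1)
    {P P' : Fin d × Fin d → Polynomial k}
    (hP : ∀ p, Polynomial.toLaurent (P p) = D p.1 p.2 * T (M : ℤ))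
    (hP' : ∀ p, Polynomial.toLaurent (P' p) = D' p.1 p.2 * T (M : ℤ))
    {A : Matrix (Fin d) (Fin d) R} {B : Matrix (Fin d) (Fin d) (Polynomial R)}
    (hB : ∀ i j, Polynomial.X ^ N ∣ (B - 1) i j)
    (h : D.map (laurentMap k R) * B.map Polynomial.toLaurent =
      A.map LaurentPolynomial.C * D.map (laurentMap k R)) : A = 1 := by
  choose Y hY using hB
  let Q : Matrix (Fin d) (Fin d) (Polynomial R) :=
    Matrix.of fun i j => (P (i, j)).map (algebraMap k R)
  let Q' : Matrix (Fin d) (Fin d) (Polynomial R) :=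
    Matrix.of fun i j => (P' (i, j)).map (algebraMap k R)
  let E := D.map (laurentMap k R)
  let E' := D'.map (laurentMap k R)
  have hQ : Q.map Polynomial.toLaurent = (T (M : ℤ) : R[T;T⁻¹]) • E := by
    ext1 i j
    simp only [Q, E, Matrix.map_apply, Matrix.of_apply, Matrix.smul_apply, smul_eq_mul]
    rw [← laurentMap_toLaurent, hP, map_mul, laurentMap_T, mul_comm]
  have hQ' : Q'.map Polynomial.toLaurent = (T (M : ℤ) : R[T;T⁻¹]) • E' := by
    ext1 i j
    simp only [Q', E', Matrix.map_apply, Matrix.of_apply, Matrix.smul_apply, smul_eq_mul]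
    rw [← laurentMap_toLaurent, hP', map_mul, laurentMap_T, mul_comm]
  have hEE' : E * E' = 1 := by
    have := congrArg (laurentMap k R).mapMatrix hDD'
    rwa [map_mul, map_one] at this
  let τ := (Polynomial.toLaurent (R := R)).mapMatrix (m := Fin d)
  have hτ : ∀ X, τ X = X.map Polynomial.toLaurent := fun X => rfl
  have hB' : B = 1 + (Polynomial.X ^ N : Polynomial R) • Matrix.of Y := by
    ext1 i j
    have := hY i j
    rw [Matrix.sub_apply, sub_eq_iff_eq_add'] at this
    exact this
  -- Clearing the denominators of the dilation costs `2M` powers of `T`, and `N > 2M` are available.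
  have key : τ ((Polynomial.X ^ (M + M) : Polynomial R) • (A - 1).map Polynomial.C) =
      τ ((Polynomial.X ^ N : Polynomial R) • (Q * Matrix.of Y * Q')) := by
    have e1 : A.map LaurentPolynomial.C = E * τ B * E' := by
      rw [hτ, h, mul_assoc, hEE', mul_one]
    have e2 : τ ((A - 1).map Polynomial.C) = A.map LaurentPolynomial.C - 1 := by
      ext1 i j
      simp [hτ, Matrix.one_apply]
    have e3 : ∀ (m : ℕ) X, τ ((Polynomial.X ^ m : Polynomial R) • X) =
        (T (m : ℤ) : R[T;T⁻¹]) • τ X := by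
      intro m X
      ext1 i j
      simp [hτ]
    rw [e3, e3, e2, e1, hB', map_add, map_one, e3, map_mul, map_mul, hτ Q, hτ Q', hQ, hQ',
      mul_add, mul_one, add_mul, hEE', add_sub_cancel_left]
    simp only [Matrix.smul_mul, Matrix.mul_smul, smul_smul]
    congr 1
    rw [← T_add, ← T_add, ← T_add]
    congr 1
    push_cast
    ring
  ext i j
  have h1 := congrArg (fun X => X i j) key
  simp only [hτ, Matrix.map_apply, Matrix.smul_apply, smul_eq_mul] at h1
  have h2 := congrArg (fun p => Polynomial.coeff p (M + M)) (Polynomial.toLaurent_injective h1)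
  simp only [Polynomial.coeff_X_pow_mul', le_refl, if_true, Nat.sub_self, Polynomial.coeff_C_zero,
    if_neg (not_le.2 hMN)] at h2
  rw [Matrix.sub_apply, sub_eq_zero] at h2
  exact h2

end Weights

/-! ### Smoothness of locally finite representations of the étale groups -/

section Smoothness

open LaurentPolynomial

variable {k : Type u} [Field k] {n : ℕ} {V : Type w} [AddCommGroup V] [Module k V]

/-- A finite-dimensional representation of `K^ét` is trivial on a congruence subgroup. Conjugation by
the dilations contracts a congruence subgroup to the identity, while the poles of the matrices of the
dilations are bounded. -/
theorem exists_level_of_isSubrep {ρ : PrestackRep (KetPrestack k n) V} {W : Submodule k V}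
    [FiniteDimensional k W] (hW : ρ.IsSubrep W) :
    ∃ N, ∀ (R : CommAlgCat.{u} k) (x : Ket n R), x.1 ∈ congruence n R N →
      ∀ w ∈ W, ρ.act R x (1 ⊗ₜ w) = 1 ⊗ₜ w := by
  obtain ⟨d, Φ, h1, hmul, hmap, hfix⟩ := hW.exists_matrix
  let H := KetPrestack k n
  let A₀ : CommAlgCat.{u} k := CommAlgCat.of k k[T;T⁻¹]
  obtain ⟨δ, hδ, hδX⟩ := exists_scaling (n := n) (a := (T 1 : k[T;T⁻¹]))
    (LaurentPolynomial.isUnit_T 1)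
  let δ₀ : H.obj A₀ := (⟨δ, hδ⟩ : Ket n k[T;T⁻¹])
  let D : Matrix (Fin d) (Fin d) k[T;T⁻¹] := Φ A₀ δ₀
  let D' : Matrix (Fin d) (Fin d) k[T;T⁻¹] := Φ A₀ δ₀⁻¹
  have hDD' : D * D' = 1 := by
    rw [← hmul, inv_mul_cancel, h1]
  obtain ⟨M₁, P₁, hP₁⟩ := exists_toLaurent_eq_mul_T
    fun p : (Fin d × Fin d) ⊕ (Fin d × Fin d) => p.elim (fun q => D q.1 q.2) fun q => D' q.1 q.2
  -- The matrix of the dilated automorphism has to be trivial modulo `T ^ (2 M₁ + 1)`; the dilation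
  -- divides by `T` and thereby loses one order.
  refine ⟨M₁ + M₁ + 1 + 1, fun R x hx => hfix R x ?_⟩
  have hlocal : ∀ (R : CommAlgCat.{u} k) (x : Ket n R), IsLocalRing R →
      x.1 ∈ congruence n R (M₁ + M₁ + 1 + 1) → Φ R x = 1 := by
    intro R x _ hx
    obtain ⟨ρs, hρs, hs1, hs2⟩ := exists_dilation x.2
    let RX : CommAlgCat.{u} k := CommAlgCat.of k (Polynomial R)
    let RT : CommAlgCat.{u} k := CommAlgCat.of k R[T;T⁻¹]
    let xs : H.obj RX := (⟨ρs, hρs⟩ : Ket n (Polynomial R))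
    let χ : RX ⟶ RT := CommAlgCat.ofHom ((Polynomial.toLaurentAlg (R := R)).restrictScalars k)
    let ι : R ⟶ RX := CommAlgCat.ofHom (Polynomial.CAlgHom (R := k) (A := R))
    let f : A₀ ⟶ RT := CommAlgCat.ofHom (laurentMap k R)
    have hfX : ∀ i, G.hom (G.map (laurentMap k R).toRingHom δ) (MvPowerSeries.X i) =
        MvPowerSeries.C (Polynomial.toLaurent (R := R) Polynomial.X) * MvPowerSeries.X i := by
      intro i
      have := laurentMap_T (k := k) R 1
      simp only [Nat.cast_one] at this
      rw [G.map_hom_X, hδX, map_mul, MvPowerSeries.map_C, MvPowerSeries.map_X,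
        Polynomial.toLaurent_X]
      exact congrArg (fun r => MvPowerSeries.C r * MvPowerSeries.X i) this
    have hconj : H.map χ xs * H.map f δ₀ = H.map f δ₀ * H.map χ (H.map ι x) := by
      refine Subtype.ext ?_
      have := hs2 R[T;T⁻¹] (Polynomial.toLaurent (R := R)) _ hfX
      rw [G.map_comp] at this
      exact this
    have hΦ := congrArg (Φ RT) hconj
    rw [hmul, hmul, hmap, hmap, hmap] at hΦ
    erw [hmap R RX ι x] at hΦ
    refine eq_one_of_conj_eq (k := k) (R := R) (N := M₁ + M₁ + 1) (M := M₁) (by omega) hDD'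
      (P := fun q => P₁ (Sum.inl q)) (P' := fun q => P₁ (Sum.inr q))
      (fun q => hP₁ (Sum.inl q)) (fun q => hP₁ (Sum.inr q)) (B := Φ RX xs) ?_ ?_
    · intro i j
      rw [← Ideal.mem_span_singleton, ← Ideal.Quotient.eq_zero_iff_mem]
      -- By naturality `xs`, being trivial over `R[X] / X ^ N`, has trivial matrix there.
      let π := Ideal.Quotient.mkₐ k
        (Ideal.span {(Polynomial.X ^ (M₁ + M₁ + 1) : Polynomial R)})
      have h2 : H.map (CommAlgCat.ofHom π : RX ⟶ _) xs = 1 := by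
        refine Subtype.ext ?_
        exact hs1 _ hx _ π.toRingHom (Ideal.Quotient.eq_zero_iff_mem.2
          (Ideal.mem_span_singleton_self _))
      have h3 := hmap _ _ (CommAlgCat.ofHom π : RX ⟶ _) xs
      rw [h2, h1] at h3
      have h4 := congrArg (fun X => X i j) h3
      change π ((Φ RX xs - 1) i j) = 0
      rw [Matrix.sub_apply, map_sub, sub_eq_zero]
      refine h4.symm.trans ?_
      rw [Matrix.one_apply, Matrix.one_apply]
      split_ifs <;> simp
    · refine hΦ.trans ?_
      rw [Matrix.map_map]
      congr 1
      ext1 i j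
      exact Polynomial.toLaurent_C _
  -- Equality of matrix entries can be checked in the local rings.
  ext i j
  rw [← sub_eq_zero]
  refine eq_zero_of_localization _ fun J hJ => ?_
  let g : R ⟶ CommAlgCat.of k (Localization.AtPrime J) :=
    CommAlgCat.ofHom ((Algebra.ofId R (Localization.AtPrime J)).restrictScalars k)
  have h2 := hlocal (CommAlgCat.of k (Localization.AtPrime J)) (H.map g x)
    (inferInstanceAs (IsLocalRing (Localization.AtPrime J)))
    (congruence_map_mem _ (by omega) hx)
  have h3 := congrArg (fun X => X i j) ((hmap _ _ g x).symm.trans h2)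
  rw [map_sub, sub_eq_zero]
  refine Eq.trans h3 ?_
  rw [Matrix.one_apply, Matrix.one_apply]
  split_ifs <;> simp

/-- The congruence subgroup fixing `v` can be chosen independently of the base ring. -/
theorem IsKetLocallyFinite.exists_level {ρ : PrestackRep (GetPrestack k n) V}
    (h : IsKetLocallyFinite ρ) (v : V) :
    ∃ N, ∀ (R : CommAlgCat.{u} k) (x : Get n R), x.1 ∈ congruence n R N →
      ρ.act R x (1 ⊗ₜ v) = 1 ⊗ₜ v := by
  obtain ⟨W, _, hv, hW⟩ := h v
  obtain ⟨N, hN⟩ := exists_level_of_isSubrep hW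
  refine ⟨N + 1, fun R x hx => ?_⟩
  have hK : x.1 ∈ Ket n R := mem_Ket_of_mem_Get x.2 (congruence_le_K (Nat.succ_ne_zero N) hx)
  exact hN R ⟨x.1, hK⟩ (congruence_anti (Nat.le_succ N) hx) v hv

end Smoothness

/-! ### The universal element of `K` and representations of `G` -/

section Universal

variable (k : Type u) [Field k] (n : ℕ)

/-- The generic `n`-tuple of power series without constant term: the coefficients in positive degree
are independent variables. -/
def genericSeries (i : Fin n) :
    MvPowerSeries (Fin n) (MvPolynomial (Fin n × {d : Fin n →₀ ℕ // d ≠ 0}) k) :=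
  fun d => if h : d = 0 then 0 else MvPolynomial.X (i, ⟨d, h⟩)

theorem coeff_genericSeries (i : Fin n) {d : Fin n →₀ ℕ} (h : d ≠ 0) :
    MvPowerSeries.coeff d (genericSeries k n i) = MvPolynomial.X (i, ⟨d, h⟩) :=
  dif_neg h

theorem constantCoeff_genericSeries (i : Fin n) :
    MvPowerSeries.constantCoeff (genericSeries k n i) = 0 := by
  rw [← MvPowerSeries.coeff_zero_eq_constantCoeff_apply]
  change genericSeries k n i 0 = 0
  simp [genericSeries]

/-- `K` is representable by an affine scheme, with universal element `g` over `O`. Moreover every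
function on this scheme is constant on a congruence subgroup, since it depends on only finitely many
coefficients. -/
theorem exists_universal : ∃ (O : CommAlgCat.{u} k) (g : G n O) (ε : O →ₐ[k] k),
    g ∈ K n O ∧ G.map ε.toRingHom g = 1 ∧
    (∀ (R : Type u) [CommRing R] [Algebra k R] (κ : G n R), κ ∈ K n R →
      ∃ ev : O →ₐ[k] R, G.map ev.toRingHom g = κ) ∧
    ∀ a : O, ∃ N, ∀ (R : Type u) [CommRing R] [Algebra k R] (ev : O →ₐ[k] R),
      G.map ev.toRingHom g ∈ congruence n R N → ev a = algebraMap k R (ε a) := by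
  classical
  let P := MvPolynomial (Fin n × {d : Fin n →₀ ℕ // d ≠ 0}) k
  let D : P := (linearPart (genericSeries k n)).det
  let O := Localization.Away D
  let F : Fin n → MvPowerSeries (Fin n) O := fun i =>
    MvPowerSeries.map (algebraMap P O) (genericSeries k n i)
  have hlin : ∀ (R : Type u) [CommRing R] (f : P →+* R),
      linearPart (fun i => MvPowerSeries.map f (genericSeries k n i)) =
        f.mapMatrix (linearPart (genericSeries k n)) := fun R _ f => by
    ext i j
    simp [linearPart]
  obtain ⟨g, hg, hgX⟩ := exists_mem_K (f := F)
    (fun i => by rw [MvPowerSeries.constantCoeff_map, constantCoeff_genericSeries, map_zero]) (by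
      rw [hlin, ← RingHom.map_det]
      exact IsLocalization.Away.algebraMap_isUnit D)
  have huniv : ∀ (R : Type u) [CommRing R] [Algebra k R] (κ : G n R), κ ∈ K n R →
      ∃ ev : O →ₐ[k] R, G.map ev.toRingHom g = κ := by
    intro R _ _ κ hκ
    let e : P →ₐ[k] R := MvPolynomial.aeval fun p =>
      MvPowerSeries.coeff p.2.1 (G.hom κ (MvPowerSeries.X p.1))
    have he : ∀ i, MvPowerSeries.map e.toRingHom (genericSeries k n i) =
        G.hom κ (MvPowerSeries.X i) := by
      intro i
      ext d
      rw [MvPowerSeries.coeff_map]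
      by_cases hd : d = 0
      · subst hd
        rw [MvPowerSeries.coeff_zero_eq_constantCoeff_apply, constantCoeff_genericSeries, map_zero,
          MvPowerSeries.coeff_zero_eq_constantCoeff_apply, hκ i]
      · rw [coeff_genericSeries k n i hd]
        exact MvPolynomial.aeval_X _ _
    have hu : IsUnit (e D) := by
      have := isUnit_det_linearPart hκ
      rw [← funext he, hlin, ← RingHom.map_det] at this
      exact this
    refine ⟨IsLocalization.Away.liftAlgHom (x := D) (f := e) hu, G.ext_X fun i => ?_⟩
    rw [G.map_hom_X, hgX, ← he i]
    ext d
    simp only [F, MvPowerSeries.coeff_map]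
    exact IsLocalization.Away.lift_eq (x := D) (g := e.toRingHom) hu _
  obtain ⟨ε, hε⟩ := huniv k 1 (one_mem _)
  refine ⟨CommAlgCat.of k O, g, ε, hg, hε, huniv, ?_⟩
  have hP : ∀ p : P, ∃ N, ∀ (R : Type u) [CommRing R] [Algebra k R] (ev : O →ₐ[k] R),
      G.map ev.toRingHom g ∈ congruence n R N →
        ev (algebraMap P O p) = algebraMap k R (ε (algebraMap P O p)) := by
    intro p
    induction p using MvPolynomial.induction_on with
    | C r =>
      refine ⟨0, fun R _ _ ev _ => ?_⟩
      have : algebraMap P O (MvPolynomial.C r) = algebraMap k O r :=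
        (IsScalarTower.algebraMap_apply k P O r).symm
      rw [this, AlgHom.commutes, AlgHom.commutes]
      rfl
    | add p q hp hq =>
      obtain ⟨N, hN⟩ := hp
      obtain ⟨M, hM⟩ := hq
      refine ⟨max N M, fun R _ _ ev h => ?_⟩
      simp only [map_add, hN R ev (congruence_anti (le_max_left _ _) h),
        hM R ev (congruence_anti (le_max_right _ _) h)]
    | mul_X p i hp =>
      obtain ⟨N, hN⟩ := hp
      obtain ⟨i, d, hd⟩ := i
      have hX : ∀ (R : Type u) [CommRing R] [Algebra k R] (ev : O →ₐ[k] R),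
          ev (algebraMap P O (MvPolynomial.X (i, ⟨d, hd⟩))) =
            MvPowerSeries.coeff d (G.hom (G.map ev.toRingHom g) (MvPowerSeries.X i)) := by
        intro R _ _ ev
        rw [G.map_hom_X, hgX, MvPowerSeries.coeff_map, MvPowerSeries.coeff_map,
          coeff_genericSeries k n i hd]
        rfl
      refine ⟨max N (d.degree + 1), fun R _ _ ev h => ?_⟩
      have h1 := coeff_eq_zero_of_mem_pow _ _
        (congruence_anti (le_max_right N (d.degree + 1)) h (MvPowerSeries.X i)).1 d
        (Nat.lt_succ_self _)
      rw [map_sub, sub_eq_zero] at h1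
      simp only [map_mul, hN R ev (congruence_anti (le_max_left _ _) h)]
      rw [hX, hX, h1, hε, G.hom_one, RingHom.id_apply, MvPowerSeries.coeff_X,
        MvPowerSeries.coeff_X]
      split_ifs <;> simp
  intro a
  obtain ⟨p, s, rfl⟩ := IsLocalization.exists_mk'_eq (Submonoid.powers D) a
  obtain ⟨N, hN⟩ := hP p
  obtain ⟨M, hM⟩ := hP s
  refine ⟨max N M, fun R _ _ ev h => ?_⟩
  have hs : IsUnit (ev (algebraMap P O s)) := (IsLocalization.map_units O s).map ev
  refine hs.mul_right_cancel ?_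
  rw [← map_mul, IsLocalization.mk'_spec, hN R ev (congruence_anti (le_max_left _ _) h),
    hM R ev (congruence_anti (le_max_right _ _) h), ← map_mul, ← map_mul, IsLocalization.mk'_spec]

end Universal

section Representations

variable {k : Type u} [Field k] {n : ℕ} {V : Type w} [AddCommGroup V] [Module k V]

/-- Every vector is fixed by a congruence subgroup, uniformly over all base rings. -/
theorem PrestackRep.exists_level (ρ : PrestackRep (GPrestack k n) V) (v : V) :
    ∃ N, ∀ (R : CommAlgCat.{u} k) (x : G n R), x ∈ congruence n R N →
      ρ.act R x (1 ⊗ₜ v) = 1 ⊗ₜ v := by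
  obtain ⟨O, g, ε, -, hε, huniv, hlevel⟩ := exists_universal k n
  have key : ∀ m : O ⊗[k] V, ∃ N, ∀ (R : Type u) [CommRing R] [Algebra k R] (ev : O →ₐ[k] R),
      G.map ev.toRingHom g ∈ congruence n R N → LinearMap.rTensor V ev.toLinearMap m =
        LinearMap.rTensor V ((Algebra.ofId k R).comp ε).toLinearMap m := by
    intro m
    induction m using TensorProduct.induction_on with
    | zero => exact ⟨0, fun R _ _ ev _ => by simp⟩
    | tmul a v =>
      obtain ⟨N, hN⟩ := hlevel a
      refine ⟨N, fun R _ _ ev h => ?_⟩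
      rw [LinearMap.rTensor_tmul, LinearMap.rTensor_tmul, AlgHom.toLinearMap_apply, hN R ev h]
      rfl
    | add x y hx hy =>
      obtain ⟨N, hN⟩ := hx
      obtain ⟨M, hM⟩ := hy
      refine ⟨max N M, fun R _ _ ev h => ?_⟩
      rw [map_add, map_add, hN R ev (congruence_anti (le_max_left _ _) h),
        hM R ev (congruence_anti (le_max_right _ _) h)]
  obtain ⟨N, hN⟩ := key (ρ.act O g (1 ⊗ₜ v))
  refine ⟨N + 1, fun R x hx => ?_⟩
  obtain ⟨ev, rfl⟩ := huniv R x (congruence_le_K (Nat.succ_ne_zero N) hx)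
  have hnat : ∀ f : O →ₐ[k] R, LinearMap.rTensor V f.toLinearMap (ρ.act O g (1 ⊗ₜ v)) =
      ρ.act R (G.map f.toRingHom g) (1 ⊗ₜ v) := by
    intro f
    refine (ρ.naturality (CommAlgCat.ofHom f : O ⟶ R) g (1 ⊗ₜ v)).trans ?_
    rw [LinearMap.rTensor_tmul]
    simp only [AlgHom.toLinearMap_apply, map_one]
    rfl
  have h1 : G.map ((Algebra.ofId k R).comp ε).toRingHom g = 1 := by
    have : ((Algebra.ofId k R).comp ε).toRingHom = (algebraMap k R).comp ε.toRingHom := rfl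
    rw [this, G.map_comp, hε, map_one]
  have h2 := hN R ev (congruence_anti (Nat.le_succ N) hx)
  rw [hnat, hnat, h1] at h2
  refine h2.trans ?_
  have : ρ.act R (1 : G n R) = 1 := map_one (ρ.act R)
  rw [this]
  rfl

/-- The restriction of a representation of `G` is locally finite: since `K` is representable by an
affine scheme, this is the usual local finiteness of comodules. -/
theorem PrestackRep.isKetLocallyFinite_restrict (ρ : PrestackRep (GPrestack k n) V) :
    IsKetLocallyFinite (ρ.restrict (GetToG k n)) := by
  classical
  intro v
  obtain ⟨O, g, ε, hg, hε, huniv, -⟩ := exists_universal k n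
  have hnat : ∀ (R : Type u) [CommRing R] [Algebra k R] (f : O →ₐ[k] R),
      LinearMap.rTensor V f.toLinearMap (ρ.act O g (1 ⊗ₜ v)) =
        ρ.act (CommAlgCat.of k R) (G.map f.toRingHom g) (1 ⊗ₜ v) := by
    intro R _ _ f
    refine (ρ.naturality (CommAlgCat.ofHom f : O ⟶ CommAlgCat.of k R) g (1 ⊗ₜ v)).trans ?_
    rw [LinearMap.rTensor_tmul]
    simp only [AlgHom.toLinearMap_apply, map_one]
    rfl
  -- `W` is spanned by the coefficients of the orbit map of `v` in a basis of the functions on `K`.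
  let b := Module.Basis.ofVectorSpace k O
  obtain ⟨c, hc⟩ := TensorProduct.eq_repr_basis_left b (ρ.act O g (1 ⊗ₜ v))
  rw [Finsupp.sum] at hc
  let W : Submodule k V := Submodule.span k (c.support.image c : Finset V)
  have hcW : ∀ i ∈ c.support, c i ∈ W := fun i hi =>
    Submodule.subset_span (Finset.mem_coe.2 (Finset.mem_image_of_mem c hi))
  refine ⟨W, FiniteDimensional.span_finset k _, ?_, ?_⟩
  · have h := hnat k ε
    rw [hε] at h
    have h1 : ρ.act (CommAlgCat.of k k) (1 : G n k) = 1 := map_one (ρ.act (CommAlgCat.of k k))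
    rw [h1, ← hc, map_sum] at h
    have h2 := congrArg (TensorProduct.lid k V) h
    simp only [LinearMap.rTensor_tmul, map_sum, TensorProduct.lid_tmul] at h2
    have h3 : TensorProduct.lid k V ((1 : k) ⊗ₜ v) = v := by simp
    rw [← h3]
    refine Eq.subst (motive := fun z => z ∈ W) h2 ?_
    exact Submodule.sum_mem _ fun i hi => Submodule.smul_mem _ _ (hcW i hi)
  · intro R x m hm
    suffices hle : W.baseChange R ≤ (W.baseChange R).comap
        ((ρ.restrict (GetToG k n)).restrict (KetToGet k n) |>.act R x).toLinearMap from hle hm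
    conv_lhs => rw [Submodule.baseChange_span]
    rw [Submodule.span_le]
    rintro _ ⟨w, hw, rfl⟩
    obtain ⟨i, hi, rfl⟩ := Finset.mem_image.1 (Finset.mem_coe.1 hw)
    let T : CommAlgCat.{u} k := CommAlgCat.of k (R ⊗[k] O)
    let inl : R →ₐ[k] R ⊗[k] O := Algebra.TensorProduct.includeLeft
    let inr : O →ₐ[k] R ⊗[k] O := Algebra.TensorProduct.includeRight
    let y : G n R := x.1
    have hy : y ∈ K n R := x.2.1
    -- The vector `c i` is the value of the `i`-th coordinate functional of `O` on `g • (1 ⊗ v)`. Acting by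
    -- `y` commutes with this functional, and `y * g` is again a specialization of `g`.
    let Λ : R ⊗[k] O →ₗ[k] R := (TensorProduct.rid k R).toLinearMap ∘ₗ
      LinearMap.lTensor R (b.coord i)
    obtain ⟨ev, hev⟩ := huniv (R ⊗[k] O) (G.map inl.toRingHom y * G.map inr.toRingHom g)
      (mul_mem (K.map_mem _ hy) (K.map_mem _ hg))
    have hT : LinearMap.rTensor V ev.toLinearMap (ρ.act O g (1 ⊗ₜ v)) =
        ρ.act T (G.map inl.toRingHom y)
          (LinearMap.rTensor V inr.toLinearMap (ρ.act O g (1 ⊗ₜ v))) := by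
      rw [hnat, hnat, hev]
      exact congrArg (fun e => e ((1 : T) ⊗ₜ[k] v))
        (map_mul (ρ.act T) (G.map inl.toRingHom y) (G.map inr.toRingHom g))
    have hΛ : ∀ (j) (z : R ⊗[k] V), LinearMap.rTensor V Λ
        (inr (b j) • LinearMap.rTensor V inl.toLinearMap z) = if j = i then z else 0 := by
      intro j z
      induction z using TensorProduct.induction_on with
      | zero => simp
      | tmul r w =>
        simp [inl, inr, Λ, TensorProduct.smul_tmul', Finsupp.single_apply]
        split_ifs <;> simp
      | add z₁ z₂ h₁ h₂ =>
        rw [map_add, smul_add, map_add, h₁, h₂]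
        split_ifs <;> simp
    have hterm : ∀ j, ρ.act T (G.map inl.toRingHom y) (inr (b j) ⊗ₜ c j) =
        inr (b j) • LinearMap.rTensor V inl.toLinearMap (ρ.act R y (1 ⊗ₜ c j)) := by
      intro j
      have h1 := ρ.naturality (CommAlgCat.ofHom inl : R ⟶ T) y (1 ⊗ₜ c j)
      have h2 : LinearMap.rTensor V inl.toLinearMap ((1 : R) ⊗ₜ c j) =
        (1 : T) ⊗ₜ[k] c j := by
        rw [LinearMap.rTensor_tmul, AlgHom.toLinearMap_apply, map_one]
      have h3 : (inr (b j) : T) ⊗ₜ[k] c j = inr (b j) • ((1 : T) ⊗ₜ[k] c j) := by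
        rw [TensorProduct.smul_tmul', smul_eq_mul]
        exact congrArg (· ⊗ₜ[k] c j) (mul_one (inr (b j))).symm
      rw [h3]
      refine (map_smul (ρ.act T (G.map inl.toRingHom y)) _ _).trans ?_
      refine congrArg (inr (b j) • ·) ?_
      rw [← h2]
      exact h1.symm
    rw [← hc, map_sum, map_sum] at hT
    have hT2 := hT.trans ((map_sum (ρ.act T (G.map inl.toRingHom y)) _ _).trans
      (Finset.sum_congr rfl fun j _ => hterm j))
    have hT3 := congrArg (LinearMap.rTensor V Λ) hT2
    rw [map_sum, map_sum, Finset.sum_congr rfl fun j _ => hΛ j _, Finset.sum_ite_eq', if_pos hi]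
      at hT3
    change ρ.act R y (1 ⊗ₜ c i) ∈ W.baseChange R
    rw [← hT3]
    exact Submodule.sum_mem _ fun j hj => Submodule.tmul_mem_baseChange_of_mem _ (hcW j hj)

end Representations

/-! ### Extension of representations by continuity -/

section Extension

variable {k : Type u} [Field k] {n : ℕ} {V : Type w} [AddCommGroup V] [Module k V]

/-- If linear automorphisms indexed by `ι` fix each `1 ⊗ v` as soon as the index lies deep enough in a
decreasing filtration, then they fix each tensor as soon as the index lies deep enough. -/
theorem exists_level_tensor {R : Type u} [CommRing R] [Algebra k R] {ι : Type*}
    (e : ι → (R ⊗[k] V) ≃ₗ[R] (R ⊗[k] V)) (s : ℕ → Set ι) (hs : Antitone s)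
    (h : ∀ v : V, ∃ N, ∀ x ∈ s N, e x (1 ⊗ₜ v) = 1 ⊗ₜ v) (m : R ⊗[k] V) :
    ∃ N, ∀ x ∈ s N, e x m = m := by
  induction m using TensorProduct.induction_on with
  | zero => exact ⟨0, fun x _ => map_zero _⟩
  | tmul r v =>
    obtain ⟨N, hN⟩ := h v
    refine ⟨N, fun x hx => ?_⟩
    have hr : r ⊗ₜ[k] v = r • ((1 : R) ⊗ₜ[k] v) := by
      rw [TensorProduct.smul_tmul', smul_eq_mul, mul_one]
    rw [hr, map_smul, hN x hx]
  | add m₁ m₂ h₁ h₂ =>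
    obtain ⟨N₁, hN₁⟩ := h₁
    obtain ⟨N₂, hN₂⟩ := h₂
    refine ⟨max N₁ N₂, fun x hx => ?_⟩
    rw [map_add, hN₁ x (hs (le_max_left _ _) hx), hN₂ x (hs (le_max_right _ _) hx)]

theorem PrestackRep.exists_level_tensor (ρ : PrestackRep (GPrestack k n) V) {R : CommAlgCat.{u} k}
    (m : R ⊗[k] V) : ∃ N, ∀ x : G n R, x ∈ congruence n R N → ρ.act R x m = m :=
  FormalDisc.exists_level_tensor (fun x : G n R => ρ.act R x) (fun N => congruence n R N)
    (fun _ _ h => congruence_anti h)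
    (fun v => (ρ.exists_level v).imp fun _ h x hx => h R x hx) m

theorem IsKetLocallyFinite.exists_level_tensor {ρ : PrestackRep (GetPrestack k n) V}
    (h : IsKetLocallyFinite ρ) {R : CommAlgCat.{u} k} (m : R ⊗[k] V) :
    ∃ N, ∀ x : Get n R, x.1 ∈ congruence n R N → ρ.act R x m = m :=
  FormalDisc.exists_level_tensor (fun x : Get n R => ρ.act R x)
    (fun N => {x : Get n R | x.1 ∈ congruence n R N})
    (fun _ _ h _ hx => congruence_anti h hx)
    (fun v => (h.exists_level v).imp fun _ h x hx => h R x hx) m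

/-- Elements of `G` act like sufficiently close elements of `G^ét`. -/
theorem PrestackRep.exists_act_eq (ρ : PrestackRep (GPrestack k n) V) {R : CommAlgCat.{u} k}
    (g : G n R) (m : R ⊗[k] V) :
    ∃ N, ∀ x : Get n R, x.1⁻¹ * g ∈ congruence n R N →
      (ρ.restrict (GetToG k n)).act R x m = ρ.act R g m := by
  obtain ⟨N, hN⟩ := ρ.exists_level_tensor m
  refine ⟨N, fun x hx => ?_⟩
  have h1 := congrArg (ρ.act R x.1) (hN _ hx)
  have h2 : ρ.act R (x.1 * (x.1⁻¹ * g)) = ρ.act R x.1 * ρ.act R (x.1⁻¹ * g) :=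
    map_mul (ρ.act R) _ _
  rw [mul_inv_cancel_left] at h2
  rw [h2]
  exact h1.symm

/-- A representation of `G` is determined by its restriction to `G^ét`. -/
theorem PrestackRep.restrict_injective {ρ ρ' : PrestackRep (GPrestack k n) V}
    (h : ρ.restrict (GetToG k n) = ρ'.restrict (GetToG k n)) : ρ = ρ' := by
  ext R g m
  change ρ.act R g m = ρ'.act R g m
  obtain ⟨N, hN⟩ := ρ.exists_act_eq g m
  obtain ⟨N', hN'⟩ := ρ'.exists_act_eq g m
  obtain ⟨x, hx, hxg⟩ := exists_mem_Get_inv_mul_mem g (max N N')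
  rw [← hN ⟨x, hx⟩ (congruence_anti (le_max_left _ _) hxg),
    ← hN' ⟨x, hx⟩ (congruence_anti (le_max_right _ _) hxg), h]

variable {ρ : PrestackRep (GetPrestack k n) V} (h : IsKetLocallyFinite ρ)

include h in
/-- The vectors `x • m` for `x` in `G^ét(R)` close to `g ∈ G(R)` have a common value. -/
theorem IsKetLocallyFinite.exists_act_eq {R : CommAlgCat.{u} k} (g : G n R) (m : R ⊗[k] V) :
    ∃ m', ∃ N, ∀ x : Get n R, x.1⁻¹ * g ∈ congruence n R N → ρ.act R x m = m' := by
  obtain ⟨N, hN⟩ := h.exists_level_tensor m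
  obtain ⟨y, hy, hyg⟩ := exists_mem_Get_inv_mul_mem g N
  refine ⟨ρ.act R (⟨y, hy⟩ : Get n R) m, N, fun x hx => ?_⟩
  let y' : Get n R := ⟨y, hy⟩
  have h1 : (y'⁻¹ * x).1 ∈ congruence n R N := by
    have := mul_mem hyg (inv_mem hx)
    convert this using 1
    change y⁻¹ * x.1 = y⁻¹ * g * (x.1⁻¹ * g)⁻¹
    group
  have h2 := congrArg (ρ.act R y') (hN _ h1)
  have h3 : ρ.act R (y' * (y'⁻¹ * x)) = ρ.act R y' * ρ.act R (y'⁻¹ * x) := map_mul (ρ.act R) _ _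
  rw [mul_inv_cancel_left] at h3
  rw [h3]
  exact h2

/-- The action of `G(R)` extending by continuity a `K^ét`-locally-finite action of `G^ét(R)`. -/
def extendAct {R : CommAlgCat.{u} k} (g : G n R) (m : R ⊗[k] V) : R ⊗[k] V :=
  (h.exists_act_eq g m).choose

theorem exists_act_eq_extendAct {R : CommAlgCat.{u} k} (g : G n R) (m : R ⊗[k] V) :
    ∃ N, ∀ x : Get n R, x.1⁻¹ * g ∈ congruence n R N → ρ.act R x m = extendAct h g m :=
  (h.exists_act_eq g m).choose_spec

theorem extendAct_coe {R : CommAlgCat.{u} k} (x : Get n R) (m : R ⊗[k] V) :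
    extendAct h x.1 m = ρ.act R x m := by
  obtain ⟨N, hN⟩ := exists_act_eq_extendAct h x.1 m
  exact (hN x (by rw [inv_mul_cancel]; exact one_mem _)).symm

theorem extendAct_add {R : CommAlgCat.{u} k} (g : G n R) (m₁ m₂ : R ⊗[k] V) :
    extendAct h g (m₁ + m₂) = extendAct h g m₁ + extendAct h g m₂ := by
  obtain ⟨N₁, h₁⟩ := exists_act_eq_extendAct h g m₁
  obtain ⟨N₂, h₂⟩ := exists_act_eq_extendAct h g m₂
  obtain ⟨N₃, h₃⟩ := exists_act_eq_extendAct h g (m₁ + m₂)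
  obtain ⟨x, hx, hxg⟩ := exists_mem_Get_inv_mul_mem g (max N₁ (max N₂ N₃))
  rw [← h₁ ⟨x, hx⟩ (congruence_anti (by omega) hxg), ← h₂ ⟨x, hx⟩ (congruence_anti (by omega) hxg),
    ← h₃ ⟨x, hx⟩ (congruence_anti (by omega) hxg), map_add]

theorem extendAct_smul {R : CommAlgCat.{u} k} (g : G n R) (r : R) (m : R ⊗[k] V) :
    extendAct h g (r • m) = r • extendAct h g m := by
  obtain ⟨N₁, h₁⟩ := exists_act_eq_extendAct h g m
  obtain ⟨N₂, h₂⟩ := exists_act_eq_extendAct h g (r • m)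
  obtain ⟨x, hx, hxg⟩ := exists_mem_Get_inv_mul_mem g (max N₁ N₂)
  rw [← h₁ ⟨x, hx⟩ (congruence_anti (by omega) hxg), ← h₂ ⟨x, hx⟩ (congruence_anti (by omega) hxg),
    map_smul]

theorem extendAct_one {R : CommAlgCat.{u} k} (m : R ⊗[k] V) :
    extendAct h (1 : G n R) m = m := by
  have h1 : ρ.act R (1 : Get n R) = 1 := map_one (ρ.act R)
  have h2 := extendAct_coe h (1 : Get n R) m
  rw [h1] at h2
  exact h2

theorem extendAct_mul {R : CommAlgCat.{u} k} (g₁ g₂ : G n R) (m : R ⊗[k] V) :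
    extendAct h (g₁ * g₂) m = extendAct h g₁ (extendAct h g₂ m) := by
  obtain ⟨N, hN⟩ := exists_act_eq_extendAct h (g₁ * g₂) m
  obtain ⟨N₂, h₂⟩ := exists_act_eq_extendAct h g₂ m
  obtain ⟨x₂, hx₂, hxg₂⟩ := exists_mem_Get_inv_mul_mem g₂ (max N N₂)
  obtain ⟨N₁, h₁⟩ := exists_act_eq_extendAct h g₁ (extendAct h g₂ m)
  -- `(x₁ x₂)⁻¹ (g₁ g₂)` is the product of `x₂⁻¹ (x₁⁻¹ g₁) x₂` and `x₂⁻¹ g₂`.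
  obtain ⟨M, hM⟩ := exists_conj_mem_congruence x₂ N
  obtain ⟨x₁, hx₁, hxg₁⟩ := exists_mem_Get_inv_mul_mem g₁ (max M N₁)
  let y₁ : Get n R := ⟨x₁, hx₁⟩
  let y₂ : Get n R := ⟨x₂, hx₂⟩
  have h3 : (y₁ * y₂).1⁻¹ * (g₁ * g₂) ∈ congruence n R N := by
    have := mul_mem (hM _ (congruence_anti (le_max_left _ _) hxg₁))
      (congruence_anti (le_max_left _ _) hxg₂)
    convert this using 1
    change (x₁ * x₂)⁻¹ * (g₁ * g₂) = _
    group
  have h4 : ρ.act R (y₁ * y₂) = ρ.act R y₁ * ρ.act R y₂ := map_mul (ρ.act R) _ _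
  rw [← hN _ h3, h4, ← h₁ y₁ (congruence_anti (le_max_right _ _) hxg₁),
    ← h₂ y₂ (congruence_anti (le_max_right _ _) hxg₂)]
  rfl

theorem map_inv_mul_map_mem_congruence {R R' : Type u} [CommRing R] [CommRing R'] (f : R →+* R')
    {N : ℕ} (hN : N ≠ 0) {g₁ g₂ : G n R} (hg : g₁⁻¹ * g₂ ∈ congruence n R N) :
    (G.map f g₁)⁻¹ * G.map f g₂ ∈ congruence n R' N := by
  simpa only [map_mul, map_inv] using congruence_map_mem f hN hg

/-- A `K^ét`-locally-finite representation of `G^ét` extends to a representation of `G`. -/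
def extendRep : PrestackRep (GPrestack k n) V where
  act R := (LinearMap.GeneralLinearGroup.generalLinearEquiv R (R ⊗[k] V)).toMonoidHom.comp
    (MonoidHom.toHomUnits (G := G n R)
      { toFun := fun g =>
          { toFun := extendAct h g
            map_add' := extendAct_add h g
            map_smul' := extendAct_smul h g }
        map_one' := LinearMap.ext fun m => extendAct_one h m
        map_mul' := fun g₁ g₂ => LinearMap.ext fun m => extendAct_mul h g₁ g₂ m })
  naturality {R R'} f g m := by
    change LinearMap.rTensor V f.hom.toLinearMap (extendAct h g m) =
      extendAct h (G.map f.hom.toRingHom g) (LinearMap.rTensor V f.hom.toLinearMap m)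
    obtain ⟨N₁, h₁⟩ := exists_act_eq_extendAct h g m
    obtain ⟨N₂, h₂⟩ := exists_act_eq_extendAct h (G.map f.hom.toRingHom g)
      (LinearMap.rTensor V f.hom.toLinearMap m)
    obtain ⟨x, hx, hxg⟩ := exists_mem_Get_inv_mul_mem g (N₁ + N₂ + 1)
    rw [← h₁ ⟨x, hx⟩ (congruence_anti (by omega) hxg),
      ← h₂ ⟨_, Get.map_mem f.hom.toRingHom hx⟩]
    · exact ρ.naturality f _ m
    · exact congruence_anti (by omega)
        (map_inv_mul_map_mem_congruence f.hom.toRingHom (Nat.succ_ne_zero _) hxg)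

theorem extendRep_restrict : (extendRep h).restrict (GetToG k n) = ρ := by
  ext R x m
  exact extendAct_coe h x m

end Extension

section Category

variable {k : Type u} [Field k] {n : ℕ}

/-- A linear map commuting with `G^ét` commutes with `G`. -/
theorem comm_of_comm_Get {X Y : RepCat.{u, w} (GPrestack k n)}
    (f : (Res k n).obj X ⟶ (Res k n).obj Y) (R : CommAlgCat.{u} k) (g : G n R) (m : R ⊗[k] X.V) :
    f.lin.baseChange R (X.rep.act R g m) = Y.rep.act R g (f.lin.baseChange R m) := by
  obtain ⟨N, hN⟩ := X.rep.exists_act_eq g m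
  obtain ⟨M, hM⟩ := Y.rep.exists_act_eq g (f.lin.baseChange R m)
  obtain ⟨x, hx, hxg⟩ := exists_mem_Get_inv_mul_mem g (max N M)
  rw [← hN ⟨x, hx⟩ (congruence_anti (le_max_left _ _) hxg),
    ← hM ⟨x, hx⟩ (congruence_anti (le_max_right _ _) hxg)]
  exact f.comm R _ m

theorem IsKetLocallyFinite.of_iso {X Y : RepCat.{u, w} (GetPrestack k n)} (e : X ≅ Y)
    (h : IsKetLocallyFinite X.rep) : IsKetLocallyFinite Y.rep := by
  intro v
  obtain ⟨W, _, hv, hW⟩ := h (e.inv.lin v)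
  refine ⟨W.map e.hom.lin, inferInstance, ⟨_, hv, ?_⟩, ?_⟩
  · exact congrArg (fun f : Y ⟶ Y => f.lin v) e.inv_hom_id
  · have hmem : ∀ R : CommAlgCat.{u} k, ∀ m ∈ W.baseChange R,
        e.hom.lin.baseChange R m ∈ (W.map e.hom.lin).baseChange R := by
      rintro R _ ⟨m, rfl⟩
      induction m using TensorProduct.induction_on with
      | zero => simp
      | tmul r w => simpa using Submodule.tmul_mem_baseChange_of_mem r (Submodule.mem_map_of_mem w.2)
      | add m₁ m₂ h₁ h₂ =>
        rw [map_add, map_add]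
        exact add_mem h₁ h₂
    intro R x m hm
    have hm' : ∃ m₀ ∈ W.baseChange R, e.hom.lin.baseChange R m₀ = m := by
      obtain ⟨m, rfl⟩ := hm
      induction m using TensorProduct.induction_on with
      | zero => exact ⟨0, zero_mem _, by simp⟩
      | tmul r w =>
        obtain ⟨_, w, hw, rfl⟩ := w
        exact ⟨r ⊗ₜ w, Submodule.tmul_mem_baseChange_of_mem r hw, by simp⟩
      | add m₁ m₂ h₁ h₂ =>
        obtain ⟨a₁, ha₁, e₁⟩ := h₁
        obtain ⟨a₂, ha₂, e₂⟩ := h₂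
        exact ⟨a₁ + a₂, add_mem ha₁ ha₂, by rw [map_add, map_add, e₁, e₂]⟩
    obtain ⟨m₀, hm₀, rfl⟩ := hm'
    have := hmem R _ (hW R x m₀ hm₀)
    rw [show e.hom.lin.baseChange R (((X.rep.restrict (KetToGet k n)).act R x) m₀) = _ from
      e.hom.comm R _ m₀] at this
    exact this

end Category

end FormalDisc

end

theorem mainTheorem6 (k : Type u) [Field k] [IsAlgClosed k] [CharZero k] (n : ℕ) :
    (FormalDisc.Res.{u, w} k n).Full ∧ (FormalDisc.Res.{u, w} k n).Faithful ∧
    (∀ X : FormalDisc.RepCat.{u, w} (FormalDisc.GetPrestack k n),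
      (FormalDisc.Res.{u, w} k n).essImage X ↔ FormalDisc.IsKetLocallyFinite X.rep) ∧
    (∀ (V : Type w) [AddCommGroup V] [Module k V]
      (ρ : FormalDisc.PrestackRep (FormalDisc.GetPrestack k n) V),
      FormalDisc.IsKetLocallyFinite ρ →
        ∃! ρ' : FormalDisc.PrestackRep (FormalDisc.GPrestack k n) V,
          ρ'.restrict (FormalDisc.GetToG k n) = ρ) := by
  refine ⟨⟨fun {X Y} f => ⟨⟨f.lin, FormalDisc.comm_of_comm_Get f⟩, rfl⟩⟩, ⟨fun {X Y f g} h => ?_⟩,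
    fun X => ⟨?_, fun h => ?_⟩, fun V _ _ ρ h => ?_⟩
  · exact FormalDisc.RepCat.Hom.ext (congrArg (fun f : (FormalDisc.Res k n).obj X ⟶
      (FormalDisc.Res k n).obj Y => f.lin) h)
  · rintro ⟨Y, ⟨e⟩⟩
    exact .of_iso e Y.rep.isKetLocallyFinite_restrict
  · refine ⟨⟨X.V, FormalDisc.extendRep h⟩, ⟨eqToIso ?_⟩⟩
    exact congrArg (FormalDisc.RepCat.mk X.V) (FormalDisc.extendRep_restrict h)
  · exact ⟨FormalDisc.extendRep h, FormalDisc.extendRep_restrict h, fun ρ' hρ' =>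
      FormalDisc.PrestackRep.restrict_injective (hρ'.trans (FormalDisc.extendRep_restrict h).symm)⟩
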